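/- Compositions are written from right to left; monoidal categories are strict, with unit object $\mathbf 1$; $\mathrm{id}$ is the identity of a single object $H$ and $\mathrm{id}_n$ that of $H^n=H^{\otimes n}$. **The category $4\mathrm{Alg}$.** A BP Hopf algebra in a braided monoidal category with braiding $c$ is an object $H$ with morphisms $\mu:H\otimes H\to H$, $\eta:\mathbf 1\to H$, $\Delta:H\to H\otimes H$, $\varepsilon:H\to\mathbf 1$, $S,S^{-1}:H\to H$, $\lambda:H\to\mathbf 1$, $\Lambda:\mathbf 1\to H$, $\tau,\tau^{-1}:H\to H$, $w:\mathbf 1\to H\otimes H$ such that - $(H,\mu,\eta)$ is an algebra, $(H,\Delta,\varepsilon)$ is a coalgebra, $(\mu\otimes\mu)(\mathrm{id}\otimes c\otimes\mathrm{id})(\Delta\otimes\Delta)=\Delta\mu$, $\varepsilon\mu=\varepsilon\otimes\varepsilon$, $\Delta\eta=\eta\otimes\eta$, $\varepsilon\eta=\mathrm{id}_{\mathbf 1}$, $\mu(S\otimes\mathrm{id})\Delta=\eta\varepsilon=\mu(\mathrm{id}\otimes S)\Delta$, and $S^{-1}$ is a two-sided inverse of $S$; - $(\mathrm{id}\otimes\lambda)\Delta=\eta\lambda$,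 $\mu(\Lambda\otimes\mathrm{id})=\Lambda\varepsilon$, $\lambda\Lambda=\mathrm{id}_{\mathbf 1}$, $S\Lambda=\Lambda$, $\lambda S=\lambda$; - $\tau^{-1}$ is a two-sided inverse of $\tau$, $S\tau=\tau S$, $\varepsilon\tau=\varepsilon$, $\mu(\tau\otimes\mathrm{id})=\tau\mu$; - $w=(\tau\otimes\tau)\Delta\tau^{-1}\eta$, $(\mathrm{id}\otimes\Delta)w=(\mu\otimes\mathrm{id}_2)(\mathrm{id}\otimes w\otimes\mathrm{id})w$, $\Delta\tau^{-1}=(\tau^{-1}\otimes\tau^{-1})\,\Omega\,c^{-1}\Delta$, and $(\mu\otimes\mu)(S\otimes(\Omega c^{-1}\Omega)\otimes S)(\rho_L\otimes\rho_R)=c$, where $\Omega=(\mu\otimes\mu)(\mathrm{id}\otimes w\otimes\mathrm{id})$, $\rho_L=(\mathrm{id}\otimes\mu)(w\otimes\mathrm{id})$, $\rho_R=(\mu\otimes\mathrm{id})(\mathrm{id}\otimes w)$. $4\mathrm{Alg}$ is the strict braided monoidal category freely generated by a BP Hopf algebra $H$; its objects are $H^n$, $n\ge 0$, and $c_{m,n}:H^m\otimes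 H^n\to H^n\otimes H^m$ is its braiding. In $4\mathrm{Alg}$ put $$\mathrm{ev}=\lambda\mu(\mathrm{id}\otimes S),\quad \mathrm{coev}=\Delta\Lambda,\quad W=(\mu\otimes\tau)(\mathrm{id}\otimes\mathrm{coev}),\quad \bar W=\mu(\tau^{-1}\otimes S),\quad \bar w=(S\otimes\mathrm{id})w,$$ $$\Theta'_0=\varepsilon,\quad \Theta'_{n}=(\Theta'_{n-1}\otimes\mu)(\mathrm{id}\otimes c_{1,n-1}\otimes\mathrm{id})(\Delta\otimes\mathrm{id}_{n})\ (n\ge1),\quad U_n=\Theta'_n(\Lambda\otimes\mathrm{id}_n):H^n\to H^n,$$ and define the decorated crossings $H\otimes H\to H\otimes H$ by $$X=c\,(\mu\otimes\mu)(\mathrm{id}\otimes\bar w\otimes\mathrm{id}),\qquad Y=\Omega\, c^{-1},$$ $$\hat X=(\mathrm{id}\otimes\mu)(X\otimes\mathrm{id})(\mathrm{id}\otimes\mu\otimes\mathrm{id})(\mathrm{id}_2\otimes w),\qquad \hat Y=(\mathrm{id}\otimes\mu)(Y\otimes\mathrm{id})(\mathrm{id}\otimes\mu\otimes\mathrm{id})(\mathrm{id}_2\otimes\bar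 w).$$ **The category $\mathrm{MAlg}$.** Let $\mathrm{MAlg}^{\mathrm F}$ be the strict monoidal category freely generated by objects $H_i$, $i\ge0$, and morphisms $\mathrm{ev}_i:H_i\otimes H_i\to\mathbf 1$, $\Delta_i:H_i\to H_i\otimes H_i$, $\varepsilon_i:H_i\to\mathbf 1$, $\Lambda_i:\mathbf 1\to H_i$, $\tau_i:H_i\to H_i$, $W_i:H_0\to H_i\otimes H_i$, $\bar W_i:H_i\otimes H_i\to H_0$ for $i\ge1$; $X_{i,j},\hat Y_{i,j}:H_i\otimes H_j\to H_j\otimes H_i$ for $1\le i\le j$; $\hat X_{i,j},Y_{i,j}:H_i\otimes H_j\to H_j\otimes H_i$ for $i\ge j\ge1$; and $U_{i_1,\dots,i_n}:H_{i_1}\otimes\cdots\otimes H_{i_n}\to H_{i_1}\otimes\cdots\otimes H_{i_n}$ for $n\ge1$ and $i_1,\dots,i_n\ge1$. Let $\mathcal F:\mathrm{MAlg}^{\mathrm F}\to4\mathrm{Alg}$ be the strict monoidal functor that discards labels: $H_i\mapsto H$, $U_{i_1,\dots,i_n}\mapsto U_n$, and every other generator goes to the morphism of the same name without indices. Let $\mathrm{MAlg}=\mathrm{MAlg}^{\mathrm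 F}/\ker\mathcal F$ be the category with the same objects in which two parallel morphisms are identified when $\mathcal F$ takes the same value on them, let $\pi:\mathrm{MAlg}^{\mathrm F}\to\mathrm{MAlg}$ be the projection, and write $\mathcal F:\mathrm{MAlg}\to4\mathrm{Alg}$ also for the induced functor. For a word $\underline i=(i_1,\dots,i_\ell)$, $\ell\ge 0$, of integers $i_h\ge 0$, put $H_{\underline i}=H_{i_1}\otimes\cdots\otimes H_{i_\ell}$. Fix $k\ge1$. **Exchange of labels.** Let $\sigma_k:\mathrm{MAlg}^{\mathrm F}\to\mathrm{MAlg}^{\mathrm F}$ be the strict monoidal functor that exchanges $H_k$ with $H_{k+1}$ and fixes the other $H_i$, exchanges $X_{k,k+1}$ with $\hat X_{k+1,k}$ and $\hat Y_{k,k+1}$ with $Y_{k+1,k}$, and sends any other generator to the generator of the same name in whose labels $k$ and $k+1$ are exchanged. **The families $\hat\Theta^{\mathrm L}_k$ and $\Omega_k$.** For words $\underline i=(i_1,\underline i')$ of length $\ell\ge 1$ with $\underline i'=(i_2,\dots,i_\ell)$, define recursively morphisms of $4\mathrm{Alg}$, $\hat\gamma_{\underline i,k}:H^\ell\otimes H\to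 H\otimes H^\ell$ and $\hat\Theta^{\mathrm L}_{\underline i,k},\check\Theta^{\mathrm L}_{\underline i,k}:H^\ell\otimes H\to H^\ell$, by $\hat\gamma_{\varnothing,k}=\mathrm{id}$, $\hat\Theta^{\mathrm L}_{\varnothing,k}=\check\Theta^{\mathrm L}_{\varnothing,k}=\varepsilon$, $$\hat\gamma_{(i),k}=\begin{cases}c&i\le k\\X&i=k+1\\\hat X&i>k+1,\end{cases}\qquad \hat\Theta^{\mathrm L}_{(i),k}=\begin{cases}\mu&i=k\\\mathrm{id}\otimes\varepsilon&i\ne k,\end{cases}\qquad \check\Theta^{\mathrm L}_{(i),k}=\begin{cases}\mu(\mathrm{id}\otimes S)&i=k\\\mathrm{id}\otimes\varepsilon&i\ne k,\end{cases}$$ $$\hat\gamma_{\underline i,k}=(\hat\gamma_{(i_1),k}\otimes\mathrm{id}_{\ell-1})(\mathrm{id}\otimes\hat\gamma_{\underline i',k}),\qquad \hat\Theta^{\mathrm L}_{\underline i,k}=(\hat\Theta^{\mathrm L}_{(i_1),k}\otimes\hat\Theta^{\mathrm L}_{\underline i',k})(\mathrm{id}\otimes\hat\gamma_{\underline i',k}\otimes\mathrm{id})(\mathrm{id}_\ell\otimes\Delta),$$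 $$\check\Theta^{\mathrm L}_{\underline i,k}=(\check\Theta^{\mathrm L}_{(i_1),k}\otimes\mathrm{id}_{\ell-1})(\mathrm{id}\otimes\hat\gamma_{\underline i',k})(\mathrm{id}\otimes\check\Theta^{\mathrm L}_{\underline i',k}\otimes\mathrm{id})(\mathrm{id}_\ell\otimes\Delta),$$ and put $\Omega_{\underline i,k}=\hat\Theta^{\mathrm L}_{\underline i,k}(\mathrm{id}_\ell\otimes\eta)$ and $\Omega^{-1}_{\underline i,k}=\check\Theta^{\mathrm L}_{\underline i,k}(\mathrm{id}_\ell\otimes\eta)$, both $H^\ell\to H^\ell$. **Proposition.** For every $k\ge1$: 1. There is a unique functor $\hat{\mathcal F}_k:\mathrm{MAlg}\to4\mathrm{Alg}$ with $\hat{\mathcal F}_k\circ\pi=\mathcal F\circ\sigma_k$, that is, a unique functor that first exchanges labels as above and then discards them. 2. The morphisms $\hat\Theta^{\mathrm L}_{\underline i,k}:\mathcal F(H_{\underline i})\otimes H\to\hat{\mathcal F}_k(H_{\underline i})$ form a natural transformation $\hat\Theta^{\mathrm L}_k:\mathcal F\otimes H\Rightarrow\hat{\mathcal F}_k$: for every morphism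 $f:H_{\underline i}\to H_{\underline j}$ of $\mathrm{MAlg}$, $\hat\Theta^{\mathrm L}_{\underline j,k}(\mathcal F(f)\otimes\mathrm{id})=\hat{\mathcal F}_k(f)\,\hat\Theta^{\mathrm L}_{\underline i,k}$. 3. The morphisms $\Omega_{\underline i,k}:\mathcal F(H_{\underline i})\to\hat{\mathcal F}_k(H_{\underline i})$ form a natural isomorphism $\mathcal F\cong\hat{\mathcal F}_k$, and the inverse of $\Omega_{\underline i,k}$ is $\Omega^{-1}_{\underline i,k}$. -/

import Mathlib

open CategoryTheory MonoidalCategory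

/-! ## Strict monoidal categories presented by generators and relations -/

namespace StrictPres

/-- Formal morphisms over a family `G` of generating morphisms; the objects form a monoid `M`, whose
operation `+` is the tensor product on objects. Composition is written in diagrammatic order. -/
inductive Term {M : Type} [AddMonoid M] (G : M → M → Type) : M → M → Type
  | id (a : M) : Term G a a
  | comp {a b c : M} (f : Term G a b) (g : Term G b c) : Term G a c
  | tensor {a b c d : M} (f : Term G a b) (g : Term G c d) : Term G (a + c) (b + d)
  | gen {a b : M} (x : G a b) : Term G a b

section

variable {M : Type} [AddMonoid M] {G : M → M → Type}

/-- The identity morphism, seen as a morphism between two objects that are equal. -/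
def Term.ofEq {a b : M} (h : a = b) : Term G a b := h ▸ Term.id a

/-- The congruence on formal morphisms generated by the axioms of strict monoidal categories and by
a given family `R` of relations. -/
inductive Term.Rel (R : ∀ a b : M, Term G a b → Term G a b → Prop) :
    ∀ {a b : M}, Term G a b → Term G a b → Prop
  | refl {a b : M} (f : Term G a b) : Term.Rel R f f
  | symm {a b : M} {f g : Term G a b} : Term.Rel R f g → Term.Rel R g f
  | trans {a b : M} {f g h : Term G a b} : Term.Rel R f g → Term.Rel R g h → Term.Rel R f h
  | comp {a b c : M} {f f' : Term G a b} {g g' : Term G b c} :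
      Term.Rel R f f' → Term.Rel R g g' → Term.Rel R (.comp f g) (.comp f' g')
  | tensor {a b c d : M} {f f' : Term G a b} {g g' : Term G c d} :
      Term.Rel R f f' → Term.Rel R g g' → Term.Rel R (.tensor f g) (.tensor f' g')
  | id_comp {a b : M} (f : Term G a b) : Term.Rel R (.comp (.id a) f) f
  | comp_id {a b : M} (f : Term G a b) : Term.Rel R (.comp f (.id b)) f
  | assoc {a b c d : M} (f : Term G a b) (g : Term G b c) (h : Term G c d) :
      Term.Rel R (.comp (.comp f g) h) (.comp f (.comp g h))
  | id_tensor_id (a b : M) : Term.Rel R (.tensor (.id a) (.id b)) (.id (a + b))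
  | tensor_comp {a b c a' b' c' : M} (f : Term G a b) (g : Term G b c)
      (f' : Term G a' b') (g' : Term G b' c') :
      Term.Rel R (.tensor (.comp f g) (.comp f' g')) (.comp (.tensor f f') (.tensor g g'))
  | tensor_assoc {a b c a' b' c' : M} (f : Term G a a') (g : Term G b b') (h : Term G c c') :
      Term.Rel R (.comp (.tensor (.tensor f g) h) (.ofEq (add_assoc a' b' c')))
        (.comp (.ofEq (add_assoc a b c)) (.tensor f (.tensor g h)))
  | unit_tensor {a b : M} (f : Term G a b) :
      Term.Rel R (.comp (.tensor (.id 0) f) (.ofEq (zero_add b))) (.comp (.ofEq (zero_add a)) f)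
  | tensor_unit {a b : M} (f : Term G a b) :
      Term.Rel R (.comp (.tensor f (.id 0)) (.ofEq (add_zero b))) (.comp (.ofEq (add_zero a)) f)
  | rel {a b : M} {f g : Term G a b} : R a b f g → Term.Rel R f g

/-- Formal morphisms modulo the congruence generated by `R`. -/
def Term.setoid (R : ∀ a b : M, Term G a b → Term G a b → Prop) (a b : M) :
    Setoid (Term G a b) where
  r f g := Term.Rel R f g
  iseqv := ⟨.refl, .symm, .trans⟩

end

/-- The strict monoidal category with object monoid `M`, generated by the morphisms in `G` subject
to the relations in `R`. -/
structure Pres {M : Type} [AddMonoid M] (G : M → M → Type)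
    (R : ∀ a b : M, Term G a b → Term G a b → Prop) : Type where
  /-- The underlying element of the monoid of objects. -/
  as : M

namespace Pres

variable {M : Type} [AddMonoid M] {G : M → M → Type}
  {R : ∀ a b : M, Term G a b → Term G a b → Prop}

instance : Category (Pres G R) where
  Hom X Y := Quotient (Term.setoid R X.as Y.as)
  id X := Quotient.mk _ (.id X.as)
  comp f g := Quotient.map₂ Term.comp (fun _ _ h _ _ h' => Term.Rel.comp h h') f g
  id_comp f := Quotient.inductionOn f fun f => Quotient.sound (.id_comp f)
  comp_id f := Quotient.inductionOn f fun f => Quotient.sound (.comp_id f)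
  assoc f g h := Quotient.inductionOn₃ f g h fun f g h => Quotient.sound (.assoc f g h)

/-- The morphism represented by a formal morphism. -/
def hom {a b : M} (f : Term G a b) : (⟨a⟩ : Pres G R) ⟶ ⟨b⟩ := Quotient.mk (Term.setoid R a b) f

theorem hom_eq {a b : M} {f g : Term G a b} (h : Term.Rel R f g) :
    (hom f : (⟨a⟩ : Pres G R) ⟶ ⟨b⟩) = hom g := Quotient.sound h

theorem hom_surj {X Y : Pres G R} (f : X ⟶ Y) : ∃ t : Term G X.as Y.as, f = hom t :=
  Quotient.inductionOn f fun t => ⟨t, rfl⟩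

theorem hom_id (a : M) : (hom (.id a) : (⟨a⟩ : Pres G R) ⟶ ⟨a⟩) = 𝟙 _ := rfl

theorem hom_comp {a b c : M} (f : Term G a b) (g : Term G b c) :
    (hom (.comp f g) : (⟨a⟩ : Pres G R) ⟶ ⟨c⟩) = hom f ≫ hom g := rfl

theorem hom_ofEq {a b : M} (h : a = b) :
    (hom (.ofEq h) : (⟨a⟩ : Pres G R) ⟶ ⟨b⟩) = eqToHom (congrArg Pres.mk h) := by
  subst h; rfl

/-- Tensor product of morphisms. -/
def tensorMor {X Y Z W : Pres G R} (f : X ⟶ Y) (g : Z ⟶ W) :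
    (⟨X.as + Z.as⟩ : Pres G R) ⟶ ⟨Y.as + W.as⟩ :=
  Quotient.map₂ Term.tensor (fun _ _ h _ _ h' => Term.Rel.tensor h h') f g

/-- The tensor product is the sum of the underlying elements; the associators and unitors are
identities, up to the equalities between objects that hold in the monoid `M`. -/
instance : MonoidalCategoryStruct (Pres G R) where
  tensorObj X Y := ⟨X.as + Y.as⟩
  tensorUnit := ⟨0⟩
  tensorHom f g := tensorMor f g
  whiskerLeft X _ _ f := tensorMor (𝟙 X) f
  whiskerRight f X := tensorMor f (𝟙 X)
  associator X Y Z := eqToIso (congrArg Pres.mk (add_assoc X.as Y.as Z.as))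
  leftUnitor X := eqToIso (congrArg Pres.mk (zero_add X.as))
  rightUnitor X := eqToIso (congrArg Pres.mk (add_zero X.as))

theorem hom_tensor {a b c d : M} (f : Term G a b) (g : Term G c d) :
    (hom (.tensor f g) : (⟨a + c⟩ : Pres G R) ⟶ ⟨b + d⟩) =
      MonoidalCategoryStruct.tensorHom (C := Pres G R) (hom f) (hom g) := rfl

theorem id_tensorMor_id (X Y : Pres G R) :
    tensorMor (𝟙 X) (𝟙 Y) = 𝟙 (⟨X.as + Y.as⟩ : Pres G R) :=
  hom_eq (.id_tensor_id X.as Y.as)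

theorem eqToHom_tensorMor_id {a b : M} (h : a = b) (c : M) :
    tensorMor (eqToHom (congrArg Pres.mk h) : (⟨a⟩ : Pres G R) ⟶ ⟨b⟩) (𝟙 (⟨c⟩ : Pres G R)) =
      eqToHom (congrArg Pres.mk (congrArg (· + c) h)) := by
  subst h; exact id_tensorMor_id _ _

theorem id_tensorMor_eqToHom {a b : M} (h : a = b) (c : M) :
    tensorMor (𝟙 (⟨c⟩ : Pres G R)) (eqToHom (congrArg Pres.mk h) : (⟨a⟩ : Pres G R) ⟶ ⟨b⟩) =
      eqToHom (congrArg Pres.mk (congrArg (c + ·) h)) := by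
  subst h; exact id_tensorMor_id _ _

theorem eqToHom_pentagon {C : Type} [Category C] {a b c d e : C} (h₁ : a = b) (h₂ : b = c)
    (h₃ : c = d) (h₄ : a = e) (h₅ : e = d) :
    eqToHom h₁ ≫ eqToHom h₂ ≫ eqToHom h₃ = eqToHom h₄ ≫ eqToHom h₅ := by
  simp

theorem tensorMor_heq {X X' Y Y' Z Z' W W' : Pres G R} (hX : X = X') (hY : Y = Y') (hZ : Z = Z')
    (hW : W = W') {f : X ⟶ Y} {f' : X' ⟶ Y'} {g : Z ⟶ W} {g' : Z' ⟶ W'} (hf : HEq f f')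
    (hg : HEq g g') : HEq (tensorMor f g) (tensorMor f' g') := by
  subst hX hY hZ hW hf hg
  rfl

instance : MonoidalCategory (Pres G R) :=
  MonoidalCategory.ofTensorHom
    (id_tensorHom_id := fun X Y => id_tensorMor_id X Y)
    (id_tensorHom := fun _ _ _ _ => rfl)
    (tensorHom_id := fun _ _ => rfl)
    (tensorHom_comp_tensorHom := fun f₁ f₂ g₁ g₂ => by
      obtain ⟨f₁, rfl⟩ := hom_surj f₁
      obtain ⟨f₂, rfl⟩ := hom_surj f₂
      obtain ⟨g₁, rfl⟩ := hom_surj g₁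
      obtain ⟨g₂, rfl⟩ := hom_surj g₂
      exact (hom_eq (.tensor_comp f₁ g₁ f₂ g₂)).symm)
    (associator_naturality := fun {X₁ X₂ X₃ Y₁ Y₂ Y₃} f g h => by
      obtain ⟨f, rfl⟩ := hom_surj f
      obtain ⟨g, rfl⟩ := hom_surj g
      obtain ⟨h, rfl⟩ := hom_surj h
      have := hom_eq (R := R) (.tensor_assoc f g h)
      simp only [hom_comp, hom_ofEq] at this
      exact this)
    (leftUnitor_naturality := fun {X Y} f => by
      obtain ⟨f, rfl⟩ := hom_surj f
      have := hom_eq (R := R) (.unit_tensor f)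
      simp only [hom_comp, hom_ofEq] at this
      exact this)
    (rightUnitor_naturality := fun {X Y} f => by
      obtain ⟨f, rfl⟩ := hom_surj f
      have := hom_eq (R := R) (.tensor_unit f)
      simp only [hom_comp, hom_ofEq] at this
      exact this)
    (pentagon := fun W X Y Z => by
      have e₁ : MonoidalCategoryStruct.tensorHom (C := Pres G R) (α_ W X Y).hom (𝟙 Z) =
          eqToHom (congrArg Pres.mk (congrArg (· + Z.as) (add_assoc W.as X.as Y.as))) :=
        eqToHom_tensorMor_id (add_assoc W.as X.as Y.as) Z.as
      have e₂ : MonoidalCategoryStruct.tensorHom (C := Pres G R) (𝟙 W) (α_ X Y Z).hom =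
          eqToHom (congrArg Pres.mk (congrArg (W.as + ·) (add_assoc X.as Y.as Z.as))) :=
        id_tensorMor_eqToHom (add_assoc X.as Y.as Z.as) W.as
      rw [e₁, e₂]
      exact eqToHom_pentagon _ (congrArg Pres.mk (add_assoc W.as (X.as + Y.as) Z.as)) _
        (congrArg Pres.mk (add_assoc (W.as + X.as) Y.as Z.as))
        (congrArg Pres.mk (add_assoc W.as X.as (Y.as + Z.as))))
    (triangle := fun X Y => by
      have e₁ : MonoidalCategoryStruct.tensorHom (C := Pres G R) (ρ_ X).hom (𝟙 Y) =
          eqToHom (congrArg Pres.mk (congrArg (· + Y.as) (add_zero X.as))) :=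
        eqToHom_tensorMor_id (add_zero X.as) Y.as
      have e₂ : MonoidalCategoryStruct.tensorHom (C := Pres G R) (𝟙 X) (λ_ Y).hom =
          eqToHom (congrArg Pres.mk (congrArg (X.as + ·) (zero_add Y.as))) :=
        id_tensorMor_eqToHom (zero_add Y.as) X.as
      rw [e₁, e₂]
      exact eqToHom_trans (congrArg Pres.mk (add_assoc X.as 0 Y.as)) _)

theorem tensorMor_assoc_heq {X X' Y Y' Z Z' : Pres G R} (f : X ⟶ X') (g : Y ⟶ Y') (h : Z ⟶ Z') :
    HEq (tensorMor (tensorMor f g) h) (tensorMor f (tensorMor g h)) :=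
  (comp_eqToHom_heq _ (congrArg Pres.mk (add_assoc X'.as Y'.as Z'.as))).symm.trans
    ((heq_of_eq (associator_naturality f g h)).trans
      (eqToHom_comp_heq _ (congrArg Pres.mk (add_assoc X.as Y.as Z.as))))

theorem unit_tensorMor_heq {X Y : Pres G R} (f : X ⟶ Y) :
    HEq (tensorMor (𝟙 (⟨0⟩ : Pres G R)) f) f :=
  (comp_eqToHom_heq _ (congrArg Pres.mk (zero_add Y.as))).symm.trans
    ((heq_of_eq (leftUnitor_naturality f)).trans
      (eqToHom_comp_heq _ (congrArg Pres.mk (zero_add X.as))))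

theorem tensorMor_unit_heq {X Y : Pres G R} (f : X ⟶ Y) :
    HEq (tensorMor f (𝟙 (⟨0⟩ : Pres G R))) f :=
  (comp_eqToHom_heq _ (congrArg Pres.mk (add_zero Y.as))).symm.trans
    ((heq_of_eq (rightUnitor_naturality f)).trans
      (eqToHom_comp_heq _ (congrArg Pres.mk (add_zero X.as))))

end Pres

/-- The empty family of relations. -/
def NoRel {M : Type} [AddMonoid M] (G : M → M → Type) :
    ∀ a b : M, Term G a b → Term G a b → Prop := fun _ _ _ _ => False

/-- The strict monoidal category freely generated by the morphisms in `G`. -/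
abbrev Free {M : Type} [AddMonoid M] (G : M → M → Type) : Type := Pres G (NoRel G)

section FreeLift

variable {M : Type} [AddMonoid M] {G : M → M → Type}
  {N : Type} [AddMonoid N] {K : N → N → Type} {R : ∀ a b : N, Term K a b → Term K a b → Prop}

/-- Evaluation of formal morphisms, given a monoid homomorphism on objects and the images of the
generating morphisms. -/
def Term.eval (φ : M →+ N) (γ : ∀ a b : M, G a b → ((⟨φ a⟩ : Pres K R) ⟶ ⟨φ b⟩)) :
    ∀ {a b : M}, Term G a b → ((⟨φ a⟩ : Pres K R) ⟶ ⟨φ b⟩)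
  | _, _, .id _ => 𝟙 _
  | _, _, .comp f g => Term.eval φ γ f ≫ Term.eval φ γ g
  | _, _, .tensor (a := a) (b := b) (c := c) (d := d) f g =>
      eqToHom (congrArg Pres.mk (map_add φ a c)) ≫
        MonoidalCategoryStruct.tensorHom (C := Pres K R) (Term.eval φ γ f) (Term.eval φ γ g) ≫
          eqToHom (congrArg Pres.mk (map_add φ b d).symm)
  | _, _, .gen x => γ _ _ x

theorem id_heq {C : Type} [Category C] {a b : C} (h : a = b) : HEq (𝟙 a) (𝟙 b) := by
  subst h; rfl

theorem Term.eval_ofEq (φ : M →+ N) (γ : ∀ a b : M, G a b → ((⟨φ a⟩ : Pres K R) ⟶ ⟨φ b⟩))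
    {a b : M} (h : a = b) :
    Term.eval φ γ (.ofEq h) = eqToHom (congrArg (fun x => Pres.mk (φ x)) h) := by
  subst h; rfl

theorem Term.eval_tensor_heq (φ : M →+ N)
    (γ : ∀ a b : M, G a b → ((⟨φ a⟩ : Pres K R) ⟶ ⟨φ b⟩)) {a b c d : M} (f : Term G a b)
    (g : Term G c d) :
    HEq (Term.eval φ γ (.tensor f g)) (Pres.tensorMor (Term.eval φ γ f) (Term.eval φ γ g)) :=
  (eqToHom_comp_heq _ _).trans (comp_eqToHom_heq _ _)

theorem Term.eval_rel (φ : M →+ N) (γ : ∀ a b : M, G a b → ((⟨φ a⟩ : Pres K R) ⟶ ⟨φ b⟩))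
    {a b : M} {f g : Term G a b} (h : Term.Rel (NoRel G) f g) :
    Term.eval φ γ f = Term.eval φ γ g := by
  induction h with
  | refl f => rfl
  | symm _ ih => exact ih.symm
  | trans _ _ ih ih' => exact ih.trans ih'
  | comp _ _ ih ih' => simp only [Term.eval, ih, ih']
  | tensor _ _ ih ih' => simp only [Term.eval, ih, ih']
  | id_comp f => exact Category.id_comp _
  | comp_id f => exact Category.comp_id _
  | assoc f g h => exact Category.assoc _ _ _
  | id_tensor_id a b =>
    simp only [Term.eval, id_tensorHom_id]
    exact (congrArg _ (Category.id_comp _)).trans ((eqToHom_trans _ _).trans (eqToHom_refl _ _))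
  | tensor_comp f g f' g' =>
    simp only [Term.eval, Category.assoc, eqToHom_trans_assoc, eqToHom_refl, Category.id_comp,
      ← tensorHom_comp_tensorHom_assoc]
  | @tensor_assoc a b c a' b' c' f g h =>
    refine eq_of_heq ?_
    simp only [Term.eval.eq_2, Term.eval_ofEq]
    refine (comp_eqToHom_heq _ _).trans (HEq.trans ?_ (eqToHom_comp_heq _ _).symm)
    refine (Term.eval_tensor_heq φ γ _ _).trans (HEq.trans ?_ (Term.eval_tensor_heq φ γ _ _).symm)
    exact (Pres.tensorMor_heq (congrArg Pres.mk (map_add φ a b)) (congrArg Pres.mk (map_add φ a' b'))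
        rfl rfl (Term.eval_tensor_heq φ γ _ _) HEq.rfl).trans
      ((Pres.tensorMor_assoc_heq _ _ _).trans
        (Pres.tensorMor_heq rfl rfl (congrArg Pres.mk (map_add φ b c))
          (congrArg Pres.mk (map_add φ b' c')) HEq.rfl (Term.eval_tensor_heq φ γ _ _)).symm)
  | @unit_tensor a b f =>
    refine eq_of_heq ?_
    simp only [Term.eval.eq_2, Term.eval_ofEq]
    refine (comp_eqToHom_heq _ _).trans (HEq.trans ?_ (eqToHom_comp_heq _ _).symm)
    refine (Term.eval_tensor_heq φ γ _ _).trans ?_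
    exact (Pres.tensorMor_heq (congrArg Pres.mk (map_zero φ)) (congrArg Pres.mk (map_zero φ))
      rfl rfl (id_heq (congrArg Pres.mk (map_zero φ))) HEq.rfl).trans (Pres.unit_tensorMor_heq _)
  | @tensor_unit a b f =>
    refine eq_of_heq ?_
    simp only [Term.eval.eq_2, Term.eval_ofEq]
    refine (comp_eqToHom_heq _ _).trans (HEq.trans ?_ (eqToHom_comp_heq _ _).symm)
    refine (Term.eval_tensor_heq φ γ _ _).trans ?_
    exact (Pres.tensorMor_heq rfl rfl (congrArg Pres.mk (map_zero φ))
      (congrArg Pres.mk (map_zero φ)) HEq.rfl (id_heq (congrArg Pres.mk (map_zero φ)))).trans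
        (Pres.tensorMor_unit_heq _)
  | rel h => exact h.elim

/-- The functor out of a free strict monoidal category with given values on the generators; it
respects tensor products. -/
def Free.lift (φ : M →+ N) (γ : ∀ a b : M, G a b → ((⟨φ a⟩ : Pres K R) ⟶ ⟨φ b⟩)) :
    Free G ⥤ Pres K R where
  obj X := ⟨φ X.as⟩
  map f := Quotient.lift (Term.eval φ γ) (fun _ _ h => Term.eval_rel φ γ h) f
  map_id _ := rfl
  map_comp f g := Quotient.inductionOn₂ f g fun _ _ => rfl

end FreeLift

end StrictPres

/-! ## The category `4Alg` freely generated by a BP Hopf algebra -/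

namespace BPHopf

open StrictPres

/-- Generating morphisms of the free strict braided monoidal category on a BP Hopf algebra `H`. The
objects are the tensor powers of `H`, and the object `n : ℕ` is the `n`-fold power; `braid m n` is
the braiding of the `m`-fold power with the `n`-fold power. -/
inductive Gen : ℕ → ℕ → Type
  | braid (m n : ℕ) : Gen (m + n) (n + m)
  | braidInv (m n : ℕ) : Gen (n + m) (m + n)
  | mul : Gen 2 1
  | unit : Gen 0 1
  | comul : Gen 1 2
  | counit : Gen 1 0
  | antipode : Gen 1 1
  | antipodeInv : Gen 1 1
  | integralForm : Gen 1 0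
  | integralElement : Gen 0 1
  | ribbon : Gen 1 1
  | ribbonInv : Gen 1 1
  | copairing : Gen 0 2

section Terms

/-- Composition in diagrammatic order: `f ⨾ g` means first `f`, then `g`. -/
local infixr:60 " ⨾ " => Term.comp

/-- Tensor product of formal morphisms. -/
local infixr:70 " ⊠ " => Term.tensor

/-- The identity of the `n`-fold power. -/
abbrev I (n : ℕ) : Term Gen n n := .id n

/-- The braiding `c`. -/
abbrev br (m n : ℕ) : Term Gen (m + n) (n + m) := .gen (.braid m n)

/-- The inverse braiding. -/
abbrev brInv (m n : ℕ) : Term Gen (n + m) (m + n) := .gen (.braidInv m n)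

/-- The product `μ`. -/
abbrev mu : Term Gen 2 1 := .gen .mul

/-- The unit `η`. -/
abbrev eta : Term Gen 0 1 := .gen .unit

/-- The coproduct `Δ`. -/
abbrev Delta : Term Gen 1 2 := .gen .comul

/-- The counit `ε`. -/
abbrev eps : Term Gen 1 0 := .gen .counit

/-- The antipode `S`. -/
abbrev S : Term Gen 1 1 := .gen .antipode

/-- The inverse antipode. -/
abbrev SInv : Term Gen 1 1 := .gen .antipodeInv

/-- The integral form `λ`. -/
abbrev lam : Term Gen 1 0 := .gen .integralForm

/-- The integral element `Λ`. -/
abbrev Lam : Term Gen 0 1 := .gen .integralElement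

/-- The ribbon morphism `τ`. -/
abbrev tau : Term Gen 1 1 := .gen .ribbon

/-- The inverse ribbon morphism. -/
abbrev tauInv : Term Gen 1 1 := .gen .ribbonInv

/-- The copairing `w`. -/
abbrev w : Term Gen 0 2 := .gen .copairing

/-- The monodromy `Ω = (μ ⊗ μ) ∘ (id ⊗ w ⊗ id)`. -/
def monodromy : Term Gen 2 2 := (I 1 ⊠ w ⊠ I 1) ⨾ (mu ⊠ mu)

/-- The left coaction `ρ_L = (id ⊗ μ) ∘ (w ⊗ id)`. -/
def rhoL : Term Gen 1 2 := (w ⊠ I 1) ⨾ (I 1 ⊠ mu)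

/-- The right coaction `ρ_R = (μ ⊗ id) ∘ (id ⊗ w)`. -/
def rhoR : Term Gen 1 2 := (I 1 ⊠ w) ⨾ (mu ⊠ I 1)

/-- The axioms of a BP Hopf algebra in a strict braided monoidal category. -/
inductive Axioms : ∀ a b : ℕ, Term Gen a b → Term Gen a b → Prop
  | br_brInv (m n : ℕ) : Axioms (m + n) (m + n) (br m n ⨾ brInv m n) (I (m + n))
  | brInv_br (m n : ℕ) : Axioms (n + m) (n + m) (brInv m n ⨾ br m n) (I (n + m))
  | br_natural {a b c d : ℕ} (f : Term Gen a b) (g : Term Gen c d) :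
      Axioms (a + c) (d + b) ((f ⊠ g) ⨾ br b d) (br a c ⨾ (g ⊠ f))
  | hexagon_forward (a b c : ℕ) : Axioms (a + b + c) (b + (c + a))
      (.ofEq (add_assoc a b c) ⨾ br a (b + c) ⨾ .ofEq (add_assoc b c a))
      ((br a b ⊠ I c) ⨾ .ofEq (add_assoc b a c) ⨾ (I b ⊠ br a c))
  | hexagon_reverse (a b c : ℕ) : Axioms (a + (b + c)) (c + a + b)
      (.ofEq (add_assoc a b c).symm ⨾ br (a + b) c ⨾ .ofEq (add_assoc c a b).symm)
      ((I a ⊠ br b c) ⨾ .ofEq (add_assoc a c b).symm ⨾ (br a c ⊠ I b))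
  | mul_assoc : Axioms 3 1 ((mu ⊠ I 1) ⨾ mu) ((I 1 ⊠ mu) ⨾ mu)
  | one_mul : Axioms 1 1 ((eta ⊠ I 1) ⨾ mu) (I 1)
  | mul_one : Axioms 1 1 ((I 1 ⊠ eta) ⨾ mu) (I 1)
  | comul_assoc : Axioms 1 3 (Delta ⨾ (Delta ⊠ I 1)) (Delta ⨾ (I 1 ⊠ Delta))
  | counit_comul : Axioms 1 1 (Delta ⨾ (eps ⊠ I 1)) (I 1)
  | comul_counit : Axioms 1 1 (Delta ⨾ (I 1 ⊠ eps)) (I 1)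
  | mul_comul : Axioms 2 2 ((Delta ⊠ Delta) ⨾ (I 1 ⊠ br 1 1 ⊠ I 1 :) ⨾ (mu ⊠ mu)) (mu ⨾ Delta)
  | mul_counit : Axioms 2 0 (mu ⨾ eps) (eps ⊠ eps)
  | one_comul : Axioms 0 2 (eta ⨾ Delta) (eta ⊠ eta)
  | one_counit : Axioms 0 0 (eta ⨾ eps) (I 0)
  | antipode_left : Axioms 1 1 (Delta ⨾ (S ⊠ I 1) ⨾ mu) (eps ⨾ eta)
  | antipode_right : Axioms 1 1 (Delta ⨾ (I 1 ⊠ S) ⨾ mu) (eps ⨾ eta)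
  | SInv_S : Axioms 1 1 (SInv ⨾ S) (I 1)
  | S_SInv : Axioms 1 1 (S ⨾ SInv) (I 1)
  | form_invariant : Axioms 1 1 (Delta ⨾ (I 1 ⊠ lam)) (lam ⨾ eta)
  | element_invariant : Axioms 1 1 ((Lam ⊠ I 1) ⨾ mu) (eps ⨾ Lam)
  | element_form : Axioms 0 0 (Lam ⨾ lam) (I 0)
  | element_antipode : Axioms 0 1 (Lam ⨾ S) Lam
  | antipode_form : Axioms 1 0 (S ⨾ lam) lam
  | tau_tauInv : Axioms 1 1 (tau ⨾ tauInv) (I 1)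
  | tauInv_tau : Axioms 1 1 (tauInv ⨾ tau) (I 1)
  | tau_antipode : Axioms 1 1 (tau ⨾ S) (S ⨾ tau)
  | tau_counit : Axioms 1 0 (tau ⨾ eps) eps
  | tau_mul : Axioms 2 1 ((tau ⊠ I 1) ⨾ mu) (mu ⨾ tau)
  | copairing_eq : Axioms 0 2 w (eta ⨾ tauInv ⨾ Delta ⨾ (tau ⊠ tau))
  | copairing_comul : Axioms 0 3 (w ⨾ (I 1 ⊠ Delta)) (w ⨾ (I 1 ⊠ w ⊠ I 1 :) ⨾ (mu ⊠ I 2 :))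
  | tauInv_comul : Axioms 1 2 (tauInv ⨾ Delta)
      (Delta ⨾ brInv 1 1 ⨾ monodromy ⨾ (tauInv ⊠ tauInv))
  | braiding_eq : Axioms 2 2
      ((rhoL ⊠ rhoR) ⨾ (S ⊠ (monodromy ⨾ brInv 1 1 ⨾ monodromy) ⊠ S :) ⨾ (mu ⊠ mu :)) (br 1 1)

/-- The evaluation `ev = λ ∘ μ ∘ (id ⊗ S)`. -/
def ev : Term Gen 2 0 := (I 1 ⊠ S) ⨾ mu ⨾ lam

/-- The coevaluation `coev = Δ ∘ Λ`. -/
def coev : Term Gen 0 2 := Lam ⨾ Delta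

/-- `W = (μ ⊗ τ) ∘ (id ⊗ coev)`. -/
def W : Term Gen 1 2 := (I 1 ⊠ coev) ⨾ (mu ⊠ tau)

/-- `W̄ = μ ∘ (τ⁻¹ ⊗ S)`. -/
def WBar : Term Gen 2 1 := (tauInv ⊠ S) ⨾ mu

/-- `w̄ = (S ⊗ id) ∘ w`. -/
def wBar : Term Gen 0 2 := w ⨾ (S ⊠ I 1)

/-- The crossing `X = c ∘ (μ ⊗ μ) ∘ (id ⊗ w̄ ⊗ id)`. -/
def X : Term Gen 2 2 := (I 1 ⊠ wBar ⊠ I 1) ⨾ (mu ⊠ mu :) ⨾ br 1 1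

/-- The crossing `Y = Ω ∘ c⁻¹`, which is the inverse of `X`. -/
def Y : Term Gen 2 2 := brInv 1 1 ⨾ monodromy

/-- The crossing `X̂ = (id ⊗ μ) ∘ (X ⊗ id) ∘ (id ⊗ μ ⊗ id) ∘ (id ⊗ id ⊗ w)`. -/
def XHat : Term Gen 2 2 := (I 2 ⊠ w) ⨾ (I 1 ⊠ mu ⊠ I 1 :) ⨾ (X ⊠ I 1 :) ⨾ (I 1 ⊠ mu)

/-- The crossing `Ŷ = (id ⊗ μ) ∘ (Y ⊗ id) ∘ (id ⊗ μ ⊗ id) ∘ (id ⊗ id ⊗ w̄)`, which is the inverse of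
`X̂`. -/
def YHat : Term Gen 2 2 := (I 2 ⊠ wBar) ⨾ (I 1 ⊠ mu ⊠ I 1 :) ⨾ (Y ⊠ I 1 :) ⨾ (I 1 ⊠ mu)

/-- The morphism `Θ'ₙ : H ⊗ Hⁿ ⟶ Hⁿ`, which multiplies every factor of `Hⁿ` on the left by one of the
`n` iterated coproducts of the first factor. -/
def thetaLeft : ∀ n : ℕ, Term Gen (1 + n) n
  | 0 => eps
  | n + 1 =>
    (Delta ⊠ I (n + 1)) ⨾
    .ofEq (show 2 + (n + 1) = 1 + ((1 + n) + 1) by omega) ⨾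
    (I 1 ⊠ br 1 n ⊠ I 1) ⨾
    .ofEq (show 1 + ((n + 1) + 1) = (1 + n) + 2 by omega) ⨾
    (thetaLeft n ⊠ mu)

/-- `Uₙ = Θ'ₙ ∘ (Λ ⊗ idₙ)`. -/
def U (n : ℕ) : Term Gen n n :=
  .ofEq (zero_add n).symm ⨾ (Lam ⊠ I n) ⨾ thetaLeft n

/-- The one-letter case of `γ̂`. -/
def gammaHatOne (k i : ℕ) : Term Gen 2 2 :=
  if i ≤ k then br 1 1 else if i = k + 1 then X else XHat

/-- The morphism `γ̂_{i,k} : H^ℓ ⊗ H ⟶ H ⊗ H^ℓ` of a word `i` of length `ℓ`. -/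
def gammaHat (k : ℕ) : ∀ l : List ℕ, Term Gen (l.length + 1) (1 + l.length)
  | [] => I 1
  | i :: l =>
    .ofEq (show (l.length + 1) + 1 = 1 + (l.length + 1) by omega) ⨾
    (I 1 ⊠ gammaHat k l) ⨾
    .ofEq (show 1 + (1 + l.length) = 2 + l.length by omega) ⨾
    (gammaHatOne k i ⊠ I l.length) ⨾
    .ofEq (show 2 + l.length = 1 + (l.length + 1) by omega)

/-- The one-letter case of `Θ̂`. -/
def thetaHatOne (k i : ℕ) : Term Gen 2 1 :=
  if i = k then mu else I 1 ⊠ eps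

/-- The morphism `Θ̂_{i,k} : H^ℓ ⊗ H ⟶ H^ℓ` of a word `i` of length `ℓ`. -/
def thetaHat (k : ℕ) : ∀ l : List ℕ, Term Gen (l.length + 1) l.length
  | [] => eps
  | i :: l =>
    (I (l.length + 1) ⊠ Delta) ⨾
    .ofEq (show (l.length + 1) + 2 = 1 + ((l.length + 1) + 1) by omega) ⨾
    (I 1 ⊠ gammaHat k l ⊠ I 1) ⨾
    .ofEq (show 1 + ((1 + l.length) + 1) = 2 + (l.length + 1) by omega) ⨾
    (thetaHatOne k i ⊠ thetaHat k l) ⨾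
    .ofEq (show 1 + l.length = l.length + 1 by omega)

/-- The one-letter case of `Θ̌`. -/
def thetaCheckOne (k i : ℕ) : Term Gen 2 1 :=
  if i = k then (I 1 ⊠ S) ⨾ mu else I 1 ⊠ eps

/-- The morphism `Θ̌_{i,k} : H^ℓ ⊗ H ⟶ H^ℓ` of a word `i` of length `ℓ`. -/
def thetaCheck (k : ℕ) : ∀ l : List ℕ, Term Gen (l.length + 1) l.length
  | [] => eps
  | i :: l =>
    (I (l.length + 1) ⊠ Delta) ⨾
    .ofEq (show (l.length + 1) + 2 = 1 + ((l.length + 1) + 1) by omega) ⨾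
    (I 1 ⊠ thetaCheck k l ⊠ I 1) ⨾
    (I 1 ⊠ gammaHat k l) ⨾
    .ofEq (show 1 + (1 + l.length) = 2 + l.length by omega) ⨾
    (thetaCheckOne k i ⊠ I l.length) ⨾
    .ofEq (show 1 + l.length = l.length + 1 by omega)

/-- `Ω_{i,k} = Θ̂_{i,k} ∘ (id_ℓ ⊗ η)`. -/
def omega (k : ℕ) (l : List ℕ) : Term Gen l.length l.length :=
  (I l.length ⊠ eta) ⨾ thetaHat k l

/-- `Θ̌_{i,k} ∘ (id_ℓ ⊗ η)`, the inverse of `Ω_{i,k}`. -/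
def omegaInv (k : ℕ) (l : List ℕ) : Term Gen l.length l.length :=
  (I l.length ⊠ eta) ⨾ thetaCheck k l

end Terms

/-- The category `4Alg`: the strict braided monoidal category freely generated by a BP Hopf
algebra. -/
abbrev FourAlg : Type := Pres Gen Axioms

/-- The BP Hopf algebra that generates `4Alg`. -/
def H : FourAlg := ⟨1⟩

/-- The braiding of `4Alg`. -/
instance : BraidedCategory FourAlg where
  braiding A B :=
    { hom := Pres.hom (br A.as B.as)
      inv := Pres.hom (brInv A.as B.as)
      hom_inv_id := Pres.hom_eq (.rel (.br_brInv A.as B.as))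
      inv_hom_id := Pres.hom_eq (.rel (.brInv_br A.as B.as)) }
  braiding_naturality_right A B C f := by
    obtain ⟨f, rfl⟩ := Pres.hom_surj f
    exact Pres.hom_eq (.rel (.br_natural (I A.as) f))
  braiding_naturality_left f C := by
    obtain ⟨f, rfl⟩ := Pres.hom_surj f
    exact Pres.hom_eq (.rel (.br_natural f (I C.as)))
  hexagon_forward A B C := by
    have h := Pres.hom_eq (R := Axioms) (.rel (.hexagon_forward A.as B.as C.as))
    simp only [Pres.hom_comp, Pres.hom_ofEq] at h
    exact h
  hexagon_reverse A B C := by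
    have h := Pres.hom_eq (R := Axioms) (.rel (.hexagon_reverse A.as B.as C.as))
    simp only [Pres.hom_comp, Pres.hom_ofEq] at h
    exact h

/-! ## The labeled categories `MAlgF` and `MAlg` -/

/-- Generating morphisms of the category of labeled morphisms. Objects are words in the labels
`0, 1, 2, …`, and the letter `i` stands for the generating object `H_i`. -/
inductive LGen : FreeAddMonoid ℕ → FreeAddMonoid ℕ → Type
  | ev (i : ℕ) (hi : 1 ≤ i) : LGen (.of i + .of i) 0
  | comul (i : ℕ) (hi : 1 ≤ i) : LGen (.of i) (.of i + .of i)
  | counit (i : ℕ) (hi : 1 ≤ i) : LGen (.of i) 0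
  | integralElement (i : ℕ) (hi : 1 ≤ i) : LGen 0 (.of i)
  | ribbon (i : ℕ) (hi : 1 ≤ i) : LGen (.of i) (.of i)
  | X (i j : ℕ) (hi : 1 ≤ i) (hij : i ≤ j) : LGen (.of i + .of j) (.of j + .of i)
  | YHat (i j : ℕ) (hi : 1 ≤ i) (hij : i ≤ j) : LGen (.of i + .of j) (.of j + .of i)
  | XHat (i j : ℕ) (hj : 1 ≤ j) (hij : j ≤ i) : LGen (.of i + .of j) (.of j + .of i)
  | Y (i j : ℕ) (hj : 1 ≤ j) (hij : j ≤ i) : LGen (.of i + .of j) (.of j + .of i)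
  | W (i : ℕ) (hi : 1 ≤ i) : LGen (.of 0) (.of i + .of i)
  | WBar (i : ℕ) (hi : 1 ≤ i) : LGen (.of i + .of i) (.of 0)
  | U (l : FreeAddMonoid ℕ) (hl : l ≠ 0) (hpos : ∀ i ∈ l.toList, 1 ≤ i) : LGen l l

/-- The free strict monoidal category on the labeled generators. -/
abbrev MAlgF : Type := Free LGen

/-- The number of letters of a word. -/
def lengthHom : FreeAddMonoid ℕ →+ ℕ where
  toFun l := l.toList.length
  map_zero' := rfl
  map_add' _ _ := List.length_append

/-- The morphism of `4Alg` obtained from a labeled generator by forgetting its labels. -/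
def forgetGen : ∀ a b : FreeAddMonoid ℕ, LGen a b →
    ((⟨lengthHom a⟩ : FourAlg) ⟶ ⟨lengthHom b⟩)
  | _, _, .ev _ _ => Pres.hom ev
  | _, _, .comul _ _ => Pres.hom Delta
  | _, _, .counit _ _ => Pres.hom eps
  | _, _, .integralElement _ _ => Pres.hom Lam
  | _, _, .ribbon _ _ => Pres.hom tau
  | _, _, .X _ _ _ _ => Pres.hom X
  | _, _, .YHat _ _ _ _ => Pres.hom YHat
  | _, _, .XHat _ _ _ _ => Pres.hom XHat
  | _, _, .Y _ _ _ _ => Pres.hom Y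
  | _, _, .W _ _ => Pres.hom W
  | _, _, .WBar _ _ => Pres.hom WBar
  | _, _, .U l _ _ => Pres.hom (U l.toList.length)

/-- The functor `MAlgF ⥤ 4Alg` that forgets labels. -/
def forgetF : MAlgF ⥤ FourAlg := Free.lift lengthHom forgetGen

/-- The quotient of `MAlgF` by the kernel congruence of `forgetF`. -/
abbrev MAlg : Type := CategoryTheory.Quotient forgetF.homRel

/-- The projection functor. -/
def toMAlg : MAlgF ⥤ MAlg := CategoryTheory.Quotient.functor forgetF.homRel

/-- The functor `F : MAlg ⥤ 4Alg` that forgets labels. -/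
def forget : MAlg ⥤ FourAlg :=
  CategoryTheory.Quotient.lift forgetF.homRel forgetF fun _ _ _ _ h => h

/-- The object `H_{i₁} ⊗ ⋯ ⊗ H_{iₗ}` of `MAlg`. -/
def ob (l : List ℕ) : MAlg := toMAlg.obj ⟨.ofList l⟩

/-- The exchange of the labels `k` and `k + 1`. -/
def swap (k i : ℕ) : ℕ := if i = k then k + 1 else if i = k + 1 then k else i

theorem swap_pos {k i : ℕ} (hk : 1 ≤ k) (hi : 1 ≤ i) : 1 ≤ swap k i := by
  unfold swap; split_ifs <;> omega

theorem swap_le {k i j : ℕ} (hij : i ≤ j) (h : ¬ (i = k ∧ j = k + 1)) : swap k i ≤ swap k j := by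
  unfold swap; split_ifs <;> omega

theorem swap_ge {k i j : ℕ} (h : i = k ∧ j = k + 1) : swap k j ≤ swap k i := by
  unfold swap; split_ifs <;> omega

/-- The exchange of the labels `k` and `k + 1` in a word. -/
def swapHom (k : ℕ) : FreeAddMonoid ℕ →+ FreeAddMonoid ℕ := FreeAddMonoid.map (swap k)

theorem swapHom_zero {k : ℕ} (hk : 1 ≤ k) : swapHom k (.of 0) = .of 0 := by
  have h : swap k 0 = 0 := by
    rw [swap, if_neg (by omega), if_neg (by omega)]
  rw [swapHom, FreeAddMonoid.map_of, h]

theorem swapHom_ne_zero {k : ℕ} {l : FreeAddMonoid ℕ} (hl : l ≠ 0) : swapHom k l ≠ 0 := fun h =>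
  hl (List.map_eq_nil_iff.mp (show l.toList.map (swap k) = [] from h))

theorem swapHom_pos {k : ℕ} (hk : 1 ≤ k) {l : FreeAddMonoid ℕ} (hpos : ∀ i ∈ l.toList, 1 ≤ i) :
    ∀ i ∈ (swapHom k l).toList, 1 ≤ i := by
  intro i hi
  obtain ⟨j, hj, rfl⟩ := List.mem_map.mp (show i ∈ l.toList.map (swap k) from hi)
  exact swap_pos hk (hpos j hj)

/-- The exchange of the labels `k` and `k + 1` on generators. It sends `X_{k,k+1}`, `Ŷ_{k,k+1}`,
`X̂_{k+1,k}`, `Y_{k+1,k}` to `X̂_{k+1,k}`, `Y_{k+1,k}`, `X_{k,k+1}`, `Ŷ_{k,k+1}`, respectively, and all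
other generators to the generators of the same kind with the labels exchanged. -/
def swapGen (k : ℕ) (hk : 1 ≤ k) : ∀ a b : FreeAddMonoid ℕ, LGen a b →
    ((⟨swapHom k a⟩ : MAlgF) ⟶ ⟨swapHom k b⟩)
  | _, _, .ev i hi => Pres.hom (.gen (.ev (swap k i) (swap_pos hk hi)))
  | _, _, .comul i hi => Pres.hom (.gen (.comul (swap k i) (swap_pos hk hi)))
  | _, _, .counit i hi => Pres.hom (.gen (.counit (swap k i) (swap_pos hk hi)))
  | _, _, .integralElement i hi => Pres.hom (.gen (.integralElement (swap k i) (swap_pos hk hi)))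
  | _, _, .ribbon i hi => Pres.hom (.gen (.ribbon (swap k i) (swap_pos hk hi)))
  | _, _, .X i j hi hij =>
    if h : i = k ∧ j = k + 1 then
      Pres.hom (.gen (.XHat (swap k i) (swap k j) (swap_pos hk (hi.trans hij)) (swap_ge h)))
    else Pres.hom (.gen (.X (swap k i) (swap k j) (swap_pos hk hi) (swap_le hij h)))
  | _, _, .YHat i j hi hij =>
    if h : i = k ∧ j = k + 1 then
      Pres.hom (.gen (.Y (swap k i) (swap k j) (swap_pos hk (hi.trans hij)) (swap_ge h)))
    else Pres.hom (.gen (.YHat (swap k i) (swap k j) (swap_pos hk hi) (swap_le hij h)))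
  | _, _, .XHat i j hj hij =>
    if h : j = k ∧ i = k + 1 then
      Pres.hom (.gen (.X (swap k i) (swap k j) (swap_pos hk (hj.trans hij)) (swap_ge h)))
    else Pres.hom (.gen (.XHat (swap k i) (swap k j) (swap_pos hk hj) (swap_le hij h)))
  | _, _, .Y i j hj hij =>
    if h : j = k ∧ i = k + 1 then
      Pres.hom (.gen (.YHat (swap k i) (swap k j) (swap_pos hk (hj.trans hij)) (swap_ge h)))
    else Pres.hom (.gen (.Y (swap k i) (swap k j) (swap_pos hk hj) (swap_le hij h)))
  | _, _, .W i hi => 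
    eqToHom (congrArg Pres.mk (swapHom_zero hk)) ≫
      Pres.hom (.gen (.W (swap k i) (swap_pos hk hi)))
  | _, _, .WBar i hi =>
    Pres.hom (.gen (.WBar (swap k i) (swap_pos hk hi))) ≫
      eqToHom (congrArg Pres.mk (swapHom_zero hk).symm)
  | _, _, .U l hl hpos =>
    Pres.hom (.gen (.U (swapHom k l) (swapHom_ne_zero hl) (swapHom_pos hk hpos)))

/-- The strict monoidal functor `MAlgF ⥤ MAlgF` that exchanges `H_k` with `H_{k+1}`, `X_{k,k+1}` with
`X̂_{k+1,k}`, and `Ŷ_{k,k+1}` with `Y_{k+1,k}`. -/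
def swapLabels (k : ℕ) (hk : 1 ≤ k) : MAlgF ⥤ MAlgF := Free.lift (swapHom k) (swapGen k hk)

/-- A functor that first exchanges labels and then forgets them sends every word of length `ℓ` to
the `ℓ`-fold power of `H`. -/
theorem obj_eq {k : ℕ} {hk : 1 ≤ k} {Fhat : MAlg ⥤ FourAlg}
    (hF : toMAlg ⋙ Fhat = swapLabels k hk ⋙ forgetF) (l : List ℕ) :
    (⟨l.length⟩ : FourAlg) = Fhat.obj (ob l) := by
  refine Eq.trans ?_ (congrArg (fun F => F.obj (⟨.ofList l⟩ : MAlgF)) hF).symm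
  exact congrArg Pres.mk (List.length_map (as := l) (swap k)).symm

end BPHopf

/-! A strand `H` that enters to the right of a word travels to its left end. It crosses each letter
by `γ̂`, and at each letter a copy of it is left behind, which acts by right multiplication if the
letter is `k` and by the counit otherwise. The proof isolates what is needed of the crossing and of
the action (`Slide`), extends both to words (`Slide.G`, `Slide.Φ`), and calls a pair `F`, `F'`
natural (`Slide.Natural`) if `F` passes through the crossing and the action intertwines `F` with
`F'`. Natural pairs are closed under identities, composition, tensor products and inverses. The
condition on the crossing cannot be dropped: in a tensor product, the copy that acts on the left
factor first crosses the right one. Hence naturality on the free category only has to be checked on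
generators (`natural_gen`).

For most generators this is invariance. Every crossing commutes with the diagonal right action of
`H` on `H ⊗ H` (`X_mul_comul`, `XHat_mul_comul`), the morphism `μ(id ⊗ S)` turns that action into
the counit (`comul_mul_div`), and `Λ` absorbs a factor on its right. The Yang-Baxter relations
follow because a pair of decorated crossings is a diagonal action followed by a plain braiding
(`X_X_eq`, `XHat_XHat_eq`). The labels `k`, `k + 1` are exchanged because of `mul_X_left` and
`mul_X_XHat`: a strand that passes `k + 1` by `X` and multiplies `k` turns `X` into `X̂` and
conversely. The crossings `Y`, `Ŷ` are treated as inverses, and `U` by an induction on the word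
(`Slide.Natural.U`).

Inserting the unit in the strand gives `Ω`. As `η` is grouplike, replacing multiplication by
division inverts `Ω` (`omega_omegaInv`, `omegaInv_omega`). Naturality on the free category then says
that the relabeled morphism `F'` is the conjugate of `F` by `Ω`. So it depends only on `F`, the
relabeling descends to `MAlg`, and the two natural transformations descend with it.

The identities in a BP Hopf algebra are verified by reflection. A string diagram becomes a word of
layers, an equation is applied by moving layers with the interchange law, and the kernel evaluates
the resulting Boolean test, whose correctness is `E.check_sound`. Variables in the diagrams stand
for morphisms on whole words and serve for the inductions. -/

namespace BPHopf

open StrictPres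

/-! ## Morphisms of `4Alg` without fixed source and target -/

/-- A morphism of `4Alg` together with its source and target. -/
structure Mor where
  /-- The source. -/
  dom : ℕ
  /-- The target. -/
  cod : ℕ
  /-- The morphism. -/
  hom : (⟨dom⟩ : FourAlg) ⟶ ⟨cod⟩

namespace Mor

/-- The bundled form of a morphism. -/
def of {X Y : FourAlg} (f : X ⟶ Y) : Mor := ⟨X.as, Y.as, f⟩

/-- The bundled form of a formal morphism. -/
def tm {a b : ℕ} (t : Term Gen a b) : Mor := ⟨a, b, Pres.hom t⟩

/-- The identity of the `n`-fold power. -/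
def id (n : ℕ) : Mor := ⟨n, n, 𝟙 _⟩

/-- Composition in diagrammatic order; the value is `f` if `f` and `g` are not composable. -/
def comp (f g : Mor) : Mor :=
  if h : f.cod = g.dom then
    ⟨f.dom, g.cod, f.hom ≫ eqToHom (congrArg Pres.mk h) ≫ g.hom⟩
  else f

/-- Tensor product. -/
def tensor (f g : Mor) : Mor := ⟨f.dom + g.dom, f.cod + g.cod, Pres.tensorMor f.hom g.hom⟩

theorem of_injective {X Y : FourAlg} {f g : X ⟶ Y} (h : of f = of g) : f = g := by
  simpa [of] using h

theorem ext_heq {f g : Mor} (h₁ : f.dom = g.dom) (h₂ : f.cod = g.cod) (h : HEq f.hom g.hom) :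
    f = g := by
  cases f; cases g; cases h₁; cases h₂; cases h; rfl

theorem of_eq_of_heq {X Y X' Y' : FourAlg} {f : X ⟶ Y} {g : X' ⟶ Y'} (hX : X = X') (hY : Y = Y')
    (h : HEq f g) : of f = of g := by
  subst hX hY h; rfl

theorem of_comp {X Y Z : FourAlg} (f : X ⟶ Y) (g : Y ⟶ Z) : of (f ≫ g) = comp (of f) (of g) := by
  rw [comp, dif_pos (show (of f).cod = (of g).dom from rfl)]
  exact congrArg (fun m => (⟨X.as, Z.as, m⟩ : Mor)) (by
    change f ≫ g = f ≫ 𝟙 _ ≫ g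
    rw [Category.id_comp])

theorem tm_id (a : ℕ) : tm (.id a) = id a := rfl

theorem tm_comp {a b c : ℕ} (f : Term Gen a b) (g : Term Gen b c) :
    tm (.comp f g) = comp (tm f) (tm g) := of_comp (Pres.hom f) (Pres.hom g)

theorem tm_tensor {a b c d : ℕ} (f : Term Gen a b) (g : Term Gen c d) :
    tm (.tensor f g) = tensor (tm f) (tm g) := rfl

theorem tm_ofEq {a b : ℕ} (h : a = b) : tm (.ofEq h) = id a := by
  subst h; rfl

theorem tm_eq {a b : ℕ} {f g : Term Gen a b} (h : Term.Rel Axioms f g) : tm f = tm g :=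
  congrArg of (Pres.hom_eq h)

theorem exists_tm (f : Mor) : ∃ t : Term Gen f.dom f.cod, f = tm t := by
  obtain ⟨a, b, f⟩ := f
  obtain ⟨t, rfl⟩ := Pres.hom_surj f
  exact ⟨t, rfl⟩

@[simp] theorem id_dom (n : ℕ) : (id n).dom = n := rfl
@[simp] theorem id_cod (n : ℕ) : (id n).cod = n := rfl
@[simp] theorem tm_dom {a b : ℕ} (t : Term Gen a b) : (tm t).dom = a := rfl
@[simp] theorem tm_cod {a b : ℕ} (t : Term Gen a b) : (tm t).cod = b := rfl
@[simp] theorem tensor_dom (f g : Mor) : (tensor f g).dom = f.dom + g.dom := rfl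
@[simp] theorem tensor_cod (f g : Mor) : (tensor f g).cod = f.cod + g.cod := rfl

@[simp] theorem comp_dom (f g : Mor) : (comp f g).dom = f.dom := by
  unfold comp; split_ifs <;> rfl

theorem comp_cod {f g : Mor} (h : f.cod = g.dom) : (comp f g).cod = g.cod := by
  rw [comp, dif_pos h]

theorem comp_mk {a b c : ℕ} (f : (⟨a⟩ : FourAlg) ⟶ ⟨b⟩) (g : (⟨b⟩ : FourAlg) ⟶ ⟨c⟩) :
    comp ⟨a, b, f⟩ ⟨b, c, g⟩ = ⟨a, c, f ≫ g⟩ := (of_comp f g).symm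

theorem id_comp {n : ℕ} {f : Mor} (h : n = f.dom) : comp (id n) f = f := by
  subst h
  exact (comp_mk _ _).trans (by rw [Category.id_comp])

theorem comp_id {n : ℕ} {f : Mor} (h : f.cod = n) : comp f (id n) = f := by
  subst h
  exact (comp_mk _ _).trans (by rw [Category.comp_id])

theorem comp_assoc {f g h : Mor} (h₁ : f.cod = g.dom) (h₂ : g.cod = h.dom) :
    comp (comp f g) h = comp f (comp g h) := by
  obtain ⟨a, b, f⟩ := f
  obtain ⟨b', c, g⟩ := g
  obtain ⟨c', d, h⟩ := h
  obtain rfl : b = b' := h₁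
  obtain rfl : c = c' := h₂
  simp only [comp_mk, Category.assoc]

theorem id_tensor_id (m n : ℕ) : tensor (id m) (id n) = id (m + n) :=
  congrArg of (Pres.id_tensorMor_id (⟨m⟩ : FourAlg) ⟨n⟩)

theorem tensor_comp {f g f' g' : Mor} (h : f.cod = g.dom) (h' : f'.cod = g'.dom) :
    tensor (comp f g) (comp f' g') = comp (tensor f f') (tensor g g') := by
  obtain ⟨a, b, f⟩ := f
  obtain ⟨b₁, c, g⟩ := g
  obtain ⟨a', b', f'⟩ := f'
  obtain ⟨b₁', c', g'⟩ := g'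
  obtain rfl : b = b₁ := h
  obtain rfl : b' = b₁' := h'
  rw [comp_mk, comp_mk]
  exact (congrArg (fun m => (⟨a + a', c + c', m⟩ : Mor))
    (tensorHom_comp_tensorHom (C := FourAlg) f f' g g').symm).trans (comp_mk _ _).symm

theorem id_comp_id (n : ℕ) : comp (id n) (id n) = id n := id_comp rfl

theorem tensor_assoc (f g h : Mor) : tensor (tensor f g) h = tensor f (tensor g h) :=
  ext_heq (add_assoc _ _ _) (add_assoc _ _ _) (Pres.tensorMor_assoc_heq f.hom g.hom h.hom)

theorem id_zero_tensor (f : Mor) : tensor (id 0) f = f :=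
  ext_heq (zero_add _) (zero_add _) (Pres.unit_tensorMor_heq f.hom)

theorem tensor_id_zero (f : Mor) : tensor f (id 0) = f :=
  ext_heq (add_zero _) (add_zero _) (Pres.tensorMor_unit_heq f.hom)

end Mor

/-! ## String diagrams -/

/-- The elementary morphisms between tensor powers of `H` that occur in diagrams. -/
inductive Thin
  | m | u | D | e | S | s | l | L | t | T | w | c | C | b | X | Y | Xh | Yh
  deriving DecidableEq

/-- The letters of a diagram: the elementary morphisms, and variables. -/
inductive Letter
  | g (x : Thin)
  | v (n : ℕ)
  deriving DecidableEq

namespace Thin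

/-- The number of inputs. -/
def ins : Thin → List ℕ
  | u | L | w | b => []
  | D | e | S | s | l | t | T => [0]
  | m | c | C | X | Y | Xh | Yh => [0, 0]

/-- The number of outputs. -/
def outs : Thin → List ℕ
  | e | l => []
  | m | u | S | s | L | t | T => [0]
  | D | w | b | c | C | X | Y | Xh | Yh => [0, 0]

/-- The morphism of `4Alg` that an elementary morphism stands for. -/
def den : Thin → Mor
  | m => .tm mu
  | u => .tm eta
  | D => .tm Delta
  | e => .tm eps
  | S => .tm BPHopf.S
  | s => .tm SInv
  | l => .tm lam
  | L => .tm Lam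
  | t => .tm tau
  | T => .tm tauInv
  | w => .tm BPHopf.w
  | c => .tm (br 1 1)
  | C => .tm (brInv 1 1)
  | b => .tm wBar
  | X => .tm BPHopf.X
  | Y => .tm BPHopf.Y
  | Xh => .tm XHat
  | Yh => .tm YHat

theorem den_dom (x : Thin) : x.den.dom = x.ins.length := by cases x <;> rfl
theorem den_cod (x : Thin) : x.den.cod = x.outs.length := by cases x <;> rfl

end Thin

/-- The types of the variables of a diagram. Strands are labeled by numbers; the label `0` is that of
a single strand `H`. -/
abbrev Sig : Type := List (List ℕ × List ℕ)

/-- The input labels of a letter. -/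
def Sig.ins (σ : Sig) : Letter → List ℕ
  | .g x => x.ins
  | .v n => (σ.getD n ([], [])).1

/-- The output labels of a letter. -/
def Sig.outs (σ : Sig) : Letter → List ℕ
  | .g x => x.outs
  | .v n => (σ.getD n ([], [])).2

/-- Values of the strand labels and of the variables of a diagram. -/
structure Env (σ : Sig) where
  /-- `width i` is the number of strands `H` for which a strand with the label `i` stands. -/
  width : ℕ → ℕ
  width_zero : width 0 = 1
  /-- The values of the variables. -/
  val : List Mor
  typed : List.Forall₂ (fun (p : List ℕ × List ℕ) (f : Mor) =>
    f.dom = (p.1.map width).sum ∧ f.cod = (p.2.map width).sum) σ val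

namespace Env

variable {σ : Sig} (ε : Env σ)

/-- The total number of strands `H` of a list of labels. -/
def wd (s : List ℕ) : ℕ := (s.map ε.width).sum

theorem wd_append (s s' : List ℕ) : ε.wd (s ++ s') = ε.wd s + ε.wd s' := by
  simp [wd]

/-- The value of a letter. -/
def letter : Letter → Mor
  | .g x => x.den
  | .v n => ε.val.getD n (.id 0)

theorem thin_ins (x : Thin) : x.ins.length = ε.wd x.ins := by
  cases x <;> simp [Thin.ins, wd, ε.width_zero]

theorem thin_outs (x : Thin) : x.outs.length = ε.wd x.outs := by
  cases x <;> simp [Thin.outs, wd, ε.width_zero]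

theorem letter_typed (x : Letter) :
    (ε.letter x).dom = ε.wd (σ.ins x) ∧ (ε.letter x).cod = ε.wd (σ.outs x) := by
  cases x with
  | g x => exact ⟨(x.den_dom).trans (ε.thin_ins x), (x.den_cod).trans (ε.thin_outs x)⟩
  | v n =>
    -- A number past the end of both lists reads as the type `([], [])` and the value `id 0`, which
    -- fit each other, so no bound on `n` is needed.
    have key : ∀ (σ : Sig) (val : List Mor), List.Forall₂ (fun (p : List ℕ × List ℕ) (f : Mor) =>
        f.dom = (p.1.map ε.width).sum ∧ f.cod = (p.2.map ε.width).sum) σ val → ∀ n : ℕ,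
        (val.getD n (.id 0)).dom = ε.wd (σ.getD n ([], [])).1 ∧
          (val.getD n (.id 0)).cod = ε.wd (σ.getD n ([], [])).2 := by
      intro σ val h
      induction h with
      | nil => intro n; simp [wd]
      | cons h _ ih =>
        intro n
        cases n with
        | zero => exact h
        | succ n => exact ih n
    exact key σ ε.val ε.typed n

end Env

/-- Diagrams. -/
inductive E
  | id (s : List ℕ)
  | x (x : Letter)
  | comp (f g : E)
  | tensor (f g : E)

namespace E

/-- The value of a diagram. -/
def den {σ : Sig} (ε : Env σ) : E → Mor
  | id s => .id (ε.wd s)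
  | x a => ε.letter a
  | comp f g => (f.den ε).comp (g.den ε)
  | tensor f g => (f.den ε).tensor (g.den ε)

/-- The input labels of a diagram. -/
def ins (σ : Sig) : E → List ℕ
  | id s => s
  | x a => σ.ins a
  | comp f _ => f.ins σ
  | tensor f g => f.ins σ ++ g.ins σ

/-- The output labels of a diagram. -/
def outs (σ : Sig) : E → List ℕ
  | id s => s
  | x a => σ.outs a
  | comp _ g => g.outs σ
  | tensor f g => f.outs σ ++ g.outs σ

/-- All compositions in a diagram are possible. -/
def wt (σ : Sig) : E → Bool
  | id _ => true
  | x _ => true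
  | comp f g => f.wt σ && g.wt σ && decide (f.outs σ = g.ins σ)
  | tensor f g => f.wt σ && g.wt σ

/-- Composition in `Mor` is total with a junk value, so source and target are only known once the
Boolean test `wt` has been passed. -/
theorem den_typed {σ : Sig} (ε : Env σ) : ∀ f : E, f.wt σ = true →
    (f.den ε).dom = ε.wd (f.ins σ) ∧ (f.den ε).cod = ε.wd (f.outs σ)
  | id s, _ => ⟨rfl, rfl⟩
  | x a, _ => ε.letter_typed a
  | comp f g, h => by
    simp only [wt, Bool.and_eq_true, decide_eq_true_eq] at h
    obtain ⟨⟨hf, hg⟩, hfg⟩ := h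
    refine ⟨(Mor.comp_dom _ _).trans (den_typed ε f hf).1, ?_⟩
    exact (Mor.comp_cod (by rw [(den_typed ε f hf).2, (den_typed ε g hg).1, hfg])).trans
      (den_typed ε g hg).2
  | tensor f g, h => by
    simp only [wt, Bool.and_eq_true] at h
    simp only [ins, outs, Env.wd_append]
    exact ⟨congrArg₂ (· + ·) (den_typed ε f h.1).1 (den_typed ε g h.2).1,
      congrArg₂ (· + ·) (den_typed ε f h.1).2 (den_typed ε g h.2).2⟩

end E

/-- A letter with strands on its left and on its right. -/
structure Layer where
  /-- The labels on the left. -/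
  l : List ℕ
  /-- The letter. -/
  x : Letter
  /-- The labels on the right. -/
  r : List ℕ
  deriving DecidableEq

namespace Layer

/-- The input labels of a layer. -/
def ins (σ : Sig) (a : Layer) : List ℕ := a.l ++ (σ.ins a.x ++ a.r)

/-- The output labels of a layer. -/
def outs (σ : Sig) (a : Layer) : List ℕ := a.l ++ (σ.outs a.x ++ a.r)

/-- Adds strands on the left and on the right. -/
def shift (p q : List ℕ) (a : Layer) : Layer := ⟨p ++ a.l, a.x, a.r ++ q⟩

/-- The value of a layer. -/
def den {σ : Sig} (ε : Env σ) (a : Layer) : Mor :=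
  (Mor.id (ε.wd a.l)).tensor ((ε.letter a.x).tensor (Mor.id (ε.wd a.r)))

theorem den_typed {σ : Sig} (ε : Env σ) (a : Layer) :
    (a.den ε).dom = ε.wd (a.ins σ) ∧ (a.den ε).cod = ε.wd (a.outs σ) := by
  simp [den, ins, outs, Env.wd_append, ε.letter_typed a.x]

theorem ins_shift (σ : Sig) (p q : List ℕ) (a : Layer) :
    (a.shift p q).ins σ = p ++ (a.ins σ ++ q) := by
  simp [ins, shift]

theorem outs_shift (σ : Sig) (p q : List ℕ) (a : Layer) :
    (a.shift p q).outs σ = p ++ (a.outs σ ++ q) := by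
  simp [outs, shift]

theorem den_shift {σ : Sig} (ε : Env σ) (p q : List ℕ) (a : Layer) :
    (a.shift p q).den ε = (Mor.id (ε.wd p)).tensor ((a.den ε).tensor (Mor.id (ε.wd q))) := by
  simp only [den, shift, Env.wd_append, ← Mor.id_tensor_id, Mor.tensor_assoc]

end Layer

/-- Words of layers. -/
abbrev Word : Type := List Layer

namespace Word

/-- The layers of a word can be composed, starting from the labels `s`. -/
def Valid (σ : Sig) : List ℕ → Word → Prop
  | _, [] => True
  | s, a :: v => a.ins σ = s ∧ Valid σ (a.outs σ) v

/-- The output labels of a word. -/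
def outs (σ : Sig) : List ℕ → Word → List ℕ
  | s, [] => s
  | _, a :: v => outs σ (a.outs σ) v

/-- The value of a word. -/
def den {σ : Sig} (ε : Env σ) : List ℕ → Word → Mor
  | s, [] => .id (ε.wd s)
  | _, a :: v => (a.den ε).comp (den ε (a.outs σ) v)

variable {σ : Sig} (ε : Env σ)

theorem den_typed : ∀ (s : List ℕ) (v : Word), Valid σ s v →
    (den ε s v).dom = ε.wd s ∧ (den ε s v).cod = ε.wd (outs σ s v)
  | _, [], _ => ⟨rfl, rfl⟩
  | s, a :: v, h => by
    have ih := den_typed (a.outs σ) v h.2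
    refine ⟨(Mor.comp_dom _ _).trans ((a.den_typed ε).1.trans (by rw [h.1])), ?_⟩
    exact (Mor.comp_cod ((a.den_typed ε).2.trans ih.1.symm)).trans ih.2

theorem valid_append : ∀ (s : List ℕ) (v v' : Word),
    Valid σ s (v ++ v') ↔ Valid σ s v ∧ Valid σ (outs σ s v) v'
  | _, [], _ => by simp [Valid, outs]
  | s, a :: v, v' => by
    simp only [List.cons_append, Valid, outs, valid_append _ v v', and_assoc]

theorem outs_append : ∀ (s : List ℕ) (v v' : Word),
    outs σ s (v ++ v') = outs σ (outs σ s v) v'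
  | _, [], _ => rfl
  | _, _ :: v, v' => outs_append _ v v'

theorem den_append : ∀ (s : List ℕ) (v v' : Word), Valid σ s (v ++ v') →
    den ε s (v ++ v') = (den ε s v).comp (den ε (outs σ s v) v')
  | s, [], v', h => (Mor.id_comp (den_typed ε s v' h).1.symm).symm
  | s, a :: v, v', h => by
    have h' := (valid_append _ v v').mp h.2
    have e₁ := den_typed ε _ v h'.1
    have e₂ := den_typed ε _ v' h'.2
    change (a.den ε).comp (den ε (a.outs σ) (v ++ v')) = _
    rw [den_append _ v v' h.2]
    exact (Mor.comp_assoc ((a.den_typed ε).2.trans e₁.1.symm) (e₁.2.trans e₂.1.symm)).symm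

/-- Two words that can be composed starting from the labels `s` and have the same value. -/
structure Eqv (s : List ℕ) (v v' : Word) : Prop where
  valid : Valid σ s v
  valid' : Valid σ s v'
  outs_eq : outs σ s v = outs σ s v'
  den_eq : den ε s v = den ε s v'

variable {ε}

theorem Eqv.refl {s : List ℕ} {v : Word} (h : Valid σ s v) : Eqv ε s v v := ⟨h, h, rfl, rfl⟩

theorem Eqv.symm {s : List ℕ} {v v' : Word} (h : Eqv ε s v v') : Eqv ε s v' v :=
  ⟨h.valid', h.valid, h.outs_eq.symm, h.den_eq.symm⟩

theorem Eqv.trans {s : List ℕ} {v v' v'' : Word} (h : Eqv ε s v v') (h' : Eqv ε s v' v'') :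
    Eqv ε s v v'' :=
  ⟨h.valid, h'.valid', h.outs_eq.trans h'.outs_eq, h.den_eq.trans h'.den_eq⟩

theorem Eqv.cons {a : Layer} {v v' : Word} (h : Eqv ε (a.outs σ) v v') :
    Eqv ε (a.ins σ) (a :: v) (a :: v') :=
  ⟨⟨rfl, h.valid⟩, ⟨rfl, h.valid'⟩, h.outs_eq, by simp only [den, h.den_eq]⟩

theorem Eqv.append_left {s : List ℕ} {v v' : Word} (p : Word) (hp : Valid σ s p)
    (h : Eqv ε (outs σ s p) v v') : Eqv ε s (p ++ v) (p ++ v') := by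
  induction p generalizing s with
  | nil => exact h
  | cons a p ih =>
    obtain ⟨rfl, hp⟩ := hp
    exact (ih hp h).cons

theorem Eqv.append_right {s : List ℕ} {v v' : Word} (h : Eqv ε s v v') (q : Word)
    (hq : Valid σ (outs σ s v) q) : Eqv ε s (v ++ q) (v' ++ q) := by
  have h₁ : Valid σ s (v ++ q) := (valid_append _ _ _).mpr ⟨h.valid, hq⟩
  have h₂ : Valid σ s (v' ++ q) := (valid_append _ _ _).mpr ⟨h.valid', h.outs_eq ▸ hq⟩
  exact ⟨h₁, h₂, by rw [outs_append, outs_append, h.outs_eq],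
    by rw [den_append ε _ _ _ h₁, den_append ε _ _ _ h₂, h.outs_eq, h.den_eq]⟩

/-- Adds strands on the left and on the right. -/
def shift (p q : List ℕ) (v : Word) : Word := v.map (Layer.shift p q)

theorem valid_shift (p q : List ℕ) : ∀ (s : List ℕ) (v : Word), Valid σ s v →
    Valid σ (p ++ (s ++ q)) (shift p q v)
  | _, [], _ => trivial
  | s, a :: v, h => by
    refine ⟨by rw [a.ins_shift, h.1], ?_⟩
    rw [a.outs_shift]
    exact valid_shift p q _ v h.2

theorem outs_shift (p q : List ℕ) : ∀ (s : List ℕ) (v : Word),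
    outs σ (p ++ (s ++ q)) (shift p q v) = p ++ (outs σ s v ++ q)
  | _, [] => rfl
  | s, a :: v => by
    change outs σ ((a.shift p q).outs σ) (shift p q v) = _
    rw [a.outs_shift]
    exact outs_shift p q _ v

theorem den_shift (p q : List ℕ) : ∀ (s : List ℕ) (v : Word), Valid σ s v →
    den ε (p ++ (s ++ q)) (shift p q v) =
      (Mor.id (ε.wd p)).tensor ((den ε s v).tensor (Mor.id (ε.wd q)))
  | s, [], _ => by
    change Mor.id _ = (Mor.id _).tensor ((Mor.id _).tensor (Mor.id _))
    simp only [Env.wd_append, Mor.id_tensor_id]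
  | s, a :: v, h => by
    have hc : (a.den ε).cod = (den ε (a.outs σ) v).dom :=
      (a.den_typed ε).2.trans (den_typed ε _ v h.2).1.symm
    change ((a.shift p q).den ε).comp (den ε ((a.shift p q).outs σ) (shift p q v)) = _
    rw [a.outs_shift, den_shift p q _ v h.2, a.den_shift]
    rw [← Mor.tensor_comp rfl (by simpa using hc), ← Mor.tensor_comp hc rfl, Mor.id_comp_id,
      Mor.id_comp_id]
    rfl

theorem Eqv.shift {s : List ℕ} {v v' : Word} (h : Eqv ε s v v') (p q : List ℕ) :
    Eqv ε (p ++ (s ++ q)) (shift p q v) (shift p q v') :=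
  ⟨valid_shift p q _ _ h.valid, valid_shift p q _ _ h.valid',
    by rw [outs_shift, outs_shift, h.outs_eq],
    by rw [den_shift p q _ _ h.valid, den_shift p q _ _ h.valid', h.den_eq]⟩

/-- Interchange of two layers in different places. -/
theorem Eqv.interchange (ε : Env σ) (l m r : List ℕ) (x y : Letter) :
    Eqv ε (l ++ (σ.ins x ++ (m ++ (σ.ins y ++ r))))
      [⟨l, x, m ++ (σ.ins y ++ r)⟩, ⟨l ++ (σ.outs x ++ m), y, r⟩]
      [⟨l ++ (σ.ins x ++ m), y, r⟩, ⟨l, x, m ++ (σ.outs y ++ r)⟩] := by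
  refine ⟨⟨rfl, ?_, trivial⟩, ⟨?_, ?_, trivial⟩, ?_, ?_⟩
  · simp [Layer.ins, Layer.outs]
  · simp [Layer.ins]
  · simp [Layer.ins, Layer.outs]
  · simp [outs, Layer.outs]
  · have hx := ε.letter_typed x
    have hy := ε.letter_typed y
    -- Only the widths of the strands matter, so the interchange law is proved for numbers instead
    -- of lists of labels.
    have key : ∀ (f g : Mor) (l m r : ℕ),
        ((Mor.id l).tensor (f.tensor (Mor.id (m + (g.dom + r))))).comp
          ((Mor.id (l + (f.cod + m))).tensor (g.tensor (Mor.id r))) =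
        ((Mor.id (l + (f.dom + m))).tensor (g.tensor (Mor.id r))).comp
          ((Mor.id l).tensor (f.tensor (Mor.id (m + (g.cod + r))))) := by
      intro f g l m r
      simp only [← Mor.id_tensor_id, Mor.tensor_assoc]
      -- True even for `n ≠ k`, because `comp` returns its first argument when the two are not
      -- composable; this frees the simplification below from side conditions.
      have e : ∀ n k, (Mor.id n).comp (Mor.id k) = Mor.id n := fun n k => by
        by_cases h : n = k
        · subst h; exact Mor.comp_id rfl
        · exact dif_neg h
      rw [← Mor.tensor_comp rfl (by simp), ← Mor.tensor_comp rfl (by simp),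
        ← Mor.tensor_comp rfl (by simp), ← Mor.tensor_comp rfl (by simp),
        ← Mor.tensor_comp rfl (by simp), ← Mor.tensor_comp rfl (by simp),
        ← Mor.tensor_comp rfl (by simp), ← Mor.tensor_comp rfl (by simp)]
      simp only [e, Mor.comp_id, Mor.id_comp]
    have := key (ε.letter x) (ε.letter y) (ε.wd l) (ε.wd m) (ε.wd r)
    simp only [hx, hy, ← Env.wd_append] at this
    have e : ∀ (a : Layer) (s : List ℕ), (a.den ε).comp (Mor.id (ε.wd (a.outs σ))) = a.den ε :=
      fun a s => Mor.comp_id (a.den_typed ε).2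
    simp only [den, e _ []]
    exact this

end Word

/-! ### Rewriting of diagrams -/

/-- The list that follows the prefix `p` of a list. -/
def stripPrefix : List ℕ → List ℕ → Option (List ℕ)
  | [], l => some l
  | _ :: _, [] => none
  | a :: p, b :: l => if a = b then stripPrefix p l else none

theorem eq_append_of_stripPrefix : ∀ {p l m : List ℕ}, stripPrefix p l = some m → l = p ++ m
  | [], l, m, h => by simpa [stripPrefix] using h
  | _ :: _, [], m, h => by simp [stripPrefix] at h
  | a :: p, b :: l, m, h => by
    simp only [stripPrefix] at h
    split_ifs at h with hab
    rw [hab, eq_append_of_stripPrefix h, List.cons_append]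

namespace Word

/-- Exchanges a layer with the next one, which lies to the left of it. -/
def commLeft (σ : Sig) (a b : Layer) : List (Layer × Layer) :=
  match stripPrefix (b.l ++ σ.ins b.x) a.l with
  | some m =>
    if b.r = m ++ (σ.outs a.x ++ a.r) then
      [(⟨b.l, b.x, m ++ (σ.ins a.x ++ a.r)⟩, ⟨b.l ++ (σ.outs b.x ++ m), a.x, a.r⟩)]
    else []
  | none => []

/-- Exchanges a layer with the next one, which lies to the right of it. -/
def commRight (σ : Sig) (a b : Layer) : List (Layer × Layer) :=
  match stripPrefix (a.l ++ σ.outs a.x) b.l with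
  | some m =>
    if a.r = m ++ (σ.ins b.x ++ b.r) then
      [(⟨a.l ++ (σ.ins a.x ++ m), b.x, b.r⟩, ⟨a.l, a.x, m ++ (σ.outs b.x ++ b.r)⟩)]
    else []
  | none => []

/-- The ways to move the layer at the position `n` of a word to the front of the word. -/
def pull (σ : Sig) : ℕ → Word → List (Layer × Word)
  | _, [] => []
  | 0, a :: v => [(a, v)]
  | n + 1, a :: v => (pull σ n v).flatMap fun q =>
      (commLeft σ a q.1 ++ commRight σ a q.1).map fun z => (z.1, z.2 :: q.2)

/-- Moves the layer `t` of a word to the front and applies `k` to the rest. -/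
def extract (σ : Sig) (t : Layer) (v : Word) (k : Word → Option Word) : Option Word :=
  (List.range v.length).findSome? fun n =>
    (pull σ n v).findSome? fun q => if q.1 = t then k q.2 else none

/-- The rest of a word that has another word as its beginning, up to interchange. -/
def extractAll (σ : Sig) : Word → Word → Option Word
  | [], v => some v
  | t :: p, v => extract σ t v (extractAll σ p)

/-- Moves the layers at the given positions of a word to the front; `k` of them are there. -/
def pullAll (σ : Sig) : ℕ → List ℕ → Word → Option (Word × Word)
  | _, [], v => some ([], v)
  | k, n :: ns, v =>
    (pull σ (n - k) v).head?.bind fun q =>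
      (pullAll σ (k + 1) ns q.2).map fun z => (q.1 :: z.1, z.2)

variable {σ : Sig} {ε : Env σ}

/-- The stripped prefix exhibits the strands between the two letters, and the exchange is the
interchange law, read backwards for `commLeft`. -/
theorem comm_sound {a b : Layer} {z : Layer × Layer}
    (hz : z ∈ commLeft σ a b ++ commRight σ a b) : Eqv ε (a.ins σ) [a, b] [z.1, z.2] := by
  obtain ⟨al, ax, ar⟩ := a
  obtain ⟨bl, bx, br⟩ := b
  rcases List.mem_append.mp hz with hz | hz
  · unfold commLeft at hz
    split at hz
    · rename_i m hm
      split_ifs at hz with hr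
      · obtain rfl := List.mem_singleton.mp hz
        have hm := eq_append_of_stripPrefix hm
        dsimp only at hm hr
        subst hm hr
        have := (Eqv.interchange ε bl m ar bx ax).symm
        simpa [Layer.ins] using this
      · simp at hz
    · simp at hz
  · unfold commRight at hz
    split at hz
    · rename_i m hm
      split_ifs at hz with hr
      · obtain rfl := List.mem_singleton.mp hz
        have hm := eq_append_of_stripPrefix hm
        dsimp only at hm hr
        subst hm hr
        have := Eqv.interchange ε al m br ax bx
        simpa [Layer.ins] using this
      · simp at hz
    · simp at hz

/-- A layer reaches the front by being exchanged with its predecessors one at a time. There can be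
several results: a letter without outputs and a following letter without inputs at the same place
can pass each other on either side. -/
theorem pull_sound (ε : Env σ) : ∀ {n : ℕ} {v : Word} {s : List ℕ} {q : Layer × Word}, q ∈ pull σ n v →
    Valid σ s v → Eqv ε s v (q.1 :: q.2)
  | _, [], _, _, hq, _ => by simp [pull] at hq
  | 0, a :: v, _, q, hq, h => by
    obtain rfl := List.mem_singleton.mp hq
    exact .refl h
  | n + 1, a :: v, s, q, hq, h => by
    simp only [pull, List.mem_flatMap, List.mem_map] at hq
    obtain ⟨q', hq', z, hz, rfl⟩ := hq
    obtain ⟨rfl, h⟩ := h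
    have h₁ := (pull_sound ε hq' h).cons
    exact h₁.trans ((comm_sound hz).append_right q'.2 h₁.valid'.2.2)

/-- The rest of the search is passed as the continuation `k`, so that a way of moving `t` that
blocks later layers is given up in favor of another. -/
theorem extract_sound {t : Layer} {v v' : Word} {s : List ℕ} {k : Word → Option Word}
    (hv : extract σ t v k = some v') (h : Valid σ s v) :
    ∃ v₁, k v₁ = some v' ∧ Eqv ε s v (t :: v₁) := by
  obtain ⟨n, -, hn⟩ := List.exists_of_findSome?_eq_some hv
  obtain ⟨q, hq, hn⟩ := List.exists_of_findSome?_eq_some hn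
  split_ifs at hn with ht
  exact ⟨q.2, hn, ht ▸ pull_sound ε hq h⟩

theorem extractAll_sound : ∀ {p v v' : Word} {s : List ℕ}, extractAll σ p v = some v' →
    Valid σ s v → Eqv ε s v (p ++ v')
  | [], v, v', s, hv, h => by
    obtain rfl := Option.some.inj hv
    exact .refl h
  | t :: p, v, v', s, hv, h => by
    obtain ⟨z, hz', h₁⟩ := extract_sound (ε := ε) hv h
    obtain ⟨rfl, h₂⟩ := h₁.valid'
    exact h₁.trans (extractAll_sound hz' h₂).cons

theorem pullAll_sound : ∀ {k : ℕ} {ns : List ℕ} {v : Word} {s : List ℕ} {z : Word × Word},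
    pullAll σ k ns v = some z → Valid σ s v → Eqv ε s v (z.1 ++ z.2)
  | _, [], v, s, z, hz, h => by
    obtain rfl := Option.some.inj hz
    exact .refl h
  | k, n :: ns, v, s, z, hz, h => by
    obtain ⟨q, hq, hz⟩ := Option.bind_eq_some_iff.mp hz
    obtain ⟨z', hz', rfl⟩ := Option.map_eq_some_iff.mp hz
    have h₁ := pull_sound ε (List.mem_of_mem_head? hq) h
    obtain ⟨rfl, h₂⟩ := h₁.valid'
    exact h₁.trans (pullAll_sound hz' h₂).cons

/-- Replaces a part of a word: the layers at the positions `ns` are moved to the front; in what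
follows, the word `p`, with `o` strands to the left of it, is moved to the front and replaced
by `p'`. -/
def rewrite (σ : Sig) (s i : List ℕ) (p p' : Word) (o : ℕ) (ns : List ℕ) (v : Word) : Option Word :=
  (pullAll σ 0 ns v).bind fun z =>
    let s' := outs σ s z.1
    let a := s'.take o
    let b := s'.drop (o + i.length)
    if s' = a ++ (i ++ b) then
      (extractAll σ (shift a b p) z.2).map fun v' => z.1 ++ (shift a b p' ++ v')
    else none

/-- An equation stays valid with strands added on both sides and layers added before and after; the
search only has to find such a context, up to interchange. -/
theorem rewrite_sound {s i : List ℕ} {p p' : Word} {o : ℕ} {ns : List ℕ} {v v' : Word}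
    (hp : Eqv ε i p p') (hv : rewrite σ s i p p' o ns v = some v') (h : Valid σ s v) :
    Eqv ε s v v' := by
  obtain ⟨z, hz, hv⟩ := Option.bind_eq_some_iff.mp hv
  dsimp only at hv
  split_ifs at hv with hs
  obtain ⟨q, hq, rfl⟩ := Option.map_eq_some_iff.mp hv
  have h₁ := pullAll_sound (ε := ε) hz h
  have h₂ := (valid_append _ _ _).mp h₁.valid'
  refine h₁.trans (Eqv.append_left _ h₂.1 ?_)
  have h₃ := extractAll_sound (ε := ε) hq h₂.2
  refine h₃.trans (Eqv.append_right ?_ _ ((valid_append _ _ _).mp h₃.valid').2)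
  have h₄ := hp.shift ((outs σ s z.1).take o) ((outs σ s z.1).drop (o + i.length))
  rwa [← hs] at h₄

end Word

/-! ### From diagrams to words of layers, and the equality test. -/

namespace E

/-- The word of a diagram. -/
def word (σ : Sig) : E → Word
  | id _ => []
  | x a => [⟨[], a, []⟩]
  | comp f g => f.word σ ++ g.word σ
  | tensor f g => Word.shift [] (g.ins σ) (f.word σ) ++ Word.shift (f.outs σ) [] (g.word σ)

/-- A tensor product is flattened as `f ⊗ id` followed by `id ⊗ g`, which costs one use of the
interchange law. -/
theorem word_sound {σ : Sig} (ε : Env σ) : ∀ f : E, f.wt σ = true →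
    Word.Valid σ (f.ins σ) (f.word σ) ∧ Word.outs σ (f.ins σ) (f.word σ) = f.outs σ ∧
      f.den ε = Word.den ε (f.ins σ) (f.word σ)
  | id s, _ => ⟨trivial, rfl, rfl⟩
  | x a, _ => by
    refine ⟨⟨by simp [Layer.ins, ins], trivial⟩, by simp [word, Word.outs, Layer.outs, outs], ?_⟩
    change ε.letter a = (Layer.den ε ⟨[], a, []⟩).comp (.id _)
    rw [Mor.comp_id (Layer.den_typed ε _).2]
    change _ = (Mor.id 0).tensor ((ε.letter a).tensor (Mor.id 0))
    rw [Mor.id_zero_tensor, Mor.tensor_id_zero]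
  | comp f g, h => by
    simp only [wt, Bool.and_eq_true, decide_eq_true_eq] at h
    obtain ⟨⟨hf, hg⟩, hfg⟩ := h
    obtain ⟨f₁, f₂, f₃⟩ := word_sound ε f hf
    obtain ⟨g₁, g₂, g₃⟩ := word_sound ε g hg
    have hv : Word.Valid σ (f.ins σ) (f.word σ ++ g.word σ) :=
      (Word.valid_append _ _ _).mpr ⟨f₁, by rw [f₂, hfg]; exact g₁⟩
    refine ⟨hv, ?_, ?_⟩
    · change Word.outs σ (f.ins σ) (f.word σ ++ g.word σ) = _
      rw [Word.outs_append, f₂, hfg]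
      exact g₂
    · change _ = Word.den ε (f.ins σ) (f.word σ ++ g.word σ)
      rw [Word.den_append ε _ _ _ hv, f₂, hfg, ← f₃, ← g₃]
      rfl
  | tensor f g, h => by
    simp only [wt, Bool.and_eq_true] at h
    obtain ⟨f₁, f₂, f₃⟩ := word_sound ε f h.1
    obtain ⟨g₁, g₂, g₃⟩ := word_sound ε g h.2
    have vf := Word.valid_shift [] (g.ins σ) _ _ f₁
    have of := Word.outs_shift (σ := σ) [] (g.ins σ) (f.ins σ) (f.word σ)
    have df := Word.den_shift (ε := ε) [] (g.ins σ) _ _ f₁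
    have vg := Word.valid_shift (f.outs σ) [] _ _ g₁
    have og := Word.outs_shift (σ := σ) (f.outs σ) [] (g.ins σ) (g.word σ)
    have dg := Word.den_shift (ε := ε) (f.outs σ) [] _ _ g₁
    simp only [List.nil_append, List.append_nil, f₂, g₂] at vf of df vg og dg
    have hv : Word.Valid σ ((tensor f g).ins σ) ((tensor f g).word σ) :=
      (Word.valid_append _ _ _).mpr ⟨vf, of.symm ▸ vg⟩
    refine ⟨hv, ?_, ?_⟩
    · exact (Word.outs_append _ _ _).trans ((congrArg (Word.outs σ · _) of).trans og)
    · refine Eq.trans ?_ (Word.den_append ε _ _ _ hv).symm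
      change (f.den ε).tensor (g.den ε) = (Word.den ε (f.ins σ ++ g.ins σ) _).comp
        (Word.den ε (Word.outs σ (f.ins σ ++ g.ins σ) _) _)
      rw [of, df, dg, ← f₃, ← g₃]
      have tf := den_typed ε f h.1
      have tg := den_typed ε g h.2
      change _ = ((Mor.id 0).tensor ((f.den ε).tensor (Mor.id _))).comp
        ((Mor.id _).tensor ((g.den ε).tensor (Mor.id 0)))
      rw [Mor.id_zero_tensor, Mor.tensor_id_zero, ← Mor.tensor_comp tf.2 tg.1.symm,
        Mor.comp_id tf.2, Mor.id_comp tg.1.symm]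

/-- An equation between diagrams, with instructions where to use it. -/
structure Step where
  /-- The left-hand side. -/
  lhs : E
  /-- The right-hand side. -/
  rhs : E
  /-- The number of strands to the left of the place where the equation is used. -/
  off : ℕ
  /-- The positions of the layers above that place. -/
  pos : List ℕ

/-- Both sides of a step are diagrams with the same inputs and outputs. -/
def Step.wt (σ : Sig) (z : Step) : Bool :=
  z.lhs.wt σ && z.rhs.wt σ && decide (z.lhs.ins σ = z.rhs.ins σ) &&
    decide (z.lhs.outs σ = z.rhs.outs σ)

/-- The word to which a sequence of steps leads. -/
def run (σ : Sig) (s : List ℕ) : List Step → Word → Option Word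
  | [], v => some v
  | z :: zs, v =>
    if z.wt σ then
      (Word.rewrite σ s (z.lhs.ins σ) (z.lhs.word σ) (z.rhs.word σ) z.off z.pos v).bind
        (run σ s zs)
    else none

/-- Two sequences of steps lead from two diagrams to the same word, up to interchange. -/
def check (σ : Sig) (f g : E) (zs zs' : List Step) : Bool :=
  f.wt σ && g.wt σ && decide (f.ins σ = g.ins σ) &&
    match run σ (f.ins σ) zs (f.word σ), run σ (f.ins σ) zs' (g.word σ) with
    | some v, some v' => decide (Word.extractAll σ v' v = some [])
    | _, _ => false

theorem run_sound {σ : Sig} (ε : Env σ) {s : List ℕ} : ∀ {zs : List Step} {v v' : Word},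
    (∀ z ∈ zs, z.lhs.den ε = z.rhs.den ε) → run σ s zs v = some v' → Word.Valid σ s v →
      Word.Eqv ε s v v'
  | [], v, v', _, h, hv => by
    obtain rfl := Option.some.inj h
    exact .refl hv
  | z :: zs, v, v', hz, h, hv => by
    simp only [run] at h
    split_ifs at h with hw
    obtain ⟨v'', hv'', h⟩ := Option.bind_eq_some_iff.mp h
    simp only [Step.wt, Bool.and_eq_true, decide_eq_true_eq] at hw
    obtain ⟨⟨⟨w₁, w₂⟩, w₃⟩, w₄⟩ := hw
    obtain ⟨l₁, l₂, l₃⟩ := word_sound ε z.lhs w₁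
    obtain ⟨r₁, r₂, r₃⟩ := word_sound ε z.rhs w₂
    rw [← w₃] at r₁ r₂ r₃
    have hp : Word.Eqv ε (z.lhs.ins σ) (z.lhs.word σ) (z.rhs.word σ) :=
      ⟨l₁, r₁, by rw [l₂, r₂, w₄], by rw [← l₃, ← r₃, hz z List.mem_cons_self]⟩
    have h₁ := Word.rewrite_sound hp hv'' hv
    exact h₁.trans (run_sound ε (fun z h => hz z (List.mem_cons_of_mem _ h)) h h₁.valid')

/-- Every rewriting step preserves the value. The final test asks whether one resulting word can be
rearranged into the other by interchange with nothing left over. The search may be incomplete, but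
success is always a proof. -/
theorem check_sound {σ : Sig} (ε : Env σ) {f g : E} {zs zs' : List Step}
    (hz : ∀ z ∈ zs, z.lhs.den ε = z.rhs.den ε) (hz' : ∀ z ∈ zs', z.lhs.den ε = z.rhs.den ε)
    (h : check σ f g zs zs' = true) : f.den ε = g.den ε := by
  simp only [check, Bool.and_eq_true, decide_eq_true_eq] at h
  obtain ⟨⟨⟨hf, hg⟩, hfg⟩, h⟩ := h
  obtain ⟨f₁, f₂, f₃⟩ := word_sound ε f hf
  obtain ⟨g₁, g₂, g₃⟩ := word_sound ε g hg
  split at h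
  · rename_i v v' hv hv'
    have h₁ := run_sound ε hz hv f₁
    have h₂ := run_sound ε hz' hv' (hfg ▸ g₁)
    have h₃ := Word.extractAll_sound (ε := ε) (of_decide_eq_true h) h₁.valid'
    rw [List.append_nil] at h₃
    rw [f₃, g₃, ← hfg]
    exact (h₁.trans (h₃.trans h₂.symm)).den_eq
  · simp at h

/-- An instruction to use the equation with the number `n` of a list, from right to left if `flip`
is true, at the place described by `off` and `pos`. -/
structure Instr where
  /-- The number of the equation. -/
  n : ℕ
  /-- The direction. -/
  flip : Bool
  /-- The number of strands to the left of the place where the equation is used. -/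
  off : ℕ
  /-- The positions of the layers above that place. -/
  pos : List ℕ

/-- The step for an instruction. -/
def Instr.step (rs : List (E × E)) (z : Instr) : Step :=
  let p := rs.getD z.n (id [], id [])
  if z.flip then ⟨p.2, p.1, z.off, z.pos⟩ else ⟨p.1, p.2, z.off, z.pos⟩

/-- The equations in a list hold. -/
inductive Eqns {σ : Sig} (ε : Env σ) : List (E × E) → Prop
  | nil : Eqns ε []
  | cons {f g : E} {rs : List (E × E)} (h : f.den ε = g.den ε) (hs : Eqns ε rs) :
      Eqns ε ((f, g) :: rs)

theorem Eqns.getD {σ : Sig} {ε : Env σ} {rs : List (E × E)} (h : Eqns ε rs) :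
    ∀ n : ℕ, (rs.getD n (id [], id [])).1.den ε = (rs.getD n (id [], id [])).2.den ε := by
  induction h with
  | nil => exact fun _ => rfl
  | cons h _ ih =>
    intro n
    cases n with
    | zero => exact h
    | succ n => exact ih n

theorem Instr.step_sound {σ : Sig} (ε : Env σ) {rs : List (E × E)} (h : Eqns ε rs)
    (zs : List Instr) : ∀ z ∈ zs.map (Instr.step rs), z.lhs.den ε = z.rhs.den ε := by
  intro z hz
  obtain ⟨y, -, rfl⟩ := List.mem_map.mp hz
  have key := h.getD y.n
  unfold Instr.step
  dsimp only
  split_ifs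
  · exact key.symm
  · exact key

/-- Two diagrams have the same value if this follows from a list of equations by rewriting both
sides. -/
theorem den_eq_of_check {σ : Sig} (ε : Env σ) {f g : E} {rs : List (E × E)} (hr : Eqns ε rs)
    (zs zs' : List Instr)
    (h : check σ f g (zs.map (Instr.step rs)) (zs'.map (Instr.step rs)) = true) :
    f.den ε = g.den ε :=
  check_sound ε (Instr.step_sound ε hr zs) (Instr.step_sound ε hr zs') h

/-- All strands of a diagram have the label `0`, and there are no variables. -/
def thin : E → Bool
  | id s => s.all (· == 0)
  | x (.g _) => true
  | x (.v _) => false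
  | comp f g => f.thin && g.thin
  | tensor f g => f.thin && g.thin

/-- The environment of the diagrams without variables. -/
def thinEnv : Env [] := ⟨fun _ => 1, rfl, [], .nil⟩

/-- Without variables and wide strands nothing depends on the environment, so identities of the Hopf
algebra can be used inside diagrams that contain whole words. -/
theorem den_thin {σ : Sig} (ε : Env σ) : ∀ f : E, f.thin = true → f.den ε = f.den thinEnv
  | id s, h => by
    have e : ∀ {τ : Sig} (δ : Env τ), δ.wd s = s.length := by
      intro τ δ
      have : ∀ i ∈ s, i = 0 := by simpa [thin] using h
      rw [List.eq_replicate_of_mem this]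
      simp [Env.wd, δ.width_zero]
    simp only [den, e]
  | x (.g _), _ => rfl
  | x (.v _), h => by simp [thin] at h
  | comp f g, h => by
    simp only [thin, Bool.and_eq_true] at h
    simp only [den, den_thin ε f h.1, den_thin ε g h.2]
  | tensor f g, h => by
    simp only [thin, Bool.and_eq_true] at h
    simp only [den, den_thin ε f h.1, den_thin ε g h.2]

end E

/-- Two diagrams without variables have the same value. -/
def Holds (f g : E) : Prop := f.den E.thinEnv = g.den E.thinEnv

namespace Holds

variable {f g h : E}

theorem symm (p : Holds f g) : Holds g f := Eq.symm p

theorem den (p : Holds f g) {σ : Sig} (ε : Env σ) (h : (f.thin && g.thin) = true := by rfl) :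
    f.den ε = g.den ε := by
  rw [Bool.and_eq_true] at h
  rw [E.den_thin ε f h.1, E.den_thin ε g h.2]
  exact p

/-- An equation that holds, with instructions where to use it. -/
structure Use where
  /-- The left-hand side. -/
  lhs : E
  /-- The right-hand side. -/
  rhs : E
  holds : Holds lhs rhs
  /-- The number of strands to the left of the place where the equation is used. -/
  off : ℕ
  /-- The positions of the layers above that place. -/
  pos : List ℕ

/-- The use of an equation with `o` strands to the left, below the layers at the positions `ns`. -/
def use (p : Holds f g) (o : ℕ) (ns : List ℕ := []) : Use := ⟨f, g, p, o, ns⟩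

/-- The step that belongs to the use of an equation. -/
def Use.step (z : Use) : E.Step := ⟨z.lhs, z.rhs, z.off, z.pos⟩

/-- Two diagrams have the same value if this follows by rewriting both sides. -/
theorem of_uses (zs zs' : List Use)
    (h : E.check [] f g (zs.map Use.step) (zs'.map Use.step) = true) : Holds f g := by
  refine E.check_sound E.thinEnv ?_ ?_ h <;>
  · intro z hz
    obtain ⟨y, -, rfl⟩ := List.mem_map.mp hz
    exact y.holds

end Holds

end BPHopf

namespace BPHopf

open StrictPres

/-! ## The braiding -/

namespace Mor

theorem tm_br_natural {f g : Mor} {a b c d : ℕ} (ha : f.dom = a) (hb : f.cod = b) (hc : g.dom = c)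
    (hd : g.cod = d) :
    comp (tensor f g) (tm (br b d)) = comp (tm (br a c)) (tensor g f) := by
  subst ha hb hc hd
  obtain ⟨s, hs⟩ := exists_tm f
  obtain ⟨t, ht⟩ := exists_tm g
  have := tm_eq (.rel (.br_natural s t))
  rw [tm_comp, tm_comp, tm_tensor, tm_tensor, ← hs, ← ht] at this
  exact this

theorem tm_br_add_right (a b c : ℕ) : tm (br a (b + c)) =
    comp (tensor (tm (br a b)) (id c)) (tensor (id b) (tm (br a c))) := by
  have := tm_eq (.rel (.hexagon_forward a b c))
  simp only [tm_comp, tm_tensor, tm_ofEq, tm_id] at this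
  rw [comp_id (by simp), id_comp (by simp; omega), id_comp (by simp; omega)] at this
  exact this

theorem tm_br_add_left (a b c : ℕ) : tm (br (a + b) c) =
    comp (tensor (id a) (tm (br b c))) (tensor (tm (br a c)) (id b)) := by
  have := tm_eq (.rel (.hexagon_reverse a b c))
  simp only [tm_comp, tm_tensor, tm_ofEq, tm_id] at this
  rw [comp_id (by simp), id_comp (by simp; omega), id_comp (by simp; omega)] at this
  exact this

theorem tm_br_brInv (a b : ℕ) : comp (tm (br a b)) (tm (brInv a b)) = id (a + b) :=
  (tm_comp _ _).symm.trans (tm_eq (.rel (.br_brInv a b)))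

theorem tm_brInv_br (a b : ℕ) : comp (tm (brInv a b)) (tm (br a b)) = id (b + a) :=
  (tm_comp _ _).symm.trans (tm_eq (.rel (.brInv_br a b)))

/-- An idempotent with a one-sided inverse is an identity. -/
theorem eq_id_of_comp_self {f f' : Mor} {n : ℕ} (h : f.cod = n) (h' : f'.dom = n) (hn : f.dom = n)
    (hff : comp f f = f) (hf : comp f f' = id n) : f = id n := by
  rw [← hf]
  conv_rhs => rw [← hff]
  rw [comp_assoc (h.trans hn.symm) (h.trans h'.symm), hf, comp_id h]

theorem tm_br_zero_right (n : ℕ) : tm (br n 0) = id n := by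
  -- With two zero objects the hexagon says that this braiding is idempotent.
  have h := tm_br_add_right n 0 0
  rw [id_zero_tensor, tensor_id_zero] at h
  exact eq_id_of_comp_self (by simp) (by simp) (by simp) h.symm
    ((tm_br_brInv n 0).trans (by rw [add_zero]))

theorem tm_br_zero_left (n : ℕ) : tm (br 0 n) = id n := by
  have h := tm_br_add_left 0 0 n
  rw [id_zero_tensor, tensor_id_zero] at h
  exact eq_id_of_comp_self (by simp) (by simp) (by simp) h.symm
    ((tm_br_brInv 0 n).trans (by rw [zero_add]))

/-- A commutative square with two invertible sides. -/
theorem comp_inv_square {f g p p' q q' : Mor} (h : comp f q = comp p g) (hp : comp p' p = id g.dom)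
    (hq : comp q q' = id f.cod) (h₁ : f.cod = q.dom) (h₂ : p.cod = g.dom) (h₃ : p'.cod = p.dom)
    (h₄ : q.cod = q'.dom) : comp p' f = comp g q' := by
  have hc : g.cod = q.cod := by rw [← comp_cod h₁, h, comp_cod h₂]
  calc comp p' f = comp p' (comp f (comp q q')) := by rw [hq, comp_id rfl]
    _ = comp p' (comp (comp f q) q') := by rw [comp_assoc h₁ h₄]
    _ = comp p' (comp p (comp g q')) := by rw [h, comp_assoc h₂ (hc.trans h₄)]
    _ = comp (comp p' p) (comp g q') := by
      rw [comp_assoc h₃ (by rw [comp_dom, h₂])]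
    _ = comp g q' := by rw [hp, id_comp (comp_dom _ _).symm]

end Mor

/-! ## Basic equations between diagrams -/

local infixr:60 " ⨾ " => E.comp
local infixr:70 " ⊠ " => E.tensor

namespace E

/-- The identity of `n` strands. -/
abbrev i (n : ℕ) : E := id (List.replicate n 0)
abbrev m : E := x (.g .m)
abbrev u : E := x (.g .u)
abbrev D : E := x (.g .D)
abbrev e : E := x (.g .e)
abbrev S : E := x (.g .S)
abbrev s : E := x (.g .s)
abbrev l : E := x (.g .l)
abbrev L : E := x (.g .L)
abbrev t : E := x (.g .t)
abbrev T : E := x (.g .T)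
abbrev w : E := x (.g .w)
abbrev c : E := x (.g .c)
abbrev C : E := x (.g .C)
abbrev b : E := x (.g .b)
abbrev X : E := x (.g .X)
abbrev Y : E := x (.g .Y)
abbrev Xh : E := x (.g .Xh)
abbrev Yh : E := x (.g .Yh)

/-- The braiding of some strands (at most two) with one strand. -/
abbrev cl : ℕ → E
  | 0 => i 1
  | 1 => c
  | _ => (i 1 ⊠ c) ⨾ (c ⊠ i 1)

/-- The braiding of one strand with some strands (at most two). -/
abbrev cr : ℕ → E
  | 0 => i 1
  | 1 => c
  | _ => (c ⊠ i 1) ⨾ (i 1 ⊠ c)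

/-- The inverse of the braiding of one strand with some strands. -/
abbrev Cl : ℕ → E
  | 0 => i 1
  | 1 => C
  | _ => (i 1 ⊠ C) ⨾ (C ⊠ i 1)

/-- The inverse of the braiding of some strands with one strand. -/
abbrev Cr : ℕ → E
  | 0 => i 1
  | 1 => C
  | _ => (C ⊠ i 1) ⨾ (i 1 ⊠ C)

end E

open E

/-- The value of a formal morphism, computed step by step. -/
def Mor.eval : ∀ {a b : ℕ}, Term Gen a b → Mor
  | _, _, .id a => .id a
  | _, _, .comp f g => (eval f).comp (eval g)
  | _, _, .tensor f g => (eval f).tensor (eval g)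
  | _, _, .gen a => .tm (.gen a)

theorem Mor.tm_eq_eval : ∀ {a b : ℕ} (t : Term Gen a b), Mor.tm t = Mor.eval t
  | _, _, .id _ => rfl
  | _, _, .comp f g => by rw [tm_comp, tm_eq_eval f, tm_eq_eval g]; rfl
  | _, _, .tensor f g => by rw [tm_tensor, tm_eq_eval f, tm_eq_eval g]; rfl
  | _, _, .gen _ => rfl

/-- `Mor.eval` composes in `Mor`, exactly as the value of a diagram does, so for every axiom both
comparisons hold by `rfl`. -/
theorem holds_of_axiom {f g : E} {a b : ℕ} {p q : Term Gen a b} (h : Axioms a b p q)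
    (hf : Mor.eval p = f.den thinEnv) (hg : Mor.eval q = g.den thinEnv) : Holds f g :=
  hf.symm.trans ((Mor.tm_eq_eval p).symm.trans ((Mor.tm_eq (.rel h)).trans
    ((Mor.tm_eq_eval q).trans hg)))

theorem den_i (n : ℕ) : (i n).den thinEnv = .id n := by
  simp [den, Env.wd, thinEnv]

theorem wd_thinEnv : thinEnv.wd [0] = 1 := rfl

theorem c_C : Holds (c ⨾ C) (i 2) := Mor.tm_br_brInv 1 1
theorem C_c : Holds (C ⨾ c) (i 2) := Mor.tm_brInv_br 1 1

theorem den_cl (n : ℕ) (h : n ≤ 2) : (cl n).den thinEnv = .tm (br n 1) :=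
  match n, h with
  | 0, _ => (Mor.tm_br_zero_left 1).symm
  | 1, _ => rfl
  | 2, _ => (Mor.tm_br_add_left 1 1 1).symm

theorem den_cr (n : ℕ) (h : n ≤ 2) : (cr n).den thinEnv = .tm (br 1 n) :=
  match n, h with
  | 0, _ => (Mor.tm_br_zero_right 1).symm
  | 1, _ => rfl
  | 2, _ => (Mor.tm_br_add_right 1 1 1).symm

theorem Thin.ins_le (x : Thin) : x.ins.length ≤ 2 := by cases x <;> decide
theorem Thin.outs_le (x : Thin) : x.outs.length ≤ 2 := by cases x <;> decide

/-- One statement for all letters, decorated crossings included; two strands on either side suffice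
because no letter has more inputs or outputs. -/
theorem cl_nat (x : Thin) :
    Holds (.x (.g x) ⊠ i 1 ⨾ cl x.outs.length) (cl x.ins.length ⨾ i 1 ⊠ .x (.g x)) := by
  change (x.den.tensor (.id 1)).comp ((cl x.outs.length).den thinEnv) =
    ((cl x.ins.length).den thinEnv).comp ((Mor.id 1).tensor x.den)
  rw [den_cl _ x.ins_le, den_cl _ x.outs_le]
  exact Mor.tm_br_natural x.den_dom x.den_cod rfl rfl

theorem cr_nat (x : Thin) :
    Holds (i 1 ⊠ .x (.g x) ⨾ cr x.outs.length) (cr x.ins.length ⨾ .x (.g x) ⊠ i 1) := by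
  change ((Mor.id 1).tensor x.den).comp ((cr x.outs.length).den thinEnv) =
    ((cr x.ins.length).den thinEnv).comp (x.den.tensor (.id 1))
  rw [den_cr _ x.ins_le, den_cr _ x.outs_le]
  exact Mor.tm_br_natural rfl rfl x.den_dom x.den_cod

theorem cl_Cr (n : ℕ) (h : n ≤ 2) : Holds (cl n ⨾ Cr n) (i (n + 1)) :=
  match n, h with
  | 0, _ => .of_uses [] [] (by decide +kernel)
  | 1, _ => c_C
  | 2, _ => .of_uses [c_C.use 0 [0], c_C.use 1] [] (by decide +kernel)

theorem Cr_cl (n : ℕ) (h : n ≤ 2) : Holds (Cr n ⨾ cl n) (i (n + 1)) :=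
  match n, h with
  | 0, _ => .of_uses [] [] (by decide +kernel)
  | 1, _ => C_c
  | 2, _ => .of_uses [C_c.use 1 [0], C_c.use 0] [] (by decide +kernel)

theorem cr_Cl (n : ℕ) (h : n ≤ 2) : Holds (cr n ⨾ Cl n) (i (n + 1)) :=
  match n, h with
  | 0, _ => .of_uses [] [] (by decide +kernel)
  | 1, _ => c_C
  | 2, _ => .of_uses [c_C.use 1 [0], c_C.use 0] [] (by decide +kernel)

theorem Cl_cr (n : ℕ) (h : n ≤ 2) : Holds (Cl n ⨾ cr n) (i (n + 1)) :=
  match n, h with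
  | 0, _ => .of_uses [] [] (by decide +kernel)
  | 1, _ => C_c
  | 2, _ => .of_uses [C_c.use 0 [0], C_c.use 1] [] (by decide +kernel)

theorem Cl_typed (n : ℕ) (h : n ≤ 2) : ((Cl n).den thinEnv).dom = n + 1 ∧
    ((Cl n).den thinEnv).cod = n + 1 :=
  match n, h with
  | 0, _ => ⟨rfl, rfl⟩
  | 1, _ => ⟨rfl, rfl⟩
  | 2, _ => ⟨rfl, rfl⟩

theorem Cr_typed (n : ℕ) (h : n ≤ 2) : ((Cr n).den thinEnv).dom = n + 1 ∧
    ((Cr n).den thinEnv).cod = n + 1 :=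
  match n, h with
  | 0, _ => ⟨rfl, rfl⟩
  | 1, _ => ⟨rfl, rfl⟩
  | 2, _ => ⟨rfl, rfl⟩

/-- Naturality of an inverse braiding comes from inverting two sides of the square for the braiding
itself. -/
theorem Cl_nat (x : Thin) :
    Holds (Cl x.ins.length ⨾ i 1 ⊠ .x (.g x)) (.x (.g x) ⊠ i 1 ⨾ Cl x.outs.length) := by
  have hi := Cl_cr _ x.ins_le
  have ho := cr_Cl _ x.outs_le
  have ti := Cl_typed _ x.ins_le
  have tt := Cl_typed _ x.outs_le
  rw [Holds, den_i] at hi ho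
  refine Mor.comp_inv_square (cr_nat x) (hi.trans ?_) (ho.trans ?_) ?_ ?_ ?_ ?_ <;>
    simp only [den, den_cr _ x.ins_le, den_cr _ x.outs_le, Mor.tensor_dom, Mor.tensor_cod,
      Mor.id_dom, Mor.id_cod, Mor.tm_dom, Mor.tm_cod, Env.letter, x.den_dom, x.den_cod, ti, tt] <;>
    simp [add_comm, wd_thinEnv]

theorem Cr_nat (x : Thin) :
    Holds (Cr x.ins.length ⨾ .x (.g x) ⊠ i 1) (i 1 ⊠ .x (.g x) ⨾ Cr x.outs.length) := by
  have hi := Cr_cl _ x.ins_le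
  have ho := cl_Cr _ x.outs_le
  have ti := Cr_typed _ x.ins_le
  have tt := Cr_typed _ x.outs_le
  rw [Holds, den_i] at hi ho
  refine Mor.comp_inv_square (cl_nat x) (hi.trans ?_) (ho.trans ?_) ?_ ?_ ?_ ?_ <;>
    simp only [den, den_cl _ x.ins_le, den_cl _ x.outs_le, Mor.tensor_dom, Mor.tensor_cod,
      Mor.id_dom, Mor.id_cod, Mor.tm_dom, Mor.tm_cod, Env.letter, x.den_dom, x.den_cod, ti, tt] <;>
    simp [add_comm, wd_thinEnv]

end BPHopf

namespace BPHopf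

open StrictPres

namespace E

local infixr:60 " ⨾ " => E.comp
local infixr:70 " ⊠ " => E.tensor

/-! ### The axioms of a BP Hopf algebra -/

theorem mul_assoc : Holds (m ⊠ i 1 ⨾ m) (i 1 ⊠ m ⨾ m) :=
  holds_of_axiom .mul_assoc rfl rfl

theorem one_mul : Holds (u ⊠ i 1 ⨾ m) (i 1) :=
  holds_of_axiom .one_mul rfl rfl

theorem mul_one : Holds (i 1 ⊠ u ⨾ m) (i 1) :=
  holds_of_axiom .mul_one rfl rfl

theorem comul_assoc : Holds (D ⨾ D ⊠ i 1) (D ⨾ i 1 ⊠ D) :=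
  holds_of_axiom .comul_assoc rfl rfl

theorem counit_comul : Holds (D ⨾ e ⊠ i 1) (i 1) :=
  holds_of_axiom .counit_comul rfl rfl

theorem comul_counit : Holds (D ⨾ i 1 ⊠ e) (i 1) :=
  holds_of_axiom .comul_counit rfl rfl

theorem mul_comul : Holds (D ⊠ D ⨾ i 1 ⊠ c ⊠ i 1 ⨾ m ⊠ m) (m ⨾ D) :=
  holds_of_axiom .mul_comul rfl rfl

theorem mul_counit : Holds (m ⨾ e) (e ⊠ e) :=
  holds_of_axiom .mul_counit rfl rfl

theorem one_comul : Holds (u ⨾ D) (u ⊠ u) :=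
  holds_of_axiom .one_comul rfl rfl

theorem one_counit : Holds (u ⨾ e) (i 0) :=
  holds_of_axiom .one_counit rfl rfl

theorem antipode_left : Holds (D ⨾ S ⊠ i 1 ⨾ m) (e ⨾ u) :=
  holds_of_axiom .antipode_left rfl rfl

theorem antipode_right : Holds (D ⨾ i 1 ⊠ S ⨾ m) (e ⨾ u) :=
  holds_of_axiom .antipode_right rfl rfl

theorem SInv_S : Holds (s ⨾ S) (i 1) :=
  holds_of_axiom .SInv_S rfl rfl

theorem S_SInv : Holds (S ⨾ s) (i 1) :=
  holds_of_axiom .S_SInv rfl rfl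

theorem element_invariant : Holds (L ⊠ i 1 ⨾ m) (e ⨾ L) :=
  holds_of_axiom .element_invariant rfl rfl

theorem tau_tauInv : Holds (t ⨾ T) (i 1) :=
  holds_of_axiom .tau_tauInv rfl rfl

theorem tauInv_tau : Holds (T ⨾ t) (i 1) :=
  holds_of_axiom .tauInv_tau rfl rfl

theorem tau_antipode : Holds (t ⨾ S) (S ⨾ t) :=
  holds_of_axiom .tau_antipode rfl rfl

theorem tau_counit : Holds (t ⨾ e) (e) :=
  holds_of_axiom .tau_counit rfl rfl

theorem tau_mul : Holds (t ⊠ i 1 ⨾ m) (m ⨾ t) :=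
  holds_of_axiom .tau_mul rfl rfl

theorem copairing_eq : Holds (w) (u ⨾ T ⨾ D ⨾ t ⊠ t) :=
  holds_of_axiom .copairing_eq rfl rfl

theorem copairing_comul : Holds (w ⨾ i 1 ⊠ D) (w ⨾ i 1 ⊠ w ⊠ i 1 ⨾ m ⊠ i 2) :=
  holds_of_axiom .copairing_comul rfl rfl

theorem tauInv_comul : Holds (T ⨾ D) (D ⨾ C ⨾ (i 1 ⊠ w ⊠ i 1 ⨾ m ⊠ m) ⨾ T ⊠ T) :=
  holds_of_axiom .tauInv_comul rfl rfl

theorem braiding_eq :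
    Holds ((w ⊠ i 1 ⨾ i 1 ⊠ m) ⊠ (i 1 ⊠ w ⨾ m ⊠ i 1) ⨾ S ⊠ ((i 1 ⊠ w ⊠ i 1 ⨾ m ⊠ m) ⨾ C ⨾ i 1 ⊠ w ⊠ i 1 ⨾ m ⊠ m) ⊠ S ⨾ m ⊠ m)
      (c) :=
  holds_of_axiom .braiding_eq rfl rfl

/-- The element `w̄` and the decorated crossings are single letters, so that they move as one box;
the equations from here to `YHat_eq` open that box. -/
theorem copairingInv_eq : Holds (b) (w ⨾ S ⊠ i 1) := by
  change Mor.tm wBar = _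
  simp only [wBar, Mor.tm_comp, Mor.tm_tensor]
  rfl

theorem X_eq : Holds (X) (i 1 ⊠ b ⊠ i 1 ⨾ m ⊠ m ⨾ c) := by
  change Mor.tm BPHopf.X = _
  simp only [BPHopf.X, Mor.tm_comp, Mor.tm_tensor]
  rfl

theorem Y_eq : Holds (Y) (C ⨾ i 1 ⊠ w ⊠ i 1 ⨾ m ⊠ m) := by
  change Mor.tm BPHopf.Y = _
  simp only [BPHopf.Y, monodromy, Mor.tm_comp, Mor.tm_tensor]
  rfl

theorem XHat_eq : Holds (Xh) (i 2 ⊠ w ⨾ i 1 ⊠ m ⊠ i 1 ⨾ X ⊠ i 1 ⨾ i 1 ⊠ m) := by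
  change Mor.tm XHat = _
  simp only [XHat, Mor.tm_comp, Mor.tm_tensor]
  rfl

theorem YHat_eq : Holds (Yh) (i 2 ⊠ b ⨾ i 1 ⊠ m ⊠ i 1 ⨾ Y ⊠ i 1 ⨾ i 1 ⊠ m) := by
  change Mor.tm YHat = _
  simp only [YHat, Mor.tm_comp, Mor.tm_tensor]
  rfl


/-! ### Basic consequences of the axioms -/

theorem antipode_one : Holds (u ⨾ S) (u) :=
  .of_uses [] [one_counit.symm.use 0, antipode_left.symm.use 0 [0], one_comul.use 0,
    mul_one.use 0 [0, 2]] (by decide +kernel)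

theorem antipode_counit : Holds (S ⨾ e) (e) :=
  .of_uses [comul_counit.symm.use 0, mul_counit.symm.use 0 [0, 2], antipode_left.use 0,
    one_counit.use 0] [] (by decide +kernel)

/-- The braided coproduct on `H ⊗ H` is coassociative. It underlies the convolution product of
morphisms from `H ⊗ H` to `H`. -/
theorem comul₂_assoc :
    Holds (D ⊠ D ⨾ i 1 ⊠ c ⊠ i 1 ⨾ (D ⊠ D ⨾ i 1 ⊠ c ⊠ i 1) ⊠ i 2)
      (D ⊠ D ⨾ i 1 ⊠ c ⊠ i 1 ⨾ i 2 ⊠ (D ⊠ D ⨾ i 1 ⊠ c ⊠ i 1)) :=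
  .of_uses [comul_assoc.use 0, (cr_nat .D).symm.use 2 [0, 1, 2], (cl_nat .D).use 1 [0, 2, 3]] [
    comul_assoc.symm.use 1] (by decide +kernel)

theorem mul_antipode_left : Holds (D ⊠ D ⨾ i 1 ⊠ c ⊠ i 1 ⨾ (m ⨾ S) ⊠ m ⨾ m) (e ⊠ e ⨾ u) :=
  .of_uses [mul_comul.use 0, antipode_left.use 0 [0], mul_counit.use 0] [] (by decide +kernel)

theorem mul_antipode_right :
    Holds (D ⊠ D ⨾ i 1 ⊠ c ⊠ i 1 ⨾ m ⊠ (c ⨾ S ⊠ S ⨾ m) ⨾ m)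
      (e ⊠ e ⨾ u) :=
  .of_uses [(cr_nat .D).use 1 [0], mul_assoc.use 0 [0, 1, 2, 4, 5, 6],
    mul_assoc.symm.use 1 [0, 1, 2, 3, 4], antipode_right.use 1 [0, 1], one_mul.use 2 [0, 1, 4],
    (cr_nat .e).symm.use 1 [0]] [antipode_right.symm.use 0] (by decide +kernel)

theorem mul_antipode_aux₁ :
    Holds (D ⊠ D ⨾ i 1 ⊠ c ⊠ i 1 ⨾ (m ⨾ S) ⊠ (D ⊠ D ⨾ i 1 ⊠ c ⊠ i 1 ⨾ m ⊠ (c ⨾ S ⊠ S ⨾ m) ⨾ m) ⨾ m)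
      (m ⨾ S) :=
  .of_uses [mul_antipode_right.use 2 [0, 1, 2], mul_one.use 0 [0, 1, 2, 6, 7], comul_counit.use 1,
    (cl_nat .e).symm.use 1 [0], comul_counit.use 0] [] (by decide +kernel)

theorem mul_antipode_aux₂ :
    Holds (D ⊠ D ⨾ i 1 ⊠ c ⊠ i 1 ⨾ (D ⊠ D ⨾ i 1 ⊠ c ⊠ i 1 ⨾ (m ⨾ S) ⊠ m ⨾ m) ⊠ (c ⨾ S ⊠ S ⨾ m) ⨾ m)
      (c ⨾ S ⊠ S ⨾ m) :=
  .of_uses [mul_antipode_left.use 0 [0, 1, 2], one_mul.use 2 [0, 1, 2, 6, 7, 8, 9],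
    counit_comul.use 0, (cr_nat .e).symm.use 0 [0], counit_comul.use 1] [] (by decide +kernel)

/-- In the convolution algebra of morphisms `H ⊗ H ⟶ H`, the two sides are a left and a right
inverse of `μ`; the auxiliary lemmas evaluate the threefold product in its two bracketings. -/
theorem mul_antipode : Holds (m ⨾ S) (c ⨾ S ⊠ S ⨾ m) :=
  .of_uses [mul_antipode_aux₁.symm.use 0, comul₂_assoc.symm.use 0] [mul_antipode_aux₂.symm.use 0,
    mul_assoc.use 0 [0, 1, 2, 3, 4, 5, 6, 7, 8, 10, 11, 12, 13]] (by decide +kernel)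

theorem mul₂_assoc :
    Holds ((i 1 ⊠ c ⊠ i 1 ⨾ m ⊠ m) ⊠ i 2 ⨾ i 1 ⊠ c ⊠ i 1 ⨾ m ⊠ m)
      (i 2 ⊠ (i 1 ⊠ c ⊠ i 1 ⨾ m ⊠ m) ⨾ i 1 ⊠ c ⊠ i 1 ⨾ m ⊠ m) :=
  .of_uses [mul_assoc.use 0 [0, 2, 3], (cl_nat .m).use 2 [0], (cr_nat .m).symm.use 1 [1]] [
    mul_assoc.symm.use 2 [0, 1, 3]] (by decide +kernel)

theorem antipode_comul_left : Holds (D ⨾ (S ⨾ D) ⊠ D ⨾ i 1 ⊠ c ⊠ i 1 ⨾ m ⊠ m) (e ⨾ u ⊠ u) :=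
  .of_uses [mul_comul.use 0 [0, 1], antipode_left.use 0, one_comul.use 0] [] (by decide +kernel)

theorem antipode_comul_right_aux :
    Holds (D ⨾ D ⊠ (D ⨾ S ⊠ S ⨾ c) ⨾ i 1 ⊠ c ⊠ i 1 ⨾ m ⊠ m)
      (D ⨾ D ⊠ i 1 ⨾ i 1 ⊠ (D ⨾ i 1 ⊠ S ⨾ m) ⊠ S ⨾ i 1 ⊠ c ⨾ m ⊠ i 1) :=
  .of_uses [(cl_nat .m).symm.use 1 [0, 1, 2, 3, 4], comul_assoc.symm.use 0] [
    comul_assoc.symm.use 0 [0]] (by decide +kernel)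

theorem antipode_comul_right :
    Holds (D ⨾ D ⊠ (D ⨾ S ⊠ S ⨾ c) ⨾ i 1 ⊠ c ⊠ i 1 ⨾ m ⊠ m)
      (e ⨾ u ⊠ u) :=
  .of_uses [antipode_comul_right_aux.use 0, antipode_right.use 1 [0, 1], comul_counit.use 0 [0],
    (cl_nat .u).use 1 [0, 2]] [antipode_right.symm.use 0] (by decide +kernel)

theorem antipode_comul_aux₁ :
    Holds (D ⨾ (S ⨾ D) ⊠ (D ⨾ D ⊠ (D ⨾ S ⊠ S ⨾ c) ⨾ i 1 ⊠ c ⊠ i 1 ⨾ m ⊠ m) ⨾ i 1 ⊠ c ⊠ i 1 ⨾ m ⊠ m)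
      (S ⨾ D) :=
  .of_uses [antipode_comul_right.use 1 [0], mul_one.use 2 [0, 2, 4, 5, 6], comul_counit.use 0,
    (cr_nat .u).use 1 [1, 2], mul_one.use 0 [0, 1]] [] (by decide +kernel)

theorem antipode_comul_aux₂ :
    Holds (D ⨾ (D ⨾ (S ⨾ D) ⊠ D ⨾ i 1 ⊠ c ⊠ i 1 ⨾ m ⊠ m) ⊠ (D ⨾ S ⊠ S ⨾ c) ⨾ i 1 ⊠ c ⊠ i 1 ⨾ m ⊠ m)
      (D ⨾ S ⊠ S ⨾ c) :=
  .of_uses [antipode_comul_left.use 0 [0], counit_comul.use 0, one_mul.use 0 [1, 2, 3, 4, 5, 6],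
    (cl_nat .u).use 0 [1, 2, 3, 4], one_mul.use 1 [0, 1, 2, 3]] [] (by decide +kernel)

/-- Dual to `mul_antipode`: both sides invert `Δ` for the convolution of morphisms `H ⟶ H ⊗ H`,
whose associativity rests on `mul₂_assoc`. -/
theorem antipode_comul : Holds (S ⨾ D) (D ⨾ S ⊠ S ⨾ c) :=
  .of_uses [antipode_comul_aux₁.symm.use 0, mul₂_assoc.symm.use 0 [0, 1, 2, 3, 4, 5, 6, 7, 8]] [
    antipode_comul_aux₂.symm.use 0, comul_assoc.use 0] (by decide +kernel)

/-! ### The ribbon morphism. -/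

theorem mul_tau_antipode : Holds (i 1 ⊠ t ⨾ m ⨾ S) (m ⨾ t ⨾ S) :=
  .of_uses [mul_antipode.use 0 [0], (cr_nat .t).use 0, tau_antipode.use 0 [0]] [
    tau_antipode.use 0 [0], mul_antipode.use 0, tau_mul.symm.use 0 [0, 1, 2]] (by decide +kernel)

/-- The axiom puts `τ` on the left factor only. The antipode reverses products, commutes with `τ`
and is invertible, so it carries the axiom to the right factor. -/
theorem mul_tau : Holds (i 1 ⊠ t ⨾ m) (m ⨾ t) :=
  .of_uses [S_SInv.symm.use 0 [0, 1], mul_tau_antipode.use 0] [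
    S_SInv.symm.use 0 [0, 1]] (by decide +kernel)

theorem tauInv_mul : Holds (T ⊠ i 1 ⨾ m) (m ⨾ T) :=
  .of_uses [tau_tauInv.symm.use 0 [0, 1], tau_mul.symm.use 0 [0]] [
    tauInv_tau.symm.use 0] (by decide +kernel)

theorem mul_tauInv : Holds (i 1 ⊠ T ⨾ m) (m ⨾ T) :=
  .of_uses [tau_tauInv.symm.use 0 [0, 1], mul_tau.symm.use 0 [0]] [
    tauInv_tau.symm.use 1] (by decide +kernel)

theorem tauInv_antipode : Holds (T ⨾ S) (S ⨾ T) :=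
  .of_uses [tau_tauInv.symm.use 0 [0, 1], tau_antipode.symm.use 0 [0]] [
    tauInv_tau.symm.use 0] (by decide +kernel)

/-! ### The copairing and its inverse. -/

theorem copairing_counit_left : Holds (w ⨾ e ⊠ i 1) (u) :=
  .of_uses [copairing_eq.use 0, tau_counit.use 0 [0, 1, 2], counit_comul.use 0 [0, 1],
    tauInv_tau.use 0 [0]] [] (by decide +kernel)

theorem copairing_counit_right : Holds (w ⨾ i 1 ⊠ e) (u) :=
  .of_uses [copairing_eq.use 0, tau_counit.use 1 [0, 1, 2], comul_counit.use 0 [0, 1],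
    tauInv_tau.use 0 [0]] [] (by decide +kernel)

/-- Since `w` is built from the coproduct of `τ⁻¹η`, and `S` reverses coproducts, fixes `η` and
commutes with `τ`, the copairing inherits a symmetry that exchanges its legs. -/
theorem copairing_antipode : Holds (w ⨾ S ⊠ S ⨾ c) (w) :=
  .of_uses [copairing_eq.use 0, tau_antipode.use 0 [0, 1, 2],
    (cl_nat .t).use 0 [0, 1, 2, 3, 5, 6], tau_antipode.use 1 [0, 1, 2]] [copairing_eq.use 0,
    antipode_one.symm.use 0, tauInv_antipode.symm.use 0 [0], antipode_comul.use 0 [0, 1],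
    (cr_nat .t).symm.use 0 [0, 1, 2, 3, 4]] (by decide +kernel)

/-- The mirror image of the axiom `copairing_comul`, transported by the symmetry
`copairing_antipode`. -/
theorem comul_copairing : Holds (w ⨾ D ⊠ i 1) (w ⨾ i 1 ⊠ w ⊠ i 1 ⨾ i 2 ⊠ m) :=
  .of_uses [copairing_antipode.symm.use 0, (cr_nat .S).use 0 [0, 1],
    antipode_comul.use 0 [0, 1, 2], (cr_nat .D).symm.use 0 [0, 1], copairing_comul.use 0,
    mul_antipode.use 0 [0, 1], (cl_nat .S).symm.use 0 [0, 1], (cl_nat .m).use 0 [0, 1, 2, 3, 4]] [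
    (cl_nat .w).symm.use 0 [0], copairing_antipode.symm.use 0, (cl_nat .w).symm.use 1 [4],
    copairing_antipode.symm.use 0, (cl_nat .w).use 1 [0, 1, 2, 3],
    (cl_nat .m).symm.use 1 [0, 1, 2, 3, 4, 5, 6], (cr_nat .S).use 0 [0, 1],
    (cr_nat .S).use 1 [0, 1, 2, 4, 5, 7], (cr_nat .w).symm.use 0 [3, 4]] (by decide +kernel)

/-- Nesting one copairing in another duplicates a leg by `comul_copairing`; the antipode in `w̄`
then cancels the two copies. -/
theorem copairing_copairingInv : Holds (w ⨾ i 1 ⊠ b ⊠ i 1 ⨾ m ⊠ m) (u ⊠ u) :=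
  .of_uses [copairingInv_eq.use 1 [0], comul_copairing.symm.use 0, antipode_right.use 0 [0],
    copairing_counit_left.use 0] [] (by decide +kernel)

theorem copairingInv_copairing : Holds (b ⨾ i 1 ⊠ w ⊠ i 1 ⨾ m ⊠ m) (u ⊠ u) :=
  .of_uses [copairingInv_eq.use 0, comul_copairing.symm.use 0, antipode_left.use 0 [0],
    copairing_counit_left.use 0] [] (by decide +kernel)

/-- Uniqueness of inverses for the nested product: `w̄` inverts `w` by `comul_copairing`, and the
right-hand side does so by `copairing_comul`. -/
theorem copairingInv_eq₂ : Holds (b) (w ⨾ i 1 ⊠ S) :=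
  .of_uses [one_mul.symm.use 0 [0], copairing_counit_right.symm.use 0,
    mul_one.symm.use 2 [0, 1, 2], antipode_right.symm.use 1 [0]] [one_mul.symm.use 1 [0, 1],
    mul_one.symm.use 0 [0], copairing_copairingInv.symm.use 1 [0, 3],
    mul_assoc.symm.use 0 [0, 2, 3], copairing_comul.symm.use 0,
    mul_assoc.use 2 [0, 1, 2, 4]] (by decide +kernel)

/-- The braidings cancel, and then the nested elements `w̄` and `w` do. -/
theorem X_Y : Holds (X ⨾ Y) (i 2) :=
  .of_uses [X_eq.use 0, Y_eq.use 0 [0, 1, 2, 3], c_C.use 0 [0, 1, 2], mul_assoc.use 0 [0, 3],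
    mul_assoc.symm.use 3 [0, 1], copairingInv_copairing.use 1, mul_one.use 0, one_mul.use 1] []
    (by decide +kernel)

theorem Y_X : Holds (Y ⨾ X) (i 2) :=
  .of_uses [X_eq.use 0 [0], Y_eq.use 0, mul_assoc.use 0 [0, 1, 4], mul_assoc.symm.use 3 [0, 1, 2],
    copairing_copairingInv.use 1 [0], one_mul.use 1 [0, 1, 4], mul_one.use 0 [0], C_c.use 0] []
    (by decide +kernel)

/-! ### The coproduct of the inverse ribbon morphism. -/

theorem one_tauInv_comul : Holds (u ⨾ T ⨾ D) (w ⨾ T ⊠ T) :=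
  .of_uses [tauInv_comul.use 0 [0], one_comul.use 0, (Cl_nat .u).symm.use 0 [1],
    one_mul.use 0 [2], mul_one.use 1 [0]] [] (by decide +kernel)

theorem tauInv_eq : Holds (T) ((u ⨾ T) ⊠ i 1 ⨾ m) :=
  .of_uses [] [tauInv_mul.use 0 [0], one_mul.use 0] (by decide +kernel)

theorem tauInv_eq₂ : Holds (T) (i 1 ⊠ (u ⨾ T) ⨾ m) :=
  .of_uses [] [mul_tauInv.use 0 [0], mul_one.use 0] (by decide +kernel)

theorem tauInv_comul_left : Holds (T ⨾ D) ((w ⊠ D ⨾ i 1 ⊠ c ⊠ i 1 ⨾ m ⊠ m) ⨾ T ⊠ T) :=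
  .of_uses [tauInv_eq.use 0, mul_comul.symm.use 0 [0, 1], one_tauInv_comul.use 0] [
    tauInv_mul.symm.use 0 [0, 1, 2], tauInv_mul.symm.use 2 [0, 1, 2],
    (cl_nat .T).symm.use 1 [0, 1]] (by decide +kernel)

theorem tauInv_comul_right : Holds (T ⨾ D) ((D ⊠ w ⨾ i 1 ⊠ c ⊠ i 1 ⨾ m ⊠ m) ⨾ T ⊠ T) :=
  .of_uses [tauInv_eq₂.use 0, mul_comul.symm.use 0 [0, 1], one_tauInv_comul.use 1] [
    mul_tauInv.symm.use 0 [0, 1, 2], (cr_nat .T).symm.use 1 [0, 1],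
    mul_tauInv.symm.use 2 [0, 1, 2, 3]] (by decide +kernel)

/-- The morphism `τ⁻¹` is multiplication by `τ⁻¹η`. Its coproduct, computed from this and from the
axiom `tauInv_comul`, gives the two sides once the factors `τ⁻¹` are removed. -/
theorem copairing_mul_comul :
    Holds (w ⊠ D ⨾ i 1 ⊠ c ⊠ i 1 ⨾ m ⊠ m)
      (D ⨾ C ⨾ i 1 ⊠ w ⊠ i 1 ⨾ m ⊠ m) :=
  .of_uses [tauInv_tau.symm.use 0 [0, 1, 2, 3], tauInv_tau.symm.use 1 [0, 1, 2, 3, 4, 5, 6],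
    tauInv_comul_left.symm.use 0] [tauInv_tau.symm.use 0 [0, 1, 2, 3],
    tauInv_tau.symm.use 1 [0, 1, 2, 3, 4, 5, 6], tauInv_comul.symm.use 0] (by decide +kernel)

/-- As `τ⁻¹η` may multiply from either side, so may `w`: it commutes with all coproducts in the
braided algebra `H ⊗ H`. -/
theorem comul_mul_copairing :
    Holds (D ⊠ w ⨾ i 1 ⊠ c ⊠ i 1 ⨾ m ⊠ m)
      (w ⊠ D ⨾ i 1 ⊠ c ⊠ i 1 ⨾ m ⊠ m) :=
  .of_uses [tauInv_tau.symm.use 0 [0, 1, 2, 3], tauInv_tau.symm.use 1 [0, 1, 2, 3, 4, 5, 6],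
    tauInv_comul_right.symm.use 0] [tauInv_tau.symm.use 0 [0, 1, 2, 3],
    tauInv_tau.symm.use 1 [0, 1, 2, 3, 4, 5, 6], tauInv_comul_left.symm.use 0] (by decide +kernel)

/-- The `w̄` in `X` cancels the first of the two monodromies in the axiom for the braiding; the
inverse braiding and the second monodromy form `Y`. -/
theorem X_eq_coaction :
    Holds (X)
      ((w ⊠ i 1 ⨾ i 1 ⊠ m) ⊠ (i 1 ⊠ w ⨾ m ⊠ i 1) ⨾ S ⊠ Y ⊠ S ⨾ m ⊠ m) :=
  .of_uses [X_eq.use 0, braiding_eq.symm.use 0 [0, 1, 2],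
    Y_eq.symm.use 1 [0, 1, 2, 3, 4, 5, 6, 8, 9, 10], mul_assoc.use 2 [0, 5],
    mul_assoc.use 1 [0, 4, 5, 7], mul_assoc.use 0 [0, 3], mul_assoc.symm.use 3 [0, 1, 6, 7],
    copairingInv_copairing.use 1, one_mul.use 1 [2, 3], mul_one.use 0] [] (by decide +kernel)

/-- The additional copairing in `X̂` cancels the right coaction of `X_eq_coaction`, so that only the
left one remains. -/
theorem XHat_eq_coaction : Holds (Xh) (w ⊠ i 2 ⨾ S ⊠ m ⊠ i 1 ⨾ i 1 ⊠ Y ⨾ m ⊠ i 1) :=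
  .of_uses [XHat_eq.use 0, X_eq_coaction.use 0 [0, 1],
    copairingInv_eq₂.symm.use 3 [0, 1, 2, 3, 6], mul_assoc.use 1 [0, 5],
    mul_assoc.use 2 [0, 1, 2, 3, 4, 5, 7], copairing_copairingInv.use 2, mul_one.use 1,
    mul_one.use 2 [1, 2, 3]] [] (by decide +kernel)

/-- Here a copairing added on the left cancels the left coaction of `X_eq_coaction`. This trades `X`
for `Y`. -/
theorem copairing_mul_X :
    Holds (w ⊠ i 2 ⨾ i 1 ⊠ m ⊠ i 1 ⨾ i 1 ⊠ X ⨾ m ⊠ i 1)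
      (i 2 ⊠ w ⨾ i 1 ⊠ m ⊠ i 1 ⨾ Y ⊠ S ⨾ i 1 ⊠ m) :=
  .of_uses [X_eq_coaction.use 1 [0, 1], copairingInv_eq.symm.use 1 [0, 1, 4, 5, 8],
    mul_assoc.symm.use 2 [0, 5], mul_assoc.symm.use 0 [0, 1, 2, 3, 4, 5, 7],
    copairing_copairingInv.use 0, one_mul.use 0 [1, 2, 3, 4, 5], one_mul.use 0] []
    (by decide +kernel)


/-! ### The decorated crossings -/

theorem mul_X : Holds (m ⊠ i 1 ⨾ X) (i 1 ⊠ X ⨾ c ⊠ i 1 ⨾ i 1 ⊠ m) :=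
  .of_uses [X_eq.use 0 [0], mul_assoc.use 0 [1]] [X_eq.use 1,
    (cl_nat .m).symm.use 0 [0, 1, 2]] (by decide +kernel)

theorem X_mul : Holds (i 1 ⊠ m ⨾ X) (X ⊠ i 1 ⨾ i 1 ⊠ c ⨾ m ⊠ i 1) :=
  .of_uses [X_eq.use 0 [0], mul_assoc.symm.use 2 [1]] [X_eq.use 0,
    (cr_nat .m).symm.use 0 [0, 1, 2]] (by decide +kernel)

theorem mul_Y : Holds (m ⊠ i 1 ⨾ Y) (i 1 ⊠ C ⨾ Y ⊠ i 1 ⨾ i 1 ⊠ m) :=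
  .of_uses [Y_eq.use 0 [0], (Cl_nat .m).symm.use 0, mul_assoc.symm.use 2 [0, 1, 3],
    Y_eq.symm.use 0 [0]] [] (by decide +kernel)

theorem Y_mul : Holds (i 1 ⊠ m ⨾ Y) (C ⊠ i 1 ⨾ i 1 ⊠ Y ⨾ m ⊠ i 1) :=
  .of_uses [Y_eq.use 0 [0], (Cr_nat .m).symm.use 0, mul_assoc.use 0 [0, 1, 3],
    Y_eq.symm.use 1 [0]] [] (by decide +kernel)

/-- In this form `X̂` is `X` followed by right multiplication by `w` in the braided algebra `H ⊗ H`;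
most facts about `X̂` are reduced to `X` in this way. -/
theorem XHat_eq_mul : Holds (Xh) (X ⊠ w ⨾ i 1 ⊠ c ⊠ i 1 ⨾ m ⊠ m) :=
  .of_uses [XHat_eq.use 0, X_mul.use 0 [0]] [] (by decide +kernel)

theorem mul_XHat : Holds (m ⊠ i 1 ⨾ Xh) (i 1 ⊠ Xh ⨾ c ⊠ i 1 ⨾ i 1 ⊠ m) :=
  .of_uses [XHat_eq.use 0 [0], mul_X.use 0 [1, 2], mul_assoc.use 1 [0, 1, 2, 3],
    XHat_eq.symm.use 1] [] (by decide +kernel)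

/-- In the form `XHat_eq_coaction` the crossing inside is `Y`, through which a product slides at the
cost of an inverse braiding. -/
theorem mul_XHat_slide : Holds (m ⊠ i 1 ⨾ Xh) (i 1 ⊠ C ⨾ Xh ⊠ i 1 ⨾ i 1 ⊠ m) :=
  .of_uses [XHat_eq_coaction.use 0 [0], mul_assoc.symm.use 1 [1]] [XHat_eq_coaction.use 0 [0],
    mul_Y.symm.use 1 [1, 3]] (by decide +kernel)

/-! ### Decorated crossings commute with the diagonal right action. -/

theorem monodromy_cancel : Holds (i 1 ⊠ w ⊠ i 1 ⨾ m ⊠ m ⨾ i 1 ⊠ b ⊠ i 1 ⨾ m ⊠ m) (i 2) :=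
  .of_uses [mul_assoc.use 0 [0, 3], mul_assoc.symm.use 3 [0, 1], copairing_copairingInv.use 1,
    one_mul.use 1, mul_one.use 0] [] (by decide +kernel)

theorem comul_CInv_monodromy :
    Holds (w ⊠ (D ⨾ i 1 ⊠ w ⊠ i 1 ⨾ m ⊠ (S ⊠ i 1 ⨾ m)) ⨾ i 1 ⊠ m ⊠ i 1 ⨾ C ⊠ i 1 ⨾ i 1 ⊠ m ⨾ i 1 ⊠ w ⊠ i 1 ⨾ m ⊠ m)
      (w ⊠ D ⨾ i 1 ⊠ c ⊠ i 1 ⨾ m ⊠ m) :=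
  .of_uses [mul_assoc.symm.use 2 [0, 1, 2, 3, 4, 5, 6, 7, 9], Y_eq.symm.use 0 [0, 1, 2, 3, 6],
    mul_assoc.symm.use 1 [0, 1, 2], mul_assoc.symm.use 1 [0, 1, 2, 3, 4, 5, 6],
    copairing_mul_X.symm.use 0 [0, 1, 3], X_eq.use 1 [0, 1, 2, 3, 4], mul_assoc.use 1 [0, 3, 5],
    mul_assoc.symm.use 2 [0, 2, 5], copairing_copairingInv.use 0, one_mul.use 0 [2],
    mul_one.use 1 [2]] [] (by decide +kernel)

theorem comul_CInv :
    Holds (w ⊠ (D ⨾ i 1 ⊠ w ⊠ i 1 ⨾ m ⊠ (S ⊠ i 1 ⨾ m)) ⨾ i 1 ⊠ m ⊠ i 1 ⨾ C ⊠ i 1 ⨾ i 1 ⊠ m)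
      (D ⨾ C) :=
  .of_uses [monodromy_cancel.symm.use 0 [0, 1, 2, 3, 4, 5, 6, 7, 8], comul_CInv_monodromy.use 0] [
    monodromy_cancel.symm.use 0 [0, 1], copairing_mul_comul.symm.use 0] (by decide +kernel)

/-- Replacing `c⁻¹Δ` by `comul_CInv` lets the product slide through `Y`. Then `copairing_mul_X`
turns `Y` into `X`, whose `w̄` cancels a copairing. -/
theorem copairing_mul_cross :
    Holds (i 1 ⊠ D ⨾ c ⊠ i 1 ⨾ i 1 ⊠ m ⨾ w ⊠ i 2 ⨾ i 1 ⊠ c ⊠ i 1 ⨾ m ⊠ m)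
      (i 1 ⊠ (D ⨾ C) ⨾ Y ⊠ i 1 ⨾ i 1 ⊠ m) :=
  .of_uses [mul_assoc.symm.use 2 [0, 1, 3, 4], (cl_nat .m).symm.use 1 [0, 2]] [
    comul_CInv.symm.use 1, mul_assoc.symm.use 1 [0, 1, 2, 3, 4, 5, 6, 7, 9],
    mul_Y.symm.use 0 [0, 1, 2, 3, 6], mul_assoc.symm.use 2 [0, 1, 2],
    mul_assoc.symm.use 1 [0, 1, 2, 3, 4, 5, 6, 7], copairing_mul_X.symm.use 0 [0, 1, 3, 5],
    mul_assoc.symm.use 1 [0, 4], X_eq.use 1 [0, 1, 2, 3, 4, 5], mul_assoc.use 1 [0, 1, 2, 6],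
    mul_assoc.symm.use 3 [0, 3, 6], copairing_copairingInv.use 1, one_mul.use 1 [2],
    mul_one.use 1 [2, 3]] (by decide +kernel)

/-- This says that `Y` is a morphism of right `H`-modules for the diagonal action on `H ⊗ H`; the
statement for `X` follows by inversion. -/
theorem Y_mul_comul :
    Holds (i 2 ⊠ D ⨾ i 1 ⊠ c ⊠ i 1 ⨾ m ⊠ m ⨾ Y)
      (Y ⊠ D ⨾ i 1 ⊠ c ⊠ i 1 ⨾ m ⊠ m) :=
  .of_uses [mul_Y.use 0 [0, 1, 3], (Cr_nat .m).symm.use 1 [0, 1], c_C.use 1 [0]] [Y_eq.use 0,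
    mul_assoc.use 0 [0, 1, 3, 4, 5], (cl_nat .m).use 2 [0, 1, 3], mul_assoc.use 3 [0, 1, 2, 3, 4],
    copairing_mul_cross.use 1 [0], Y_mul.symm.use 0 [1, 2]] (by decide +kernel)

theorem X_mul_comul :
    Holds (i 2 ⊠ D ⨾ i 1 ⊠ c ⊠ i 1 ⨾ m ⊠ m ⨾ X)
      (X ⊠ D ⨾ i 1 ⊠ c ⊠ i 1 ⨾ m ⊠ m) :=
  .of_uses [X_Y.symm.use 0, Y_mul_comul.symm.use 0 [0], Y_X.use 0 [0, 1, 2, 3, 4]] []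
    (by decide +kernel)

/-- The extra factor `w` in `X̂` commutes with coproducts by `comul_mul_copairing`, so `X̂` inherits
equivariance from `X`. -/
theorem XHat_mul_comul :
    Holds (i 2 ⊠ D ⨾ i 1 ⊠ c ⊠ i 1 ⨾ m ⊠ m ⨾ Xh)
      (Xh ⊠ D ⨾ i 1 ⊠ c ⊠ i 1 ⨾ m ⊠ m) :=
  .of_uses [XHat_eq_mul.use 0 [0, 1, 2, 3], X_mul_comul.use 0, mul_assoc.use 0 [0, 1, 2, 4, 5, 6],
    (cl_nat .m).use 2 [0, 1, 2, 4], (cr_nat .m).symm.use 1 [0, 1, 3, 4],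
    mul_assoc.use 2 [0, 1, 2, 3, 4, 5], comul_mul_copairing.use 2] [XHat_eq_mul.use 0,
    mul_assoc.use 0 [0, 1, 2, 4, 5, 6], (cl_nat .m).use 2 [0, 1, 2, 4],
    (cr_nat .m).symm.use 1 [0, 1, 3, 4], mul_assoc.use 2 [0, 1, 2, 3, 4, 5]] (by decide +kernel)

/-! ### The inverse antipode and the invertibility of `X̂`. -/

theorem mul_antipodeInv : Holds (m ⨾ s) (C ⨾ s ⊠ s ⨾ m) :=
  .of_uses [SInv_S.symm.use 0, C_c.symm.use 0 [0], SInv_S.symm.use 1 [0, 1, 2],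
    C_c.symm.use 0 [0, 1, 2, 3], C_c.use 0 [0], mul_antipode.symm.use 0 [0, 1, 2],
    S_SInv.use 0 [0, 1, 2, 3]] [(Cl_nat .s).use 0, (Cr_nat .s).use 0 [0]] (by decide +kernel)

theorem antipodeInv_left : Holds (D ⨾ s ⊠ i 1 ⨾ C ⨾ m) (e ⨾ u) :=
  .of_uses [(Cl_nat .s).symm.use 0 [0], S_SInv.symm.use 1 [0], (Cr_nat .s).symm.use 0 [0, 1],
    mul_antipodeInv.symm.use 0 [0, 1]] [S_SInv.symm.use 0 [0, 1], antipode_one.use 0,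
    antipode_right.symm.use 0] (by decide +kernel)

theorem antipodeInv_right : Holds (D ⨾ i 1 ⊠ s ⨾ C ⨾ m) (e ⨾ u) :=
  .of_uses [(Cr_nat .s).symm.use 0 [0], S_SInv.symm.use 0 [0], (Cl_nat .s).symm.use 0 [0, 1],
    mul_antipodeInv.symm.use 0 [0, 1]] [S_SInv.symm.use 0 [0, 1], antipode_one.use 0,
    antipode_left.symm.use 0] (by decide +kernel)

theorem copairing_slide : Holds (w ⊠ i 1 ⨾ i 1 ⊠ c) (i 1 ⊠ w ⨾ C ⊠ i 1) :=
  .of_uses [c_C.symm.use 0 [0, 1]] [(cl_nat .w).symm.use 0] (by decide +kernel)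

/-- The inverse of `w` in the braided algebra `H ⊗ H` has `S⁻¹` on its first leg, in contrast to the
inverse `w̄` for nesting. -/
theorem copairing_antipodeInv_left :
    Holds (w ⊠ w ⨾ i 2 ⊠ s ⊠ i 1 ⨾ i 1 ⊠ c ⊠ i 1 ⨾ m ⊠ m)
      (u ⊠ u) :=
  .of_uses [copairing_slide.use 0 [1, 2], comul_copairing.symm.use 0, antipodeInv_left.use 0 [0],
    copairing_counit_left.use 0] [] (by decide +kernel)

theorem copairing_antipodeInv_right : Holds (w ⊠ w ⨾ s ⊠ i 3 ⨾ i 1 ⊠ c ⊠ i 1 ⨾ m ⊠ m) (u ⊠ u) :=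
  .of_uses [copairing_slide.use 0 [1], comul_copairing.symm.use 0, (Cr_nat .s).use 0 [0, 1],
    antipodeInv_right.use 0 [0], copairing_counit_left.use 0] [] (by decide +kernel)

theorem copairing_CInv : Holds (w ⨾ s ⊠ i 1 ⨾ C) (b) :=
  .of_uses [copairing_antipode.symm.use 0, (cr_nat .S).use 0 [0, 1]] [copairingInv_eq.use 0,
    c_C.symm.use 0 [0, 1], S_SInv.symm.use 0 [0, 1, 2]] (by decide +kernel)

theorem XHat_copairing : Holds (Xh ⊠ (w ⨾ s ⊠ i 1) ⨾ i 1 ⊠ c ⊠ i 1 ⨾ m ⊠ m) (X) :=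
  .of_uses [XHat_eq_mul.use 0, mul₂_assoc.use 0 [0, 1, 5, 6], copairing_antipodeInv_left.use 2,
    mul_one.use 2 [0, 2, 3], (cr_nat .u).use 1 [1], mul_one.use 0 [0]] [] (by decide +kernel)

theorem mul₂_copairing_cancel :
    Holds (i 2 ⊠ (w ⨾ s ⊠ i 1) ⨾ i 1 ⊠ c ⊠ i 1 ⨾ m ⊠ m ⊠ w ⨾ i 1 ⊠ c ⊠ i 1 ⨾ m ⊠ m)
      (i 2) :=
  .of_uses [mul₂_assoc.use 0 [0, 1, 5], copairing_antipodeInv_right.use 2, mul_one.use 2 [0, 2],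
    (cr_nat .u).use 1, mul_one.use 0] [] (by decide +kernel)

/-- As `X̂` multiplies by `w` after `X`, its inverse multiplies by the inverse of `w` before `Y`;
this is the form in which `Ŷ` is seen to be that inverse. -/
theorem YHat_eq_mul : Holds (Yh) (i 2 ⊠ (w ⨾ s ⊠ i 1) ⨾ i 1 ⊠ c ⊠ i 1 ⨾ m ⊠ m ⨾ Y) :=
  .of_uses [YHat_eq.use 0, copairing_CInv.symm.use 2] [mul_Y.use 0 [0, 1, 2, 4],
    (Cr_nat .m).symm.use 1 [0, 1, 2], c_C.use 1 [0, 1]] (by decide +kernel)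

theorem XHat_YHat : Holds (Xh ⨾ Yh) (i 2) :=
  .of_uses [YHat_eq_mul.use 0 [0], XHat_copairing.use 0, X_Y.use 0] [] (by decide +kernel)

theorem YHat_XHat : Holds (Yh ⨾ Xh) (i 2) :=
  .of_uses [XHat_eq_mul.use 0 [0], YHat_eq_mul.use 0, Y_X.use 0 [0, 1, 2, 3, 4],
    mul₂_copairing_cancel.use 0] [] (by decide +kernel)

/-! ### The relations that exchange `X` and `X̂`. -/

theorem copairing_mul_X_one : Holds (w ⊠ i 1 ⨾ i 1 ⊠ X ⨾ m ⊠ i 1) (i 1 ⊠ u) :=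
  .of_uses [mul_one.symm.use 1 [0], copairing_mul_X.use 0 [1], copairingInv_eq₂.symm.use 1,
    Y_eq.use 0 [0, 1, 2], (Cl_nat .u).symm.use 0 [0, 2]] [mul_one.symm.use 0,
    copairingInv_copairing.symm.use 1, mul_assoc.symm.use 0 [0, 1],
    mul_one.symm.use 3 [0, 1]] (by decide +kernel)

theorem one_XHat : Holds (u ⊠ i 1 ⨾ Xh) (w ⊠ i 1 ⨾ S ⊠ Y ⨾ m ⊠ i 1) :=
  .of_uses [XHat_eq_coaction.use 0 [0], mul_one.use 1 [1]] [] (by decide +kernel)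

/-- The copairing that distinguishes `X̂` from `X` is absorbed by the next crossing, by
`copairing_mul_X_one`. This is what turns `X̂` into `X` for the labels `k + 1`, `k`. -/
theorem mul_X_XHat : Holds (i 1 ⊠ m ⨾ X) (Xh ⊠ i 1 ⨾ i 1 ⊠ X ⨾ m ⊠ i 1) :=
  .of_uses [] [XHat_eq.use 0, mul_X.use 1 [0, 1, 2], X_mul.symm.use 0 [0, 1, 3],
    mul_assoc.use 1 [0, 2], copairing_mul_X_one.use 2, mul_one.use 1 [1, 2]] (by decide +kernel)

theorem mul_XHat_XHat : Holds (i 1 ⊠ m ⨾ Xh) (Xh ⊠ i 1 ⨾ i 1 ⊠ Xh ⨾ m ⊠ i 1) :=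
  .of_uses [XHat_eq_mul.use 0 [0], mul_X_XHat.use 0, mul_assoc.use 0 [0, 1, 3, 4],
    XHat_eq_mul.symm.use 1 [0]] [] (by decide +kernel)

/-- In the coaction form of `X̂` the product pulls out an inverse braiding, which cancels the
braiding of `X`. -/
theorem X_XHat : Holds (X ⨾ Xh) ((u ⊠ i 1 ⨾ X) ⊠ i 1 ⨾ i 1 ⊠ m) :=
  .of_uses [XHat_eq_coaction.use 0 [0], mul_Y.use 1 [0, 1], one_XHat.symm.use 0 [0, 2],
    X_eq.use 0, c_C.use 0 [0, 1, 2], mul_assoc.symm.use 1 [0, 1, 3, 4], XHat_eq.use 0 [0, 1, 2],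
    mul_assoc.use 0 [0, 3], mul_assoc.use 1 [0, 1, 2, 3, 4, 5], copairingInv_copairing.use 1,
    mul_one.use 0, mul_one.use 1 [1, 2]] [] (by decide +kernel)

/-- This is what turns `X` into `X̂` for the labels `k`, `k + 1`: the strand crosses `k + 1` by `X`
and multiplies `k`. -/
theorem mul_X_left : Holds (i 1 ⊠ X ⨾ m ⊠ i 1 ⨾ Xh) (X ⊠ i 1 ⨾ i 1 ⊠ m) :=
  .of_uses [mul_XHat.use 0 [0], X_XHat.use 1] [mul_one.symm.use 0, mul_X.use 0 [0],
    mul_assoc.use 1 [0, 1, 2]] (by decide +kernel)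

theorem YHat_CInv :
    Holds (i 2 ⊠ b ⨾ i 1 ⊠ m ⊠ i 1 ⨾ C ⊠ i 1 ⨾ i 1 ⊠ m)
      (Yh ⨾ i 1 ⊠ b ⊠ i 1 ⨾ m ⊠ m) :=
  .of_uses [] [YHat_eq.use 0, mul_assoc.symm.use 2 [0, 1, 2, 4], Y_eq.use 0 [0, 1],
    mul_assoc.use 0 [0, 1, 2, 3, 6], mul_assoc.symm.use 3 [0, 1, 2, 3, 4],
    copairing_copairingInv.use 1 [0, 1, 2], one_mul.use 1 [0, 1, 2],
    mul_one.use 0 [0, 1, 2]] (by decide +kernel)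

theorem XHat_CInv :
    Holds (Xh ⨾ i 2 ⊠ b ⨾ i 1 ⊠ m ⊠ i 1 ⨾ C ⊠ i 1 ⨾ i 1 ⊠ m)
      (i 1 ⊠ b ⊠ i 1 ⨾ m ⊠ m) :=
  .of_uses [YHat_CInv.use 0 [0], XHat_YHat.use 0] [] (by decide +kernel)

theorem XHat_X_aux :
    Holds (X)
      (i 2 ⊠ b ⨾ i 1 ⊠ m ⊠ i 1 ⨾ C ⊠ i 1 ⨾ i 1 ⊠ m ⨾ (u ⊠ i 1 ⨾ Xh) ⊠ i 1 ⨾ i 1 ⊠ m) :=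
  .of_uses [mul_one.symm.use 1, mul_one.symm.use 1 [0, 1, 2], copairingInv_copairing.symm.use 2,
    mul_assoc.symm.use 1 [0, 1]] [mul_assoc.symm.use 1 [0, 1, 2, 4, 5], one_XHat.use 0 [0, 1, 2],
    mul_Y.symm.use 1 [0, 1, 3], XHat_eq_coaction.symm.use 0 [0, 1], XHat_eq.use 0 [0, 1],
    mul_assoc.use 1 [0, 1, 2, 3, 4]] (by decide +kernel)

/-- `XHat_X_aux` rewrites `X` so that it starts with the configuration which `XHat_CInv` simplifies
behind an `X̂`. The outcome is the same as in `X_XHat`. -/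
theorem XHat_X : Holds (Xh ⨾ X) ((u ⊠ i 1 ⨾ X) ⊠ i 1 ⨾ i 1 ⊠ m) :=
  .of_uses [XHat_X_aux.use 0 [0], XHat_CInv.use 0, mul_assoc.symm.use 1 [0, 1, 3, 4],
    XHat_eq.use 0 [0, 1, 2], mul_assoc.use 0 [0, 3], mul_assoc.use 1 [0, 1, 2, 3, 4, 5],
    copairingInv_copairing.use 1, mul_one.use 0, mul_one.use 1 [1, 2]] [] (by decide +kernel)

theorem mul_XHat_left : Holds (i 1 ⊠ Xh ⨾ m ⊠ i 1 ⨾ X) (X ⊠ i 1 ⨾ i 1 ⊠ m) :=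
  .of_uses [mul_X.use 0 [0], XHat_X.use 1] [mul_one.symm.use 0, mul_X.use 0 [0],
    mul_assoc.use 1 [0, 1, 2]] (by decide +kernel)

/-! ### The strand that has crossed may be duplicated or discarded. -/

theorem copairingInv_comul : Holds (b ⨾ i 1 ⊠ D) (b ⨾ i 1 ⊠ b ⊠ i 1 ⨾ m ⊠ c) :=
  .of_uses [copairingInv_eq₂.use 0, antipode_comul.use 1 [0], copairing_comul.use 0,
    copairingInv_eq₂.symm.use 0, copairingInv_eq₂.symm.use 1 [0]] [] (by decide +kernel)

theorem X_comul : Holds (X ⨾ D ⊠ i 1) (i 1 ⊠ D ⨾ X ⊠ i 1 ⨾ i 1 ⊠ X) :=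
  .of_uses [X_eq.use 0, (cr_nat .D).symm.use 0 [0, 1, 2], mul_comul.symm.use 2 [0],
    copairingInv_comul.use 1, (cr_nat .m).symm.use 3 [0, 1, 4], mul_assoc.symm.use 0 [0, 1],
    (cl_nat .m).use 0 [0, 1, 2, 4, 5, 6], (cl_nat .b).use 2 [0, 3, 4]] [X_eq.use 0 [0],
    X_eq.use 1 [0, 1, 2, 3, 4]] (by decide +kernel)

theorem X_counit : Holds (X ⨾ e ⊠ i 1) (i 1 ⊠ e) :=
  .of_uses [X_eq.use 0, (cr_nat .e).symm.use 0 [0, 1, 2], mul_counit.use 2 [0],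
    copairingInv_eq.use 1, copairing_counit_right.use 1, antipode_one.use 1, mul_one.use 0] []
    (by decide +kernel)

theorem XHat_counit : Holds (Xh ⨾ e ⊠ i 1) (i 1 ⊠ e) :=
  .of_uses [XHat_eq.use 0, X_counit.use 0 [0, 1], mul_counit.use 1 [0],
    copairing_counit_left.use 2, mul_one.use 0 [1]] [] (by decide +kernel)

theorem copairing_slideInv : Holds (w ⊠ i 1 ⨾ i 1 ⊠ C) (i 1 ⊠ w ⨾ c ⊠ i 1) :=
  .of_uses [(cr_nat .w).symm.use 0] [c_C.symm.use 1 [0, 1]] (by decide +kernel)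

theorem XHat_comul_aux₁ :
    Holds (Xh ⨾ D ⊠ i 1)
      (i 1 ⊠ D ⨾ X ⊠ i 1 ⨾ i 1 ⊠ X ⨾ i 3 ⊠ (w ⨾ D ⊠ i 1) ⨾ i 2 ⊠ c ⊠ i 2 ⨾ i 1 ⊠ c ⊠ c ⊠ i 1 ⨾ m ⊠ m ⊠ m) :=
  .of_uses [XHat_eq_mul.use 0, mul_comul.symm.use 0 [0, 1, 2], X_comul.use 0] [
    (cr_nat .D).use 2 [0, 1, 2, 3]] (by decide +kernel)

theorem XHat_comul_aux₂ :
    Holds (i 1 ⊠ D ⨾ Xh ⊠ i 1 ⨾ i 1 ⊠ Xh)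
      (i 1 ⊠ D ⨾ X ⊠ i 1 ⨾ i 1 ⊠ Xh ⨾ i 3 ⊠ w ⨾ i 2 ⊠ c ⊠ i 1 ⨾ i 1 ⊠ c ⊠ m ⨾ m ⊠ i 2) :=
  .of_uses [XHat_eq_mul.use 0 [0], mul_XHat_slide.use 2 [0, 1, 2, 3]] [
    (cl_nat .Xh).use 1 [0, 1, 3], copairing_slideInv.symm.use 2 [0]] (by decide +kernel)

/-- The duplicated leg of the additional copairing splits by `comul_copairing` into two copairings,
one for each of the crossings `X̂` on the right. -/
theorem XHat_comul : Holds (Xh ⨾ D ⊠ i 1) (i 1 ⊠ D ⨾ Xh ⊠ i 1 ⨾ i 1 ⊠ Xh) :=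
  .of_uses [XHat_comul_aux₁.use 0, comul_copairing.use 2,
    mul_assoc.symm.use 4 [0, 1, 3, 4, 5, 6, 8]] [XHat_comul_aux₂.use 0, XHat_eq_mul.use 1 [0, 1],
    (cl_nat .m).use 1 [0, 1, 2, 3, 4, 6, 7, 8], (cl_nat .m).use 3 [0, 1, 2, 3, 4, 6],
    (cl_nat .c).use 2 [0, 1, 2, 3, 5, 6], (cl_nat .w).use 2 [4]] (by decide +kernel)


/-! ### Passing a strand through a decorated crossing -/

theorem copairingInv_comul_left : Holds (b ⨾ D ⊠ i 1) (b ⨾ i 1 ⊠ b ⊠ i 1 ⨾ c ⊠ m) :=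
  .of_uses [copairingInv_eq.use 0, antipode_comul.use 0 [0], comul_copairing.use 0,
    copairingInv_eq.symm.use 0, copairingInv_eq.symm.use 1 [0]] [] (by decide +kernel)

/-- Two crossings with the same strand are a diagonal action, by one leg of `w̄`, followed by a
plain braiding. Equivariance of a morphism thus gives its compatibility with the two crossings. -/
theorem X_X_eq :
    Holds (i 1 ⊠ X ⨾ X ⊠ i 1)
      (i 2 ⊠ (b ⨾ D ⊠ i 1) ⊠ i 1 ⨾ i 1 ⊠ c ⊠ i 3 ⨾ m ⊠ m ⊠ m ⨾ i 1 ⊠ c ⨾ c ⊠ i 1) :=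
  .of_uses [X_eq.use 1, X_eq.use 0 [0, 1, 2, 3]] [copairingInv_comul_left.use 2,
    (cl_nat .m).symm.use 1 [0, 1], mul_assoc.use 4 [0, 1], (cr_nat .m).use 2 [0, 1, 2, 4, 5],
    (cr_nat .b).use 1 [0, 3]] (by decide +kernel)

theorem X_X_X : Holds (X ⊠ i 1 ⨾ i 1 ⊠ X ⨾ X ⊠ i 1) ((i 1 ⊠ X ⨾ X ⊠ i 1) ⨾ i 1 ⊠ X) :=
  .of_uses [X_X_eq.use 0 [0], X_mul_comul.symm.use 0 [1], (cl_nat .X).use 0 [0, 1, 2, 3, 4, 6],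
    X_X_eq.symm.use 0] [] (by decide +kernel)

theorem X_c_X : Holds (X ⊠ i 1 ⨾ i 1 ⊠ c ⨾ X ⊠ i 1) ((i 1 ⊠ X ⨾ c ⊠ i 1) ⨾ i 1 ⊠ X) :=
  .of_uses [X_eq.use 0 [0, 1]] [X_eq.use 1, (cl_nat .X).symm.use 0 [0, 1, 2],
    (cr_nat .m).use 1 [0, 1, 3], X_mul.use 0 [0], (cr_nat .b).use 1 [1]] (by decide +kernel)

theorem X_c_XHat : Holds (X ⊠ i 1 ⨾ i 1 ⊠ c ⨾ Xh ⊠ i 1) ((i 1 ⊠ Xh ⨾ c ⊠ i 1) ⨾ i 1 ⊠ X) :=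
  .of_uses [XHat_eq_mul.use 0 [0, 1], X_mul.symm.use 0 [0, 1, 3], (cr_nat .w).symm.use 2 [0, 1],
    (cr_nat .m).symm.use 1 [0, 2]] [XHat_eq_mul.use 1, X_mul.symm.use 1 [1],
    X_mul.use 1 [0, 1, 2, 4], X_c_X.symm.use 0 [0, 1]] (by decide +kernel)

theorem X_X_XHat : Holds (X ⊠ i 1 ⨾ i 1 ⊠ X ⨾ Xh ⊠ i 1) ((i 1 ⊠ Xh ⨾ X ⊠ i 1) ⨾ i 1 ⊠ X) :=
  .of_uses [XHat_eq_mul.use 0 [0, 1], X_mul.symm.use 0 [0, 1, 3], (cr_nat .w).symm.use 2 [0, 1],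
    X_mul.symm.use 1 [0, 2]] [XHat_eq_mul.use 1, X_mul.symm.use 1 [1], X_mul.use 1 [0, 1, 2, 4],
    X_X_X.symm.use 0 [0, 1]] (by decide +kernel)

/-- The counterpart of `X_X_eq`: beyond the crossings `X`, two crossings `X̂` act diagonally by the
second leg of a copairing. -/
theorem XHat_XHat_eq :
    Holds (i 1 ⊠ Xh ⨾ Xh ⊠ i 1)
      (i 1 ⊠ X ⨾ X ⊠ i 1 ⨾ i 3 ⊠ (w ⨾ i 1 ⊠ D) ⨾ i 2 ⊠ c ⊠ i 2 ⨾ i 1 ⊠ c ⊠ c ⊠ i 1 ⨾ m ⊠ m ⊠ m) :=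
  .of_uses [XHat_eq_mul.use 0 [0], X_mul.symm.use 0 [0, 2], XHat_eq_mul.use 1,
    mul_assoc.use 1 [0, 1, 2, 5]] [copairing_comul.use 3, (cr_nat .m).use 2 [0, 1, 3],
    (cr_nat .w).use 3 [0, 2, 3], X_mul.symm.use 0 [0, 1, 2, 3, 4]] (by decide +kernel)

theorem X_XHat_XHat : Holds (X ⊠ i 1 ⨾ i 1 ⊠ Xh ⨾ Xh ⊠ i 1) ((i 1 ⊠ Xh ⨾ Xh ⊠ i 1) ⨾ i 1 ⊠ X) :=
  .of_uses [XHat_XHat_eq.use 0 [0], X_X_X.use 0, (cl_nat .X).use 1 [0, 1, 3],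
    X_mul_comul.symm.use 2 [0, 1, 2, 3, 4], XHat_XHat_eq.symm.use 0] [] (by decide +kernel)

theorem XHat_X_X : Holds (Xh ⊠ i 1 ⨾ i 1 ⊠ X ⨾ X ⊠ i 1) ((i 1 ⊠ X ⨾ X ⊠ i 1) ⨾ i 1 ⊠ Xh) :=
  .of_uses [X_X_eq.use 0 [0], XHat_mul_comul.symm.use 0 [1],
    (cl_nat .Xh).use 0 [0, 1, 2, 3, 4, 6], X_X_eq.symm.use 0] [] (by decide +kernel)

theorem XHat_XHat_XHat :
    Holds (Xh ⊠ i 1 ⨾ i 1 ⊠ Xh ⨾ Xh ⊠ i 1)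
      ((i 1 ⊠ Xh ⨾ Xh ⊠ i 1) ⨾ i 1 ⊠ Xh) :=
  .of_uses [XHat_XHat_eq.use 0 [0], XHat_X_X.use 0, (cl_nat .Xh).use 1 [0, 1, 3],
    XHat_mul_comul.symm.use 2 [0, 1, 2, 3, 4], XHat_XHat_eq.symm.use 0] [] (by decide +kernel)

theorem XHat_X_c : Holds (Xh ⊠ i 1 ⨾ i 1 ⊠ X ⨾ c ⊠ i 1) ((i 1 ⊠ c ⨾ X ⊠ i 1) ⨾ i 1 ⊠ Xh) :=
  .of_uses [X_eq.use 1 [0]] [X_eq.use 0 [0], (cr_nat .b).symm.use 1,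
    (cr_nat .m).symm.use 2 [0, 1], (cl_nat .Xh).symm.use 0 [0, 1, 2, 4],
    mul_XHat_slide.use 0 [0, 1], c_C.use 1 [0]] (by decide +kernel)

theorem XHat_XHat_c : Holds (Xh ⊠ i 1 ⨾ i 1 ⊠ Xh ⨾ c ⊠ i 1) ((i 1 ⊠ c ⨾ Xh ⊠ i 1) ⨾ i 1 ⊠ Xh) :=
  .of_uses [XHat_eq_mul.use 1 [0], (cr_nat .m).use 0 [0, 1, 2, 3], XHat_X_c.use 0] [
    XHat_eq_mul.use 0 [0], mul_XHat_slide.use 2 [0, 1, 2, 3], (cr_nat .w).symm.use 2 [0, 1],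
    c_C.use 3 [0, 2, 3], (cl_nat .Xh).symm.use 1 [0, 1, 3]] (by decide +kernel)

theorem XHat_XHat_X : Holds (Xh ⊠ i 1 ⨾ i 1 ⊠ Xh ⨾ X ⊠ i 1) ((i 1 ⊠ X ⨾ Xh ⊠ i 1) ⨾ i 1 ⊠ Xh) :=
  .of_uses [XHat_eq_mul.use 1 [0], X_mul.symm.use 1 [0, 2], XHat_X_X.use 0 [1, 2],
    X_mul.use 1 [0], X_mul.use 0 [0, 1, 2]] [XHat_eq_mul.use 0 [0],
    mul_XHat_slide.use 2 [0, 1, 2, 3], (cr_nat .w).symm.use 2 [0, 1],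
    c_C.use 3 [0, 2, 3]] (by decide +kernel)


/-! ### Passing a strand through the other generators -/

/-- The diagonal action cancels in `x S(y)`. This invariance is behind the naturality of `ev` and
`W̄`. -/
theorem comul_mul_div :
    Holds (i 2 ⊠ D ⨾ i 1 ⊠ c ⊠ i 1 ⨾ m ⊠ m ⨾ i 1 ⊠ S ⨾ m)
      ((i 1 ⊠ S ⨾ m) ⊠ e) :=
  .of_uses [mul_antipode.use 2 [0, 1], (cr_nat .D).use 1, mul_assoc.symm.use 0 [0, 1, 2, 3, 5],
    mul_assoc.use 0 [0, 1, 2], antipode_right.use 1 [0], mul_one.use 0] [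
    (cr_nat .e).use 1] (by decide +kernel)

theorem X_comul_left : Holds (D ⊠ i 1 ⨾ i 1 ⊠ X ⨾ X ⊠ i 1) (X ⨾ i 1 ⊠ D) :=
  .of_uses [X_X_eq.use 0 [0]] [X_eq.use 0, (cl_nat .D).symm.use 0 [0, 1, 2],
    mul_comul.symm.use 0 [0]] (by decide +kernel)

theorem X_counit_left : Holds (e ⊠ i 1) (X ⨾ i 1 ⊠ e) :=
  .of_uses [] [X_eq.use 0, (cl_nat .e).symm.use 0 [0, 1, 2], mul_counit.use 0 [0],
    copairingInv_eq.use 1, antipode_counit.use 1 [0], copairing_counit_left.use 1,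
    one_mul.use 1] (by decide +kernel)

/-- The integral absorbs its leg of `w̄` as a counit, and the counit of `w̄` is the unit, so the
decoration vanishes. -/
theorem X_element : Holds (L ⊠ i 1 ⨾ X) (i 1 ⊠ L) :=
  .of_uses [X_eq.use 0 [0], element_invariant.use 0 [1], copairingInv_eq.use 0,
    antipode_counit.use 0 [0], copairing_counit_left.use 0, one_mul.use 0] [
    (cl_nat .L).symm.use 0] (by decide +kernel)

theorem X_tau : Holds (t ⊠ i 1 ⨾ X) (X ⨾ i 1 ⊠ t) :=
  .of_uses [X_eq.use 0 [0], tau_mul.use 0 [1], (cl_nat .t).use 0 [0, 1, 3], X_eq.symm.use 0] []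
    (by decide +kernel)

theorem X_div : Holds (i 1 ⊠ X ⨾ X ⊠ i 1 ⨾ i 1 ⊠ (i 1 ⊠ S ⨾ m)) ((i 1 ⊠ S ⨾ m) ⊠ i 1 ⨾ c) :=
  .of_uses [X_X_eq.use 0, (cl_nat .S).symm.use 2 [0, 1, 2, 4, 5],
    (cl_nat .m).symm.use 0 [0, 1, 2, 3, 4, 5, 7], comul_mul_div.use 0 [0], copairingInv_eq.use 2,
    antipode_counit.use 2 [0], copairing_counit_left.use 2, one_mul.use 2] [] (by decide +kernel)

theorem XHat_comul_left : Holds (D ⊠ i 1 ⨾ i 1 ⊠ Xh ⨾ Xh ⊠ i 1) (Xh ⨾ i 1 ⊠ D) :=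
  .of_uses [XHat_XHat_eq.use 0 [0]] [XHat_eq_mul.use 0, mul_comul.symm.use 2 [0, 1, 2],
    (cl_nat .D).symm.use 1 [0, 1], X_comul_left.symm.use 0] (by decide +kernel)

theorem XHat_counit_left : Holds (e ⊠ i 1) (Xh ⨾ i 1 ⊠ e) :=
  .of_uses [X_counit_left.use 0] [XHat_eq.use 0, mul_counit.use 1 [0, 1, 2],
    copairing_counit_right.use 2, mul_one.use 1] (by decide +kernel)

theorem XHat_element : Holds (L ⊠ i 1 ⨾ Xh) (i 1 ⊠ L) :=
  .of_uses [XHat_eq.use 0 [0], X_element.use 0 [1, 2], element_invariant.use 2 [0],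
    copairing_counit_right.use 1, mul_one.use 0] [] (by decide +kernel)

theorem XHat_tau : Holds (t ⊠ i 1 ⨾ Xh) (Xh ⨾ i 1 ⊠ t) :=
  .of_uses [XHat_eq.use 0 [0], X_tau.use 0 [1, 2], tau_mul.use 1 [0, 1, 2], XHat_eq.symm.use 0] []
    (by decide +kernel)

theorem XHat_div : Holds (i 1 ⊠ Xh ⨾ Xh ⊠ i 1 ⨾ i 1 ⊠ (i 1 ⊠ S ⨾ m)) ((i 1 ⊠ S ⨾ m) ⊠ i 1 ⨾ c) :=
  .of_uses [XHat_XHat_eq.use 0, comul_mul_div.use 2 [0, 1, 2, 4, 5], copairing_counit_right.use 3,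
    (cl_nat .S).symm.use 2 [0, 1], (cl_nat .m).symm.use 1 [0, 1, 2, 4], X_div.use 0,
    (cr_nat .m).symm.use 0 [0, 1, 3], mul_one.use 2] [] (by decide +kernel)


/-! ### The generators against each of the three crossings of the strand. -/

theorem c_pass_comul : Holds (D ⊠ i 1 ⨾ i 1 ⊠ c ⨾ c ⊠ i 1) (c ⨾ i 1 ⊠ D) :=
  .of_uses [(cl_nat .D).use 0] [] (by decide +kernel)

theorem c_pass_counit : Holds (e ⊠ i 1 ⨾ i 1) (c ⨾ i 1 ⊠ e) :=
  .of_uses [(cl_nat .e).use 0] [] (by decide +kernel)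

theorem c_pass_element : Holds (L ⊠ i 1 ⨾ c) (i 1 ⨾ i 1 ⊠ L) :=
  .of_uses [(cl_nat .L).use 0] [] (by decide +kernel)

theorem c_pass_tau : Holds (t ⊠ i 1 ⨾ c) (c ⨾ i 1 ⊠ t) :=
  .of_uses [(cl_nat .t).use 0] [] (by decide +kernel)

theorem c_pass_ev :
    Holds ((i 1 ⊠ S ⨾ m ⨾ l) ⊠ i 1 ⨾ i 1)
      ((i 1 ⊠ c ⨾ c ⊠ i 1) ⨾ i 1 ⊠ (i 1 ⊠ S ⨾ m ⨾ l)) :=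
  .of_uses [(cl_nat .l).use 0 [0, 1], (cl_nat .m).use 0 [0], (cl_nat .S).use 1] []
    (by decide +kernel)

theorem c_pass_W :
    Holds ((i 1 ⊠ (L ⨾ D) ⨾ m ⊠ t) ⊠ i 1 ⨾ i 1 ⊠ c ⨾ c ⊠ i 1)
      (c ⨾ i 1 ⊠ (i 1 ⊠ (L ⨾ D) ⨾ m ⊠ t)) :=
  .of_uses [(cl_nat .t).use 2 [0, 1]] [(cl_nat .L).symm.use 1, (cl_nat .D).symm.use 1 [0],
    (cl_nat .m).symm.use 0 [0, 1, 2]] (by decide +kernel)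

theorem c_pass_WBar : Holds ((T ⊠ S ⨾ m) ⊠ i 1 ⨾ c) ((i 1 ⊠ c ⨾ c ⊠ i 1) ⨾ i 1 ⊠ (T ⊠ S ⨾ m)) :=
  .of_uses [(cl_nat .m).use 0 [0, 1], (cl_nat .S).use 1] [
    (cl_nat .T).symm.use 0 [0]] (by decide +kernel)

theorem X_pass_comul : Holds (D ⊠ i 1 ⨾ i 1 ⊠ X ⨾ X ⊠ i 1) (X ⨾ i 1 ⊠ D) :=
  .of_uses [X_comul_left.use 0] [] (by decide +kernel)

theorem X_pass_counit : Holds (e ⊠ i 1 ⨾ i 1) (X ⨾ i 1 ⊠ e) :=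
  .of_uses [X_counit_left.use 0] [] (by decide +kernel)

theorem X_pass_element : Holds (L ⊠ i 1 ⨾ X) (i 1 ⨾ i 1 ⊠ L) :=
  .of_uses [X_element.use 0] [] (by decide +kernel)

theorem X_pass_tau : Holds (t ⊠ i 1 ⨾ X) (X ⨾ i 1 ⊠ t) :=
  .of_uses [X_tau.use 0] [] (by decide +kernel)

theorem X_pass_ev :
    Holds ((i 1 ⊠ S ⨾ m ⨾ l) ⊠ i 1 ⨾ i 1)
      ((i 1 ⊠ X ⨾ X ⊠ i 1) ⨾ i 1 ⊠ (i 1 ⊠ S ⨾ m ⨾ l)) :=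
  .of_uses [(cl_nat .l).use 0 [0, 1], X_div.symm.use 0] [] (by decide +kernel)

theorem X_pass_W :
    Holds ((i 1 ⊠ (L ⨾ D) ⨾ m ⊠ t) ⊠ i 1 ⨾ i 1 ⊠ X ⨾ X ⊠ i 1)
      (c ⨾ i 1 ⊠ (i 1 ⊠ (L ⨾ D) ⨾ m ⊠ t)) :=
  .of_uses [X_tau.use 2 [0, 1]] [X_element.symm.use 1, X_comul_left.symm.use 1 [0],
    mul_X.symm.use 0 [0, 1, 2]] (by decide +kernel)

theorem X_pass_WBar : Holds ((T ⊠ S ⨾ m) ⊠ i 1 ⨾ c) ((i 1 ⊠ X ⨾ X ⊠ i 1) ⨾ i 1 ⊠ (T ⊠ S ⨾ m)) :=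
  .of_uses [tauInv_mul.use 0 [1]] [tauInv_mul.use 1 [0, 1, 3], X_div.use 0,
    (cl_nat .T).symm.use 0 [0, 1]] (by decide +kernel)

theorem XHat_pass_comul : Holds (D ⊠ i 1 ⨾ i 1 ⊠ Xh ⨾ Xh ⊠ i 1) (Xh ⨾ i 1 ⊠ D) :=
  .of_uses [XHat_comul_left.use 0] [] (by decide +kernel)

theorem XHat_pass_counit : Holds (e ⊠ i 1 ⨾ i 1) (Xh ⨾ i 1 ⊠ e) :=
  .of_uses [XHat_counit_left.use 0] [] (by decide +kernel)

theorem XHat_pass_element : Holds (L ⊠ i 1 ⨾ Xh) (i 1 ⨾ i 1 ⊠ L) :=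
  .of_uses [XHat_element.use 0] [] (by decide +kernel)

theorem XHat_pass_tau : Holds (t ⊠ i 1 ⨾ Xh) (Xh ⨾ i 1 ⊠ t) :=
  .of_uses [XHat_tau.use 0] [] (by decide +kernel)

theorem XHat_pass_ev :
    Holds ((i 1 ⊠ S ⨾ m ⨾ l) ⊠ i 1 ⨾ i 1)
      ((i 1 ⊠ Xh ⨾ Xh ⊠ i 1) ⨾ i 1 ⊠ (i 1 ⊠ S ⨾ m ⨾ l)) :=
  .of_uses [(cl_nat .l).use 0 [0, 1], XHat_div.symm.use 0] [] (by decide +kernel)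

theorem XHat_pass_W :
    Holds ((i 1 ⊠ (L ⨾ D) ⨾ m ⊠ t) ⊠ i 1 ⨾ i 1 ⊠ Xh ⨾ Xh ⊠ i 1)
      (c ⨾ i 1 ⊠ (i 1 ⊠ (L ⨾ D) ⨾ m ⊠ t)) :=
  .of_uses [XHat_tau.use 2 [0, 1]] [XHat_element.symm.use 1, XHat_comul_left.symm.use 1 [0],
    mul_XHat.symm.use 0 [0, 1, 2]] (by decide +kernel)

theorem XHat_pass_WBar :
    Holds ((T ⊠ S ⨾ m) ⊠ i 1 ⨾ c)
      ((i 1 ⊠ Xh ⨾ Xh ⊠ i 1) ⨾ i 1 ⊠ (T ⊠ S ⨾ m)) :=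
  .of_uses [tauInv_mul.use 0 [1]] [tauInv_mul.use 1 [0, 1, 3], XHat_div.use 0,
    (cl_nat .T).symm.use 0 [0, 1]] (by decide +kernel)


/-! ### Right multiplication on the strands of a generator -/

theorem mulRight_comul : Holds (D ⊠ i 1 ⨾ i 2 ⊠ D ⨾ i 1 ⊠ c ⊠ i 1 ⨾ m ⊠ m) (m ⨾ D) :=
  .of_uses [mul_comul.use 0] [] (by decide +kernel)

theorem mulRight_counit : Holds (e ⊠ i 1 ⨾ e) (m ⨾ e) :=
  .of_uses [mul_counit.symm.use 0] [] (by decide +kernel)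

theorem mulRight_ev :
    Holds ((i 1 ⊠ S ⨾ m ⨾ l) ⊠ i 1 ⨾ e)
      ((i 2 ⊠ D ⨾ i 1 ⊠ c ⊠ i 1 ⨾ m ⊠ m) ⨾ (i 1 ⊠ S ⨾ m ⨾ l)) :=
  .of_uses [comul_mul_div.symm.use 0] [] (by decide +kernel)

/-- On the input of `W`, which has label `0`, the strand acts by the counit; on its outputs it acts
diagonally on `ΔΛ`, and `Λ` absorbs it. -/
theorem mulRight_W :
    Holds ((i 1 ⊠ (L ⨾ D) ⨾ m ⊠ t) ⊠ i 1 ⨾ i 2 ⊠ D ⨾ i 1 ⊠ c ⊠ i 1 ⨾ m ⊠ m)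
      (i 1 ⊠ e ⨾ (i 1 ⊠ (L ⨾ D) ⨾ m ⊠ t)) :=
  .of_uses [(cl_nat .t).use 2 [0, 1, 4], mul_assoc.use 0 [0, 1, 2, 3]] [
    element_invariant.symm.use 1, mul_comul.symm.use 1 [0],
    tau_mul.symm.use 3 [0, 1, 2, 3]] (by decide +kernel)

theorem mulRight_WBar :
    Holds ((T ⊠ S ⨾ m) ⊠ i 1 ⨾ i 1 ⊠ e)
      ((i 2 ⊠ D ⨾ i 1 ⊠ c ⊠ i 1 ⨾ m ⊠ m) ⨾ (T ⊠ S ⨾ m)) :=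
  .of_uses [comul_mul_div.symm.use 0 [0]] [tauInv_mul.symm.use 0 [0, 1]] (by decide +kernel)

theorem mulRight_X :
    Holds (X ⊠ i 1 ⨾ i 2 ⊠ D ⨾ i 1 ⊠ c ⊠ i 1 ⨾ m ⊠ m)
      ((i 2 ⊠ D ⨾ i 1 ⊠ c ⊠ i 1 ⨾ m ⊠ m) ⨾ X) :=
  .of_uses [X_mul_comul.symm.use 0] [] (by decide +kernel)

theorem mulRight_XHat :
    Holds (Xh ⊠ i 1 ⨾ i 2 ⊠ D ⨾ i 1 ⊠ c ⊠ i 1 ⨾ m ⊠ m)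
      ((i 2 ⊠ D ⨾ i 1 ⊠ c ⊠ i 1 ⨾ m ⊠ m) ⨾ Xh) :=
  .of_uses [XHat_mul_comul.symm.use 0] [] (by decide +kernel)

/-! ### Crossings of two letters of which exactly one is `k`. -/

theorem c_mulFst : Holds (i 2 ⊠ D ⨾ i 1 ⊠ c ⊠ i 1 ⨾ m ⊠ i 1 ⊠ e) (i 1 ⊠ c ⨾ m ⊠ i 1) :=
  .of_uses [comul_counit.use 2] [] (by decide +kernel)

theorem X_mulFst : Holds (i 2 ⊠ D ⨾ i 1 ⊠ X ⊠ i 1 ⨾ m ⊠ i 1 ⊠ e) (i 1 ⊠ X ⨾ m ⊠ i 1) :=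
  .of_uses [comul_counit.use 2] [] (by decide +kernel)

theorem XHat_mulFst : Holds (i 2 ⊠ D ⨾ i 1 ⊠ Xh ⊠ i 1 ⨾ m ⊠ i 1 ⊠ e) (i 1 ⊠ Xh ⨾ m ⊠ i 1) :=
  .of_uses [comul_counit.use 2] [] (by decide +kernel)

theorem mulSnd : Holds (i 2 ⊠ D ⨾ i 1 ⊠ c ⊠ i 1 ⨾ (i 1 ⊠ e) ⊠ m) (i 1 ⊠ m) :=
  .of_uses [(cr_nat .e).symm.use 1 [0], counit_comul.use 2] [] (by decide +kernel)

theorem mulFst_X_X :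
    Holds (X ⊠ i 1 ⨾ i 2 ⊠ D ⨾ i 1 ⊠ c ⊠ i 1 ⨾ (i 1 ⊠ e) ⊠ m)
      ((i 2 ⊠ D ⨾ i 1 ⊠ X ⊠ i 1 ⨾ m ⊠ i 1 ⊠ e) ⨾ Xh) :=
  .of_uses [mulSnd.use 0 [0], mul_X_left.symm.use 0] [X_mulFst.use 0] (by decide +kernel)

theorem mulFst_XHat_X :
    Holds (X ⊠ i 1 ⨾ i 2 ⊠ D ⨾ i 1 ⊠ c ⊠ i 1 ⨾ (i 1 ⊠ e) ⊠ m)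
      ((i 2 ⊠ D ⨾ i 1 ⊠ Xh ⊠ i 1 ⨾ m ⊠ i 1 ⊠ e) ⨾ X) :=
  .of_uses [mulSnd.use 0 [0], mul_XHat_left.symm.use 0] [XHat_mulFst.use 0] (by decide +kernel)

theorem mulSnd_X :
    Holds (X ⊠ i 1 ⨾ i 2 ⊠ D ⨾ i 1 ⊠ c ⊠ i 1 ⨾ m ⊠ i 1 ⊠ e)
      ((i 2 ⊠ D ⨾ i 1 ⊠ c ⊠ i 1 ⨾ (i 1 ⊠ e) ⊠ m) ⨾ X) :=
  .of_uses [c_mulFst.use 0 [0], X_mul.symm.use 0] [mulSnd.use 0] (by decide +kernel)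

theorem mulFst_c_XHat :
    Holds (Xh ⊠ i 1 ⨾ i 2 ⊠ D ⨾ i 1 ⊠ c ⊠ i 1 ⨾ (i 1 ⊠ e) ⊠ m)
      ((i 2 ⊠ D ⨾ i 1 ⊠ c ⊠ i 1 ⨾ m ⊠ i 1 ⊠ e) ⨾ Xh) :=
  .of_uses [mulSnd.use 0 [0]] [c_mulFst.use 0, mul_XHat_slide.use 0 [0],
    c_C.use 1] (by decide +kernel)

theorem mulSnd_X_XHat :
    Holds (Xh ⊠ i 1 ⨾ i 2 ⊠ D ⨾ i 1 ⊠ X ⊠ i 1 ⨾ m ⊠ i 1 ⊠ e)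
      ((i 2 ⊠ D ⨾ i 1 ⊠ c ⊠ i 1 ⨾ (i 1 ⊠ e) ⊠ m) ⨾ X) :=
  .of_uses [X_mulFst.use 0 [0], mul_X_XHat.symm.use 0] [mulSnd.use 0] (by decide +kernel)

theorem mulSnd_XHat_XHat :
    Holds (Xh ⊠ i 1 ⨾ i 2 ⊠ D ⨾ i 1 ⊠ Xh ⊠ i 1 ⨾ m ⊠ i 1 ⊠ e)
      ((i 2 ⊠ D ⨾ i 1 ⊠ c ⊠ i 1 ⨾ (i 1 ⊠ e) ⊠ m) ⨾ Xh) :=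
  .of_uses [XHat_mulFst.use 0 [0], mul_XHat_XHat.symm.use 0] [mulSnd.use 0] (by decide +kernel)


/-! ### Crossings and actions of a single strand -/

theorem mul_c : Holds (m ⊠ i 1 ⨾ c) (i 1 ⊠ c ⨾ c ⊠ i 1 ⨾ i 1 ⊠ m) :=
  .of_uses [(cl_nat .m).use 0] [] (by decide +kernel)

theorem c_comul : Holds (c ⨾ D ⊠ i 1) (i 1 ⊠ D ⨾ c ⊠ i 1 ⨾ i 1 ⊠ c) :=
  .of_uses [(cr_nat .D).symm.use 0] [] (by decide +kernel)

theorem c_counit : Holds (c ⨾ e ⊠ i 1) (i 1 ⊠ e) :=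
  .of_uses [(cr_nat .e).symm.use 0] [] (by decide +kernel)

theorem mul_id_counit : Holds (m ⊠ i 1 ⨾ i 1 ⊠ e) (i 1 ⊠ i 1 ⊠ e ⨾ m) :=
  .of_uses [] [] (by decide +kernel)

theorem mul_divInv : Holds (i 1 ⊠ D ⨾ m ⊠ i 1 ⨾ i 1 ⊠ S ⨾ m) (i 1 ⊠ e) :=
  .of_uses [mul_assoc.use 0 [0, 2], antipode_right.use 1, mul_one.use 0] [] (by decide +kernel)

theorem divInv_mul : Holds (i 1 ⊠ D ⨾ (i 1 ⊠ S ⨾ m) ⊠ i 1 ⨾ m) (i 1 ⊠ e) :=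
  .of_uses [mul_assoc.use 0 [0, 1], antipode_left.use 1, mul_one.use 0] [] (by decide +kernel)

theorem counit_counit : Holds (i 1 ⊠ D ⨾ (i 1 ⊠ e) ⊠ i 1 ⨾ i 1 ⊠ e) (i 1 ⊠ e) :=
  .of_uses [counit_comul.use 1] [] (by decide +kernel)

end E

end BPHopf

namespace BPHopf

open StrictPres

local infixr:60 " ⨾ " => E.comp
local infixr:70 " ⊠ " => E.tensor

/-! ## Sliding a strand along a word -/

/-- The variable with the number `n`. -/
abbrev E.v (n : ℕ) : E := .x (.v n)

/-- The environment in which the label `i + 1` has the width with the number `i` of a list. -/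
abbrev Env.of {σ : Sig} (ws : List ℕ) (val : List Mor)
    (h : List.Forall₂ (fun (p : List ℕ × List ℕ) (f : Mor) =>
      f.dom = (p.1.map fun i => (1 :: ws).getD i 0).sum ∧
        f.cod = (p.2.map fun i => (1 :: ws).getD i 0).sum) σ val) : Env σ :=
  ⟨fun i => (1 :: ws).getD i 0, rfl, val, h⟩

open E

/-- The data needed to move a strand from the right of a word to its left and to let it act on the
letters of the word. -/
structure Slide where
  /-- The crossing of a letter with the strand. -/
  g : ℕ → Mor
  /-- The action on a letter. -/
  θ : ℕ → Mor
  g_typed (i : ℕ) : (g i).dom = 2 ∧ (g i).cod = 2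
  θ_typed (i : ℕ) : (θ i).dom = 2 ∧ (θ i).cod = 1
  -- Duplicating or discarding the strand may be postponed until after a crossing. The action on
  -- concatenated words and the inverse of `Ω` depend on this.
  g_comul (i : ℕ) : (g i).comp ((Mor.tm Delta).tensor (.id 1)) =
    ((Mor.id 1).tensor (.tm Delta)).comp (((g i).tensor (.id 1)).comp ((Mor.id 1).tensor (g i)))
  g_counit (i : ℕ) : (g i).comp ((Mor.tm eps).tensor (.id 1)) = (Mor.id 1).tensor (.tm eps)

  -- Compatibility with left multiplication on a letter, which enters through the generators `U`.
  g_mul (i : ℕ) : ((Mor.tm mu).tensor (.id 1)).comp (g i) =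
    ((Mor.id 1).tensor (g i)).comp (((Mor.tm (br 1 1)).tensor (.id 1)).comp
      ((Mor.id 1).tensor (.tm mu)))
  θ_mul (i : ℕ) : ((Mor.tm mu).tensor (.id 1)).comp (θ i) =
    ((Mor.id 1).tensor (θ i)).comp (.tm mu)

namespace Slide

variable (A : Slide)

/-- The crossing of a word with the strand. -/
def G : List ℕ → Mor
  | [] => .id 1
  | a :: l => ((Mor.id 1).tensor (G l)).comp ((A.g a).tensor (.id l.length))

/-- The action on a word. -/
def Φ : List ℕ → Mor
  | [] => .tm eps
  | a :: l => ((Mor.id 1).tensor ((Mor.id l.length).tensor (.tm Delta))).comp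
      (((Mor.id 1).tensor ((A.G l).tensor (.id 1))).comp ((A.θ a).tensor (Φ l)))

theorem G_typed : ∀ l : List ℕ, (A.G l).dom = l.length + 1 ∧ (A.G l).cod = 1 + l.length
  | [] => ⟨rfl, rfl⟩
  | a :: l => by
    have h : _ = 1 + (l.length + 1) ∧ _ = 1 + (1 + l.length) :=
      den_typed (σ := [([0, 0], [0, 0]), ([1, 0], [0, 1])])
        (.of [l.length] [A.g a, A.G l] (.cons (A.g_typed a) (.cons (G_typed l) .nil)))
        (i 1 ⊠ v 1 ⨾ v 0 ⊠ id [1]) (by decide)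
    exact ⟨h.1.trans (add_comm _ _), h.2.trans (by rw [List.length_cons, add_comm l.length])⟩

theorem Φ_typed : ∀ l : List ℕ, (A.Φ l).dom = l.length + 1 ∧ (A.Φ l).cod = l.length
  | [] => ⟨rfl, rfl⟩
  | a :: l => by
    have h : _ = 1 + (l.length + 1) ∧ _ = 1 + l.length :=
      den_typed (σ := [([0, 0], [0]), ([1, 0], [0, 1]), ([1, 0], [1])])
        (.of [l.length] [A.θ a, A.G l, A.Φ l]
          (.cons (A.θ_typed a) (.cons (A.G_typed l) (.cons (Φ_typed l) .nil))))
        (i 1 ⊠ id [1] ⊠ D ⨾ i 1 ⊠ v 1 ⊠ i 1 ⨾ v 0 ⊠ v 2) (by decide)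
    exact ⟨h.1.trans (add_comm _ _), h.2.trans (add_comm _ _)⟩

theorem G_singleton (a : ℕ) : A.G [a] = A.g a :=
  den_eq_of_check (σ := [([0, 0], [0, 0])]) (f := i 1 ⊠ i 1 ⨾ v 0 ⊠ id []) (g := v 0)
    (.of [] [A.g a] (.cons (A.g_typed a) .nil)) .nil [] [] (by decide +kernel)

theorem G_pair (a b : ℕ) : A.G [a, b] =
    ((Mor.id 1).tensor (A.g b)).comp ((A.g a).tensor (.id 1)) :=
  den_eq_of_check (σ := [([0, 0], [0, 0]), ([0, 0], [0, 0])])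
    (f := i 1 ⊠ (i 1 ⊠ i 1 ⨾ v 1 ⊠ id []) ⨾ v 0 ⊠ i 1) (g := i 1 ⊠ v 1 ⨾ v 0 ⊠ i 1)
    (.of [] [A.g a, A.g b] (.cons (A.g_typed a) <| .cons (A.g_typed b) .nil)) .nil [] []
    (by decide +kernel)

theorem Φ_singleton (a : ℕ) : A.Φ [a] = A.θ a :=
  den_eq_of_check (σ := [([0, 0], [0])]) (f := i 1 ⊠ id [] ⊠ D ⨾ i 1 ⊠ i 1 ⊠ i 1 ⨾ v 0 ⊠ e)
    (g := v 0) (.of [] [A.θ a] (.cons (A.θ_typed a) .nil)) (.cons (comul_counit.den _) <| .nil)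
    [⟨0, false, 1, []⟩] [] (by decide +kernel)

theorem Φ_pair (a b : ℕ) : A.Φ [a, b] = ((Mor.id 2).tensor (.tm Delta)).comp
    (((Mor.id 1).tensor ((A.g b).tensor (.id 1))).comp ((A.θ a).tensor (A.θ b))) := by
  rw [Φ, Φ_singleton, G_singleton]
  exact
    den_eq_of_check (σ := [([0, 0], [0, 0]), ([0, 0], [0]), ([0, 0], [0])])
      (f := i 1 ⊠ i 1 ⊠ D ⨾ i 1 ⊠ v 0 ⊠ i 1 ⨾ v 1 ⊠ v 2)
      (g := i 2 ⊠ D ⨾ i 1 ⊠ v 0 ⊠ i 1 ⨾ v 1 ⊠ v 2) (.of [] [A.g b, A.θ a, A.θ b]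
      (.cons (A.g_typed b) <| .cons (A.θ_typed a) <| .cons (A.θ_typed b) .nil)) .nil [] []
      (by decide +kernel)

theorem G_comul : ∀ l : List ℕ, (A.G l).comp ((Mor.tm Delta).tensor (.id l.length)) =
    ((Mor.id l.length).tensor (.tm Delta)).comp
      (((A.G l).tensor (.id 1)).comp ((Mor.id 1).tensor (A.G l)))
  | [] =>
    den_eq_of_check (σ := []) (f := i 1 ⨾ D ⊠ id []) (g := id [] ⊠ D ⨾ i 1 ⊠ i 1 ⨾ i 1 ⊠ i 1)
      (.of [] [] (.nil)) .nil [] [] (by decide +kernel)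
  | a :: l => by
    have := G_comul l
    -- Splits off the first letter, so that the goal becomes the value of a diagram with the labels
    -- `0` for this letter and `1` for the rest.
    rw [List.length_cons, add_comm, ← Mor.id_tensor_id]
    exact
      den_eq_of_check (σ := [([0, 0], [0, 0]), ([1, 0], [0, 1])])
        (f := (i 1 ⊠ v 1 ⨾ v 0 ⊠ id [1]) ⨾ D ⊠ i 1 ⊠ id [1])
        (g := (i 1 ⊠ id [1]) ⊠ D ⨾ (i 1 ⊠ v 1 ⨾ v 0 ⊠ id [1]) ⊠ i 1 ⨾ i 1 ⊠ (i 1 ⊠ v 1 ⨾ v 0 ⊠ id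
          [1])) (.of [l.length] [A.g a, A.G l] (.cons (A.g_typed a) <| .cons (A.G_typed l) .nil))
        (.cons (f := v 0 ⨾ D ⊠ i 1) (g := i 1 ⊠ D ⨾ v 0 ⊠ i 1 ⨾ i 1 ⊠ v 0) (A.g_comul a) <|
        .cons (f := v 1 ⨾ D ⊠ id [1]) (g := id [1] ⊠ D ⨾ v 1 ⊠ i 1 ⨾ i 1 ⊠ v 1) this <| .nil)
        [⟨0, false, 0, [0]⟩, ⟨1, false, 1, []⟩] [] (by decide +kernel)

theorem G_counit : ∀ l : List ℕ, (A.G l).comp ((Mor.tm eps).tensor (.id l.length)) =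
    (Mor.id l.length).tensor (.tm eps)
  | [] =>
    den_eq_of_check (σ := []) (f := i 1 ⨾ e ⊠ id []) (g := id [] ⊠ e) (.of [] [] (.nil)) .nil []
      [] (by decide +kernel)
  | a :: l => by
    have := G_counit l
    rw [List.length_cons, add_comm, ← Mor.id_tensor_id]
    exact
      den_eq_of_check (σ := [([0, 0], [0, 0]), ([1, 0], [0, 1])])
        (f := (i 1 ⊠ v 1 ⨾ v 0 ⊠ id [1]) ⨾ e ⊠ i 1 ⊠ id [1]) (g := (i 1 ⊠ id [1]) ⊠ e)
        (.of [l.length] [A.g a, A.G l] (.cons (A.g_typed a) <| .cons (A.G_typed l) .nil))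
        (.cons (f := v 0 ⨾ e ⊠ i 1) (g := i 1 ⊠ e) (A.g_counit a) <|
        .cons (f := v 1 ⨾ e ⊠ id [1]) (g := id [1] ⊠ e) this <| .nil)
        [⟨0, false, 0, [0]⟩, ⟨1, false, 1, []⟩] [] (by decide +kernel)

theorem G_append (p : List ℕ) : ∀ l : List ℕ, A.G (l ++ p) =
    ((Mor.id l.length).tensor (A.G p)).comp ((A.G l).tensor (.id p.length))
  | [] =>
    den_eq_of_check (σ := [([1, 0], [0, 1])]) (f := v 0) (g := id [] ⊠ v 0 ⨾ i 1 ⊠ id [1])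
      (.of [p.length] [A.G p] (.cons (A.G_typed p) .nil)) .nil [] [] (by decide +kernel)
  | a :: l => by
    have := G_append p l
    rw [List.cons_append, G, this, List.length_append, List.length_cons, add_comm l.length 1,
      ← Mor.id_tensor_id 1]
    exact
      den_eq_of_check (σ := [([0, 0], [0, 0]), ([1, 0], [0, 1]), ([2, 0], [0, 2])])
        (f := i 1 ⊠ (id [1] ⊠ v 2 ⨾ v 1 ⊠ id [2]) ⨾ v 0 ⊠ id [1, 2])
        (g := (i 1 ⊠ id [1]) ⊠ v 2 ⨾ (i 1 ⊠ v 1 ⨾ v 0 ⊠ id [1]) ⊠ id [2])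
        (.of [l.length, p.length] [A.g a, A.G l, A.G p]
        (.cons (A.g_typed a) <| .cons (A.G_typed l) <| .cons (A.G_typed p) .nil)) .nil [] []
        (by decide +kernel)

/-- The copy of the strand that acts on `l` first crosses `p`. Coassociativity and `G_comul` make
this independent of the way in which a word is cut. -/
theorem Φ_append (p : List ℕ) : ∀ l : List ℕ, A.Φ (l ++ p) =
    ((Mor.id l.length).tensor ((Mor.id p.length).tensor (.tm Delta))).comp
      (((Mor.id l.length).tensor ((A.G p).tensor (.id 1))).comp ((A.Φ l).tensor (A.Φ p)))
  | [] =>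
    den_eq_of_check (σ := [([1, 0], [0, 1]), ([1, 0], [1])]) (f := v 1)
      (g := id [] ⊠ id [1] ⊠ D ⨾ id [] ⊠ v 0 ⊠ i 1 ⨾ e ⊠ v 1) (.of [p.length] [A.G p, A.Φ p]
      (.cons (A.G_typed p) <| .cons (A.Φ_typed p) .nil))
      (.cons (f := v 0 ⨾ e ⊠ id [1]) (g := id [1] ⊠ e) (A.G_counit p) <|
      .cons (counit_comul.den _) <| .nil) [] [⟨0, false, 0, [0]⟩, ⟨1, false, 1, []⟩]
      (by decide +kernel)
  | a :: l => by
    have := Φ_append p l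
    rw [List.cons_append, Φ, this, A.G_append, List.length_append, List.length_cons,
      add_comm l.length 1, ← Mor.id_tensor_id 1]
    exact
      den_eq_of_check (σ := [([0, 0], [0]), ([1, 0], [0, 1]), ([2, 0], [0, 2]), ([1, 0], [1]), ([2, 0], [2])])
        (f := i 1 ⊠ id [1, 2] ⊠ D ⨾ i 1 ⊠ (id [1] ⊠ v 2 ⨾ v 1 ⊠ id [2]) ⊠ i 1 ⨾ v 0 ⊠ (id [1] ⊠ id
          [2] ⊠ D ⨾ id [1] ⊠ v 2 ⊠ i 1 ⨾ v 3 ⊠ v 4))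
        (g := (i 1 ⊠ id [1]) ⊠ id [2] ⊠ D ⨾ (i 1 ⊠ id [1]) ⊠ v 2 ⊠ i 1 ⨾ (i 1 ⊠ id [1] ⊠ D ⨾ i 1 ⊠
          v 1 ⊠ i 1 ⨾ v 0 ⊠ v 3) ⊠ v 4)
        (.of [l.length, p.length] [A.θ a, A.G l, A.G p, A.Φ l, A.Φ p]
        (.cons (A.θ_typed a) <| .cons (A.G_typed l) <| .cons (A.G_typed p) <| .cons (A.Φ_typed l)
          <| .cons (A.Φ_typed p) .nil)) (.cons (comul_assoc.den _) <|
        .cons (f := v 2 ⨾ D ⊠ id [2]) (g := id [2] ⊠ D ⨾ v 2 ⊠ i 1 ⨾ i 1 ⊠ v 2) (A.G_comul p) <|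
        .nil) [⟨0, true, 3, []⟩, ⟨1, true, 2, [0]⟩] [] (by decide +kernel)

end Slide

end BPHopf

namespace BPHopf

open StrictPres

local infixr:60 " ⨾ " => E.comp
local infixr:70 " ⊠ " => E.tensor

open E

namespace Slide

variable {A : Slide}

/-! ## Natural families -/

variable (A) in
/-- Crossing a word with the strand is compatible with `F`, and the action of the strand transforms
`F` into `F'`. -/
structure Natural (F F' : Mor) (l l' : List ℕ) : Prop where
  typed : F.dom = l.length ∧ F.cod = l'.length
  typed' : F'.dom = l.length ∧ F'.cod = l'.length
  G : (F.tensor (.id 1)).comp (A.G l') = (A.G l).comp ((Mor.id 1).tensor F)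
  Φ : (F.tensor (.id 1)).comp (A.Φ l') = (A.Φ l).comp F'

theorem Natural.id (l : List ℕ) : A.Natural (.id l.length) (.id l.length) l l where
  typed := ⟨rfl, rfl⟩
  typed' := ⟨rfl, rfl⟩
  G :=
    den_eq_of_check (σ := [([1, 0], [0, 1])]) (f := E.id [1] ⊠ i 1 ⨾ v 0)
      (g := v 0 ⨾ i 1 ⊠ E.id [1]) (.of [l.length] [A.G l] (.cons (A.G_typed l) .nil)) .nil [] []
      (by decide +kernel)
  Φ :=
    den_eq_of_check (σ := [([1, 0], [1])]) (f := E.id [1] ⊠ i 1 ⨾ v 0) (g := v 0 ⨾ E.id [1])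
      (.of [l.length] [A.Φ l] (.cons (A.Φ_typed l) .nil)) .nil [] [] (by decide +kernel)

theorem Natural.comp {f f' g g' : Mor} {l p q : List ℕ} (hf : A.Natural f f' l p)
    (hg : A.Natural g g' p q) : A.Natural (f.comp g) (f'.comp g') l q where
  typed := ⟨(Mor.comp_dom _ _).trans hf.typed.1, (Mor.comp_cod (hf.typed.2.trans hg.typed.1.symm)).trans hg.typed.2⟩
  typed' := ⟨(Mor.comp_dom _ _).trans hf.typed'.1, (Mor.comp_cod (hf.typed'.2.trans hg.typed'.1.symm)).trans hg.typed'.2⟩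
  G :=
    den_eq_of_check (σ := [([1], [2]), ([2], [3]), ([1, 0], [0, 1]), ([2, 0], [0, 2]), ([3, 0], [0, 3])])
      (f := (v 0 ⨾ v 1) ⊠ i 1 ⨾ v 4) (g := v 2 ⨾ i 1 ⊠ (v 0 ⨾ v 1))
      (.of [l.length, p.length, q.length] [f, g, A.G l, A.G p, A.G q]
      (.cons hf.typed <| .cons hg.typed <| .cons (A.G_typed l) <| .cons (A.G_typed p) <| .cons
        (A.G_typed q) .nil)) (.cons (f := v 1 ⊠ i 1 ⨾ v 4) (g := v 3 ⨾ i 1 ⊠ v 1) hg.G <|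
      .cons (f := v 0 ⊠ i 1 ⨾ v 3) (g := v 2 ⨾ i 1 ⊠ v 0) hf.G <| .nil)
      [⟨0, false, 0, [0]⟩, ⟨1, false, 0, []⟩] [] (by decide +kernel)
  Φ :=
    den_eq_of_check (σ := [([1], [2]), ([2], [3]), ([1], [2]), ([2], [3]), ([1, 0], [1]), ([2, 0], [2]), ([3, 0], [3])])
      (f := (v 0 ⨾ v 1) ⊠ i 1 ⨾ v 6) (g := v 4 ⨾ v 2 ⨾ v 3)
      (.of [l.length, p.length, q.length] [f, g, f', g', A.Φ l, A.Φ p, A.Φ q]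
      (.cons hf.typed <| .cons hg.typed <| .cons hf.typed' <| .cons hg.typed' <| .cons (A.Φ_typed
        l) <| .cons (A.Φ_typed p) <| .cons (A.Φ_typed q) .nil))
      (.cons (f := v 1 ⊠ i 1 ⨾ v 6) (g := v 5 ⨾ v 3) hg.Φ <|
      .cons (f := v 0 ⊠ i 1 ⨾ v 5) (g := v 4 ⨾ v 2) hf.Φ <| .nil)
      [⟨0, false, 0, [0]⟩, ⟨1, false, 0, []⟩] [] (by decide +kernel)

/-- The copy that acts on the left factor passes through `g` first, so the condition on the crossing
is needed for `g` besides both conditions on the action. -/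
theorem Natural.tensor {f f' g g' : Mor} {l p l' p' : List ℕ} (hf : A.Natural f f' l l')
    (hg : A.Natural g g' p p') : A.Natural (f.tensor g) (f'.tensor g') (l ++ p) (l' ++ p') where
  typed := by
    rw [List.length_append, List.length_append]
    exact ⟨congrArg₂ (· + ·) hf.typed.1 hg.typed.1, congrArg₂ (· + ·) hf.typed.2 hg.typed.2⟩
  typed' := by
    rw [List.length_append, List.length_append]
    exact ⟨congrArg₂ (· + ·) hf.typed'.1 hg.typed'.1, congrArg₂ (· + ·) hf.typed'.2 hg.typed'.2⟩
  G := by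
    rw [G_append, G_append]
    exact
      den_eq_of_check (σ := [([1], [3]), ([2], [4]), ([1, 0], [0, 1]), ([2, 0], [0, 2]), ([3, 0], [0, 3]), ([4, 0], [0, 4])])
        (f := (v 0 ⊠ v 1) ⊠ i 1 ⨾ E.id [3] ⊠ v 5 ⨾ v 4 ⊠ E.id [4])
        (g := (E.id [1] ⊠ v 3 ⨾ v 2 ⊠ E.id [2]) ⨾ i 1 ⊠ v 0 ⊠ v 1)
        (.of [l.length, p.length, l'.length, p'.length] [f, g, A.G l, A.G p, A.G l', A.G p']
        (.cons hf.typed <| .cons hg.typed <| .cons (A.G_typed l) <| .cons (A.G_typed p) <| .cons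
          (A.G_typed l') <| .cons (A.G_typed p') .nil))
        (.cons (f := v 1 ⊠ i 1 ⨾ v 5) (g := v 3 ⨾ i 1 ⊠ v 1) hg.G <|
        .cons (f := v 0 ⊠ i 1 ⨾ v 4) (g := v 2 ⨾ i 1 ⊠ v 0) hf.G <| .nil) [⟨0, false, 1, []⟩]
        [⟨1, true, 0, [0]⟩] (by decide +kernel)
  Φ := by
    rw [Φ_append, Φ_append]
    exact
      den_eq_of_check (σ := [([1], [3]), ([2], [4]), ([1], [3]), ([2], [4]), ([2, 0], [0, 2]), ([4, 0], [0, 4]), ([1, 0], [1]), ([2, 0], [2]), ([3, 0], [3]), ([4, 0], [4])])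
        (f := (v 0 ⊠ v 1) ⊠ i 1 ⨾ E.id [3] ⊠ E.id [4] ⊠ D ⨾ E.id [3] ⊠ v 5 ⊠ i 1 ⨾ v 8 ⊠ v 9)
        (g := (E.id [1] ⊠ E.id [2] ⊠ D ⨾ E.id [1] ⊠ v 4 ⊠ i 1 ⨾ v 6 ⊠ v 7) ⨾ v 2 ⊠ v 3)
        (.of [l.length, p.length, l'.length, p'.length] [f, g, f', g', A.G p, A.G p', A.Φ l, A.Φ
          p, A.Φ l', A.Φ p']
        (.cons hf.typed <| .cons hg.typed <| .cons hf.typed' <| .cons hg.typed' <| .cons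
          (A.G_typed p) <| .cons (A.G_typed p') <| .cons (A.Φ_typed l) <| .cons (A.Φ_typed p) <|
          .cons (A.Φ_typed l') <| .cons (A.Φ_typed p') .nil))
        (.cons (f := v 1 ⊠ i 1 ⨾ v 5) (g := v 4 ⨾ i 1 ⊠ v 1) hg.G <|
        .cons (f := v 0 ⊠ i 1 ⨾ v 8) (g := v 6 ⨾ v 2) hf.Φ <|
        .cons (f := v 1 ⊠ i 1 ⨾ v 9) (g := v 7 ⨾ v 3) hg.Φ <| .nil)
        [⟨0, false, 1, [2]⟩, ⟨1, false, 0, [0, 1]⟩] [⟨2, true, 2, [0, 1]⟩] (by decide +kernel)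

/-- The inverse of a natural family is natural. -/
theorem Natural.inv {f f' g g' : Mor} {l p : List ℕ} (hf : A.Natural f f' l p)
    (hg : g.dom = p.length ∧ g.cod = l.length) (hg' : g'.dom = p.length ∧ g'.cod = l.length)
    (h₁ : f.comp g = .id l.length) (h₂ : g.comp f = .id p.length)
    (h₃ : f'.comp g' = .id l.length) : A.Natural g g' p l where
  typed := hg
  typed' := hg'
  G :=
    den_eq_of_check (σ := [([1], [2]), ([2], [1]), ([1, 0], [0, 1]), ([2, 0], [0, 2])])
      (f := v 1 ⊠ i 1 ⨾ v 2) (g := v 3 ⨾ i 1 ⊠ v 1) (.of [l.length, p.length] [f, g, A.G l, A.G p]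
      (.cons hf.typed <| .cons hg <| .cons (A.G_typed l) <| .cons (A.G_typed p) .nil))
      (.cons (f := v 0 ⨾ v 1) (g := E.id [1]) h₁ <|
      .cons (f := v 0 ⊠ i 1 ⨾ v 3) (g := v 2 ⨾ i 1 ⊠ v 0) hf.G <|
      .cons (f := v 1 ⨾ v 0) (g := E.id [2]) h₂ <| .nil)
      [⟨0, true, 1, [0, 1]⟩, ⟨1, true, 0, [0]⟩, ⟨2, false, 0, []⟩] [] (by decide +kernel)
  Φ :=
    den_eq_of_check (σ := [([1], [2]), ([2], [1]), ([1], [2]), ([2], [1]), ([1, 0], [1]), ([2, 0], [2])])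
      (f := v 1 ⊠ i 1 ⨾ v 4) (g := v 5 ⨾ v 3)
      (.of [l.length, p.length] [f, g, f', g', A.Φ l, A.Φ p]
      (.cons hf.typed <| .cons hg <| .cons hf.typed' <| .cons hg' <| .cons (A.Φ_typed l) <| .cons
        (A.Φ_typed p) .nil)) (.cons (f := v 2 ⨾ v 3) (g := E.id [1]) h₃ <|
      .cons (f := v 0 ⊠ i 1 ⨾ v 5) (g := v 4 ⨾ v 2) hf.Φ <|
      .cons (f := v 1 ⨾ v 0) (g := E.id [2]) h₂ <| .nil)
      [⟨0, true, 0, [0, 1]⟩, ⟨1, true, 0, [0]⟩, ⟨2, false, 0, []⟩] [] (by decide +kernel)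

/-! ## The action of the first factor -/

end Slide

theorem tm_br_one_succ (n : ℕ) : Mor.tm (br 1 (n + 1)) =
    ((Mor.tm (br 1 n)).tensor (.id 1)).comp ((Mor.id n).tensor (.tm (br 1 1))) :=
  Mor.tm_br_add_right 1 n 1

theorem tm_thetaLeft_succ (n : ℕ) : Mor.tm (thetaLeft (n + 1)) =
    ((Mor.tm Delta).tensor ((Mor.id n).tensor (.id 1))).comp
      (((Mor.id 1).tensor ((Mor.tm (br 1 n)).tensor (.id 1))).comp
        ((Mor.tm (thetaLeft n)).tensor (.tm mu))) := by
  rw [thetaLeft]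
  simp only [Mor.tm_comp, Mor.tm_tensor, Mor.tm_ofEq, Mor.tm_id]
  rw [Mor.id_comp, Mor.id_comp, Mor.id_tensor_id]
  · change _ = 1 + n + 2
    omega
  · rw [Mor.comp_dom]
    change _ = 1 + (1 + n + 1)
    omega

theorem tm_U (n : ℕ) : Mor.tm (U n) =
    ((Mor.tm Lam).tensor (.id n)).comp (.tm (thetaLeft n)) := by
  rw [U, Mor.tm_comp, Mor.tm_comp, Mor.tm_ofEq, Mor.tm_tensor, Mor.id_comp]
  · rfl
  · rw [Mor.comp_dom]; exact (zero_add n).symm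

namespace Slide

variable (A : Slide)

/-- The induction runs from the right end of the word, as `Θ'` splits off the last factor; there
`g_mul` applies, and the rest is naturality of the braiding. -/
theorem thetaLeft_G (l : List ℕ) :
    ((Mor.tm (thetaLeft l.length)).tensor (.id 1)).comp (A.G l) =
      ((Mor.id 1).tensor (A.G l)).comp (((Mor.tm (br 1 1)).tensor (.id l.length)).comp
        ((Mor.id 1).tensor (.tm (thetaLeft l.length)))) := by
  induction l using List.reverseRecOn with
  | nil =>
    exact
      den_eq_of_check (σ := []) (f := e ⊠ i 1 ⨾ i 1) (g := i 1 ⊠ i 1 ⨾ c ⊠ E.id [] ⨾ i 1 ⊠ e)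
        (.of [] [] (.nil)) (.cons (cl_nat .e |>.den _) <| .nil) [⟨0, false, 0, []⟩] []
        (by decide +kernel)
  | append_singleton l a ih =>
    -- Naturality of the braiding with respect to `A.G l`, with the braidings over `l.length + 1`
    -- strands split by the hexagon.
    have hB : ((Mor.id 1).tensor (A.G l)).comp (((Mor.tm (br 1 1)).tensor (.id l.length)).comp
        ((Mor.id 1).tensor (.tm (br 1 l.length)))) =
          ((Mor.tm (br 1 l.length)).tensor (.id 1)).comp
            (((Mor.id l.length).tensor (.tm (br 1 1))).comp ((A.G l).tensor (.id 1))) := by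
      have h := Mor.tm_br_natural (f := .id 1) (a := 1) (b := 1) rfl rfl (A.G_typed l).1
        (A.G_typed l).2
      rw [Mor.tm_br_add_right 1 1, tm_br_one_succ l.length, Mor.comp_assoc] at h
      · exact h
      · rfl
      · change l.length + 2 = (A.G l).dom + 1
        rw [(A.G_typed l).1]
    rw [G_append, G_singleton, List.length_append, List.length_singleton, tm_thetaLeft_succ,
      ← Mor.id_tensor_id]
    exact
      den_eq_of_check (σ := [([0, 0], [0, 0]), ([1, 0], [0, 1]), ([0, 1], [1, 0]), ([0, 1], [1])])
        (f := (D ⊠ E.id [1] ⊠ i 1 ⨾ i 1 ⊠ v 2 ⊠ i 1 ⨾ v 3 ⊠ m) ⊠ i 1 ⨾ E.id [1] ⊠ v 0 ⨾ v 1 ⊠ i 1)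
        (g := i 1 ⊠ (E.id [1] ⊠ v 0 ⨾ v 1 ⊠ i 1) ⨾ c ⊠ E.id [1] ⊠ i 1 ⨾ i 1 ⊠ (D ⊠ E.id [1] ⊠ i 1
          ⨾ i 1 ⊠ v 2 ⊠ i 1 ⨾ v 3 ⊠ m))
        (.of [l.length] [A.g a, A.G l, .tm (br 1 l.length), .tm (thetaLeft l.length)]
        (.cons (A.g_typed a) <| .cons (A.G_typed l) <| .cons ⟨rfl, rfl⟩ <| .cons ⟨rfl, rfl⟩ .nil))
        (.cons (f := v 3 ⊠ i 1 ⨾ v 1) (g := i 1 ⊠ v 1 ⨾ c ⊠ E.id [1] ⨾ i 1 ⊠ v 3) ih <|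
        .cons (cl_nat .D |>.den _) <|
        .cons (f := i 1 ⊠ v 1 ⨾ c ⊠ E.id [1] ⨾ i 1 ⊠ v 2) (g := v 2 ⊠ i 1 ⨾ E.id [1] ⊠ c ⨾ v 1 ⊠ i
          1) hB <| .cons (f := m ⊠ i 1 ⨾ v 0) (g := i 1 ⊠ v 0 ⨾ c ⊠ i 1 ⨾ i 1 ⊠ m) (A.g_mul a) <|
        .nil) [⟨0, false, 0, [0, 1, 3, 4]⟩]
        [⟨1, true, 0, [0, 1]⟩, ⟨2, false, 1, [0, 2]⟩, ⟨3, true, 2, [1, 2]⟩] (by decide +kernel)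

/-- Left multiplication by copies of the first factor commutes with the action from the right,
letter by letter by `θ_mul`. -/
theorem thetaLeft_Φ (l : List ℕ) :
    ((Mor.tm (thetaLeft l.length)).tensor (.id 1)).comp (A.Φ l) =
      ((Mor.id 1).tensor (A.Φ l)).comp (.tm (thetaLeft l.length)) := by
  induction l using List.reverseRecOn with
  | nil =>
    exact
      den_eq_of_check (σ := []) (f := e ⊠ i 1 ⨾ e) (g := i 1 ⊠ e ⨾ e) (.of [] [] (.nil)) .nil []
        [] (by decide +kernel)
  | append_singleton l a ih =>
    have hB : ((Mor.id 1).tensor (A.Φ l)).comp (.tm (br 1 l.length)) =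
          ((Mor.tm (br 1 l.length)).tensor (.id 1)).comp
            (((Mor.id l.length).tensor (.tm (br 1 1))).comp ((A.Φ l).tensor (.id 1))) := by
      have h := Mor.tm_br_natural (f := .id 1) (a := 1) (b := 1) rfl rfl (A.Φ_typed l).1
        (A.Φ_typed l).2
      rw [tm_br_one_succ l.length, Mor.comp_assoc] at h
      · exact h
      · rfl
      · change l.length + 2 = (A.Φ l).dom + 1
        rw [(A.Φ_typed l).1]
    rw [Φ_append, Φ_singleton, G_singleton, List.length_append, List.length_singleton,
      tm_thetaLeft_succ]
    exact
      den_eq_of_check (σ := [([0, 0], [0, 0]), ([0, 0], [0]), ([1, 0], [1]), ([0, 1], [1, 0]), ([0, 1], [1])])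
        (f := (D ⊠ E.id [1] ⊠ i 1 ⨾ i 1 ⊠ v 3 ⊠ i 1 ⨾ v 4 ⊠ m) ⊠ i 1 ⨾ E.id [1] ⊠ i 1 ⊠ D ⨾ E.id
          [1] ⊠ v 0 ⊠ i 1 ⨾ v 2 ⊠ v 1)
        (g := i 1 ⊠ (E.id [1] ⊠ i 1 ⊠ D ⨾ E.id [1] ⊠ v 0 ⊠ i 1 ⨾ v 2 ⊠ v 1) ⨾ D ⊠ E.id [1] ⊠ i 1 ⨾
          i 1 ⊠ v 3 ⊠ i 1 ⨾ v 4 ⊠ m)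
        (.of [l.length] [A.g a, A.θ a, A.Φ l, .tm (br 1 l.length), .tm (thetaLeft l.length)]
        (.cons (A.g_typed a) <| .cons (A.θ_typed a) <| .cons (A.Φ_typed l) <| .cons ⟨rfl, rfl⟩ <|
          .cons ⟨rfl, rfl⟩ .nil)) (.cons (f := v 4 ⊠ i 1 ⨾ v 2) (g := i 1 ⊠ v 2 ⨾ v 4) ih <|
        .cons (f := m ⊠ i 1 ⨾ v 0) (g := i 1 ⊠ v 0 ⨾ c ⊠ i 1 ⨾ i 1 ⊠ m) (A.g_mul a) <|
        .cons (f := i 1 ⊠ v 2 ⨾ v 3) (g := v 3 ⊠ i 1 ⨾ E.id [1] ⊠ c ⨾ v 2 ⊠ i 1) hB <|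
        .cons (f := m ⊠ i 1 ⨾ v 1) (g := i 1 ⊠ v 1 ⨾ m) (A.θ_mul a) <| .nil)
        [⟨0, false, 0, [0, 1, 3, 4, 5]⟩, ⟨1, false, 2, [0, 1, 3]⟩, ⟨2, true, 1, [0, 2, 3]⟩]
        [⟨3, true, 2, [0, 1, 2, 4, 5]⟩] (by decide +kernel)

theorem Natural.U (l : List ℕ) : A.Natural (.tm (U l.length)) (.tm (U l.length)) l l where
  typed := ⟨rfl, rfl⟩
  typed' := ⟨rfl, rfl⟩
  G := by
    rw [tm_U]
    exact
      den_eq_of_check (σ := [([1, 0], [0, 1]), ([0, 1], [1])])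
        (f := (L ⊠ E.id [1] ⨾ v 1) ⊠ i 1 ⨾ v 0) (g := v 0 ⨾ i 1 ⊠ (L ⊠ E.id [1] ⨾ v 1))
        (.of [l.length] [A.G l, .tm (thetaLeft l.length)]
        (.cons (A.G_typed l) <| .cons ⟨rfl, rfl⟩ .nil))
        (.cons (f := v 1 ⊠ i 1 ⨾ v 0) (g := i 1 ⊠ v 0 ⨾ c ⊠ E.id [1] ⨾ i 1 ⊠ v 1) (A.thetaLeft_G
          l) <| .cons (cl_nat .L |>.den _) <| .nil) [⟨0, false, 0, [0]⟩, ⟨1, false, 0, [1]⟩] []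
        (by decide +kernel)
  Φ := by
    rw [tm_U]
    exact
      den_eq_of_check (σ := [([1, 0], [1]), ([0, 1], [1])])
        (f := (L ⊠ E.id [1] ⨾ v 1) ⊠ i 1 ⨾ v 0) (g := v 0 ⨾ L ⊠ E.id [1] ⨾ v 1)
        (.of [l.length] [A.Φ l, .tm (thetaLeft l.length)]
        (.cons (A.Φ_typed l) <| .cons ⟨rfl, rfl⟩ .nil))
        (.cons (f := v 1 ⊠ i 1 ⨾ v 0) (g := i 1 ⊠ v 0 ⨾ v 1) (A.thetaLeft_Φ l) <| .nil)
        [⟨0, false, 0, [0]⟩] [] (by decide +kernel)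

end Slide

end BPHopf

namespace BPHopf

open StrictPres

local infixr:60 " ⨾ " => E.comp
local infixr:70 " ⊠ " => E.tensor

open E

/-! ## The families of the exchange of labels -/

/-- The diagram of `gammaHatOne k a`. -/
def crossing (k a : ℕ) : E := if a ≤ k then c else if a = k + 1 then E.X else Xh

/-- The diagram of `thetaHatOne k a`. -/
def action (k a : ℕ) : E := if a = k then m else i 1 ⊠ e

theorem tm_gammaHatOne (k a : ℕ) : Mor.tm (gammaHatOne k a) = (crossing k a).den thinEnv := by
  unfold gammaHatOne crossing
  split_ifs <;> rfl

theorem tm_thetaHatOne (k a : ℕ) : Mor.tm (thetaHatOne k a) = (action k a).den thinEnv := by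
  unfold thetaHatOne action
  split_ifs <;> rfl

/-- The families `γ̂` and `Θ̂` for the label `k`. -/
def slide (k : ℕ) : Slide where
  g a := (crossing k a).den thinEnv
  θ a := (action k a).den thinEnv
  g_typed a := by
    unfold crossing
    split_ifs <;> exact ⟨rfl, rfl⟩
  θ_typed a := by
    unfold action
    split_ifs <;> exact ⟨rfl, rfl⟩
  g_comul a := by
    unfold crossing
    split_ifs
    exacts [c_comul, X_comul, XHat_comul]
  g_counit a := by
    unfold crossing
    split_ifs
    exacts [c_counit, X_counit, XHat_counit]
  g_mul a := by
    unfold crossing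
    split_ifs
    exacts [mul_c, mul_X, mul_XHat]
  θ_mul a := by
    unfold action
    split_ifs
    exacts [mul_assoc, mul_id_counit]

variable {k : ℕ}

theorem slide_G_singleton (a : ℕ) : (slide k).G [a] = (crossing k a).den thinEnv :=
  (slide k).G_singleton a

theorem slide_Φ_singleton (a : ℕ) : (slide k).Φ [a] = (action k a).den thinEnv :=
  (slide k).Φ_singleton a

theorem slide_G_pair (a b : ℕ) : (slide k).G [a, b] =
    (i 1 ⊠ crossing k b ⨾ crossing k a ⊠ i 1).den thinEnv :=
  (slide k).G_pair a b

theorem slide_Φ_pair (a b : ℕ) : (slide k).Φ [a, b] =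
    (i 2 ⊠ D ⨾ i 1 ⊠ crossing k b ⊠ i 1 ⨾ action k a ⊠ action k b).den thinEnv :=
  (slide k).Φ_pair a b

/-- No letter keeps its copy of the strand, and a discarded strand leaves no trace of its crossings.
-/
theorem slide_Φ_of_notMem : ∀ {l : List ℕ}, k ∉ l →
    (slide k).Φ l = (Mor.id l.length).tensor (.tm eps)
  | [], _ => (Mor.id_zero_tensor _).symm
  | a :: l, h => by
    have h₁ : (slide k).θ a = (i 1 ⊠ e).den thinEnv :=
      congrArg (E.den thinEnv) (if_neg fun h' => h (List.mem_cons.mpr (.inl h'.symm)))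
    have h₂ := slide_Φ_of_notMem fun h' => h (List.mem_cons_of_mem a h')
    rw [Slide.Φ, h₁, h₂, List.length_cons, add_comm, ← Mor.id_tensor_id]
    exact
      den_eq_of_check (σ := [([1, 0], [0, 1])])
        (f := i 1 ⊠ E.id [1] ⊠ D ⨾ i 1 ⊠ v 0 ⊠ i 1 ⨾ (i 1 ⊠ e) ⊠ E.id [1] ⊠ e)
        (g := (i 1 ⊠ E.id [1]) ⊠ e) (.of [l.length] [(slide k).G l]
        (.cons ((slide k).G_typed l) .nil))
        (.cons (f := v 0 ⨾ e ⊠ E.id [1]) (g := E.id [1] ⊠ e) ((slide k).G_counit l) <|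
        .cons (counit_comul.den _) <| .nil) [⟨0, false, 1, [0]⟩, ⟨1, false, 2, []⟩] []
        (by decide +kernel)

/-- Morphisms between words that do not contain `k`. -/
theorem natural_of_notMem {F : Mor} {l l' : List ℕ} (hl : k ∉ l) (hl' : k ∉ l')
    (h : F.dom = l.length ∧ F.cod = l'.length)
    (hG : (F.tensor (.id 1)).comp ((slide k).G l') = ((slide k).G l).comp ((Mor.id 1).tensor F)) :
    (slide k).Natural F F l l' where
  typed := h
  typed' := h
  G := hG
  Φ := by
    rw [slide_Φ_of_notMem hl, slide_Φ_of_notMem hl']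
    exact
      den_eq_of_check (σ := [([1], [2])]) (f := v 0 ⊠ i 1 ⨾ E.id [2] ⊠ e)
        (g := E.id [1] ⊠ e ⨾ v 0) (.of [l.length, l'.length] [F] (.cons h .nil)) .nil [] []
        (by decide +kernel)

/-- Morphisms between words of at most two letters, all equal to `a`. -/
theorem natural_of_label {f : E} {l l' : List ℕ} (a : ℕ) (hl : ∀ b ∈ l, b = a ∨ b = 0)
    (hl' : ∀ b ∈ l', b = a ∨ b = 0) (hk : 1 ≤ k)
    (h : (f.den thinEnv).dom = l.length ∧ (f.den thinEnv).cod = l'.length)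
    (hG : ((f ⊠ i 1).den thinEnv).comp ((slide k).G l') =
      ((slide k).G l).comp ((i 1 ⊠ f).den thinEnv))
    (hΦ : a = k → ((f ⊠ i 1).den thinEnv).comp ((slide k).Φ l') =
      ((slide k).Φ l).comp (f.den thinEnv)) :
    (slide k).Natural (f.den thinEnv) (f.den thinEnv) l l' := by
  by_cases ha : a = k
  · exact ⟨h, h, hG, hΦ ha⟩
  -- The letters are `a` or `0`, and `k` is neither, being positive and different from `a`.
  · refine natural_of_notMem ?_ ?_ h hG <;> intro hm
    · rcases hl k hm with h | h <;> omega
    · rcases hl' k hm with h | h <;> omega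

theorem crossing_of_le {a : ℕ} (h : a ≤ k) : crossing k a = c := if_pos h

theorem crossing_succ : crossing k (k + 1) = E.X := by
  rw [crossing, if_neg (by omega), if_pos rfl]

theorem crossing_of_lt {a : ℕ} (h : k + 1 < a) : crossing k a = Xh := by
  rw [crossing, if_neg (by omega), if_neg (by omega)]

theorem action_self : action k k = m := if_pos rfl

theorem action_of_ne {a : ℕ} (h : a ≠ k) : action k a = i 1 ⊠ e := if_neg h

namespace E

theorem natural_comul (hk : 1 ≤ k) (a : ℕ) :
    (slide k).Natural (D.den thinEnv) (D.den thinEnv) [a] [a, a] := by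
  refine natural_of_label a (by simp) (by simp) hk ⟨rfl, rfl⟩ ?_ ?_
  · rw [slide_G_singleton, slide_G_pair]
    change Holds (D ⊠ i 1 ⨾ (i 1 ⊠ crossing k a ⨾ crossing k a ⊠ i 1)) (crossing k a ⨾ i 1 ⊠ D)
    unfold crossing
    split_ifs
    exacts [c_pass_comul, X_pass_comul, XHat_pass_comul]
  · rintro rfl
    rw [slide_Φ_singleton, slide_Φ_pair, crossing_of_le le_rfl, action_self]
    exact mulRight_comul

theorem natural_counit (hk : 1 ≤ k) (a : ℕ) :
    (slide k).Natural (e.den thinEnv) (e.den thinEnv) [a] [] := by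
  refine natural_of_label a (by simp) (by simp) hk ⟨rfl, rfl⟩ ?_ ?_
  · rw [slide_G_singleton]
    change Holds (e ⊠ i 1 ⨾ i 1) (crossing k a ⨾ i 1 ⊠ e)
    unfold crossing
    split_ifs
    exacts [c_pass_counit, X_pass_counit, XHat_pass_counit]
  · rintro rfl
    rw [slide_Φ_singleton, action_self]
    exact mulRight_counit

theorem natural_element (hk : 1 ≤ k) (a : ℕ) :
    (slide k).Natural (L.den thinEnv) (L.den thinEnv) [] [a] := by
  refine natural_of_label a (by simp) (by simp) hk ⟨rfl, rfl⟩ ?_ ?_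
  · rw [slide_G_singleton]
    change Holds (L ⊠ i 1 ⨾ crossing k a) (i 1 ⨾ i 1 ⊠ L)
    unfold crossing
    split_ifs
    exacts [c_pass_element, X_pass_element, XHat_pass_element]
  · rintro rfl
    rw [slide_Φ_singleton, action_self]
    exact element_invariant

theorem natural_tau (hk : 1 ≤ k) (a : ℕ) :
    (slide k).Natural (t.den thinEnv) (t.den thinEnv) [a] [a] := by
  refine natural_of_label a (by simp) (by simp) hk ⟨rfl, rfl⟩ ?_ ?_
  · rw [slide_G_singleton]
    change Holds (t ⊠ i 1 ⨾ crossing k a) (crossing k a ⨾ i 1 ⊠ t)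
    unfold crossing
    split_ifs
    exacts [c_pass_tau, X_pass_tau, XHat_pass_tau]
  · rintro rfl
    rw [slide_Φ_singleton, action_self]
    exact tau_mul

theorem natural_ev (hk : 1 ≤ k) (a : ℕ) :
    (slide k).Natural ((i 1 ⊠ S ⨾ m ⨾ l).den thinEnv) ((i 1 ⊠ S ⨾ m ⨾ l).den thinEnv) [a, a] [] := by
  refine natural_of_label a (by simp) (by simp) hk ⟨rfl, rfl⟩ ?_ ?_
  · rw [slide_G_pair]
    change Holds ((i 1 ⊠ S ⨾ m ⨾ l) ⊠ i 1 ⨾ i 1) ((i 1 ⊠ crossing k a ⨾ crossing k a ⊠ i 1) ⨾ i 1 ⊠ (i 1 ⊠ S ⨾ m ⨾ l))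
    unfold crossing
    split_ifs
    exacts [c_pass_ev, X_pass_ev, XHat_pass_ev]
  · rintro rfl
    rw [slide_Φ_pair, crossing_of_le le_rfl, action_self]
    exact mulRight_ev

theorem natural_W (hk : 1 ≤ k) (a : ℕ) :
    (slide k).Natural ((i 1 ⊠ (L ⨾ D) ⨾ m ⊠ t).den thinEnv) ((i 1 ⊠ (L ⨾ D) ⨾ m ⊠ t).den thinEnv) [0] [a, a] := by
  refine natural_of_label a (by simp) (by simp) hk ⟨rfl, rfl⟩ ?_ ?_
  · rw [slide_G_singleton, crossing_of_le (Nat.zero_le k), slide_G_pair]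
    change Holds ((i 1 ⊠ (L ⨾ D) ⨾ m ⊠ t) ⊠ i 1 ⨾ (i 1 ⊠ crossing k a ⨾ crossing k a ⊠ i 1)) (c ⨾ i 1 ⊠ (i 1 ⊠ (L ⨾ D) ⨾ m ⊠ t))
    unfold crossing
    split_ifs
    exacts [c_pass_W, X_pass_W, XHat_pass_W]
  · rintro rfl
    rw [slide_Φ_singleton, action_of_ne (Nat.one_le_iff_ne_zero.mp hk).symm, slide_Φ_pair, crossing_of_le le_rfl, action_self]
    exact mulRight_W

theorem natural_WBar (hk : 1 ≤ k) (a : ℕ) :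
    (slide k).Natural ((T ⊠ S ⨾ m).den thinEnv) ((T ⊠ S ⨾ m).den thinEnv) [a, a] [0] := by
  refine natural_of_label a (by simp) (by simp) hk ⟨rfl, rfl⟩ ?_ ?_
  · rw [slide_G_pair, slide_G_singleton, crossing_of_le (Nat.zero_le k)]
    change Holds ((T ⊠ S ⨾ m) ⊠ i 1 ⨾ c) ((i 1 ⊠ crossing k a ⨾ crossing k a ⊠ i 1) ⨾ i 1 ⊠ (T ⊠ S ⨾ m))
    unfold crossing
    split_ifs
    exacts [c_pass_WBar, X_pass_WBar, XHat_pass_WBar]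
  · rintro rfl
    rw [slide_Φ_pair, crossing_of_le le_rfl, slide_Φ_singleton, action_of_ne (Nat.one_le_iff_ne_zero.mp hk).symm, action_self]
    exact mulRight_WBar

/-- With both letters `k` this is equivariance of `X`. With exactly one it is one of the relations
for a single multiplication, and only `mulFst_X_X` changes the crossing. -/
theorem natural_X (hk : 1 ≤ k) {a b : ℕ} (hab : a ≤ b) :
    (slide k).Natural (E.X.den thinEnv)
      ((if a = k ∧ b = k + 1 then Xh else E.X).den thinEnv) [a, b] [b, a] := by
  have hG : ((E.X ⊠ i 1).den thinEnv).comp ((slide k).G [b, a]) =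
      ((slide k).G [a, b]).comp ((i 1 ⊠ E.X).den thinEnv) := by
    rw [slide_G_pair, slide_G_pair]
    change Holds (E.X ⊠ i 1 ⨾ i 1 ⊠ crossing k a ⨾ crossing k b ⊠ i 1)
      ((i 1 ⊠ crossing k b ⨾ crossing k a ⊠ i 1) ⨾ i 1 ⊠ E.X)
    unfold crossing
    split_ifs
    -- As `a ≤ b`, only six of the nine pairs of crossings occur; `omega` discards the others.
    all_goals first
      | omega
      | exact cl_nat .X
      | exact X_c_X
      | exact X_c_XHat
      | exact X_X_X
      | exact X_X_XHat
      | exact X_XHat_XHat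
  by_cases h : a ≠ k ∧ b ≠ k
  · rw [if_neg fun h' => h.1 h'.1]
    exact natural_of_notMem (by simp [h.1.symm, h.2.symm]) (by simp [h.1.symm, h.2.symm])
      ⟨rfl, rfl⟩ hG
  refine ⟨⟨rfl, rfl⟩, by split_ifs <;> exact ⟨rfl, rfl⟩, hG, ?_⟩
  rw [slide_Φ_pair, slide_Φ_pair]
  by_cases ha : a = k
  · subst ha
    rcases hab.eq_or_lt with rfl | hb
    · rw [if_neg (by omega), crossing_of_le le_rfl, action_self]
      exact mulRight_X
    · rw [crossing_of_le le_rfl, action_self, action_of_ne hb.ne']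
      rcases (Nat.succ_le_of_lt hb).eq_or_lt with rfl | hb
      · rw [if_pos ⟨rfl, rfl⟩, crossing_succ]
        exact mulFst_X_X
      · rw [if_neg (by omega), crossing_of_lt hb]
        exact mulFst_XHat_X
  · obtain rfl : b = k := by tauto
    rw [if_neg fun h' => ha h'.1, crossing_of_le hab, crossing_of_le le_rfl, action_self,
      action_of_ne ha]
    exact mulSnd_X

theorem natural_XHat (hk : 1 ≤ k) {a b : ℕ} (hab : b ≤ a) :
    (slide k).Natural (Xh.den thinEnv)
      ((if b = k ∧ a = k + 1 then E.X else Xh).den thinEnv) [a, b] [b, a] := by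
  have hG : ((Xh ⊠ i 1).den thinEnv).comp ((slide k).G [b, a]) =
      ((slide k).G [a, b]).comp ((i 1 ⊠ Xh).den thinEnv) := by
    rw [slide_G_pair, slide_G_pair]
    change Holds (Xh ⊠ i 1 ⨾ i 1 ⊠ crossing k a ⨾ crossing k b ⊠ i 1)
      ((i 1 ⊠ crossing k b ⨾ crossing k a ⊠ i 1) ⨾ i 1 ⊠ Xh)
    unfold crossing
    split_ifs
    all_goals first
      | omega
      | exact cl_nat .Xh
      | exact XHat_X_c
      | exact XHat_XHat_c
      | exact XHat_X_X
      | exact XHat_XHat_X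
      | exact XHat_XHat_XHat
  by_cases h : a ≠ k ∧ b ≠ k
  · rw [if_neg fun h' => h.2 h'.1]
    exact natural_of_notMem (by simp [h.1.symm, h.2.symm]) (by simp [h.1.symm, h.2.symm])
      ⟨rfl, rfl⟩ hG
  refine ⟨⟨rfl, rfl⟩, by split_ifs <;> exact ⟨rfl, rfl⟩, hG, ?_⟩
  rw [slide_Φ_pair, slide_Φ_pair]
  by_cases hb : b = k
  · subst hb
    rcases hab.eq_or_lt with rfl | ha
    · rw [if_neg (by omega), crossing_of_le le_rfl, action_self]
      exact mulRight_XHat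
    · rw [crossing_of_le le_rfl, action_self, action_of_ne ha.ne']
      rcases (Nat.succ_le_of_lt ha).eq_or_lt with rfl | ha
      · rw [if_pos ⟨rfl, rfl⟩, crossing_succ]
        exact mulSnd_X_XHat
      · rw [if_neg (by omega), crossing_of_lt ha]
        exact mulSnd_XHat_XHat
  · obtain rfl : a = k := by tauto
    rw [if_neg fun h' => hb h'.1, crossing_of_le hab, crossing_of_le le_rfl, action_self,
      action_of_ne hb]
    exact mulFst_c_XHat

theorem natural_Y (hk : 1 ≤ k) {a b : ℕ} (hab : b ≤ a) :
    (slide k).Natural (E.Y.den thinEnv)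
      ((if b = k ∧ a = k + 1 then Yh else E.Y).den thinEnv) [a, b] [b, a] := by
  -- The family for `X` is taken in the opposite direction, from `[b, a]` to `[a, b]`; its image
  -- under the exchange is inverted too.
  refine (natural_X hk hab).inv ⟨rfl, rfl⟩ (by split_ifs <;> exact ⟨rfl, rfl⟩)
    X_Y Y_X ?_
  split_ifs
  exacts [XHat_YHat, X_Y]

theorem natural_YHat (hk : 1 ≤ k) {a b : ℕ} (hab : a ≤ b) :
    (slide k).Natural (Yh.den thinEnv)
      ((if a = k ∧ b = k + 1 then E.Y else Yh).den thinEnv) [a, b] [b, a] := by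
  refine (natural_XHat hk hab).inv ⟨rfl, rfl⟩ (by split_ifs <;> exact ⟨rfl, rfl⟩)
    XHat_YHat YHat_XHat ?_
  split_ifs
  exacts [X_Y, XHat_YHat]

end E

end BPHopf

namespace BPHopf

open StrictPres

local infixr:60 " ⨾ " => E.comp
local infixr:70 " ⊠ " => E.tensor

open E

/-! ## The inverse of `Ω` -/

/-- The diagram of `thetaCheckOne k a`. -/
def actionInv (k a : ℕ) : E := if a = k then i 1 ⊠ E.S ⨾ m else i 1 ⊠ e

theorem tm_thetaCheckOne (k a : ℕ) :
    Mor.tm (thetaCheckOne k a) = (actionInv k a).den thinEnv := by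
  unfold thetaCheckOne actionInv
  split_ifs
  · rw [Mor.tm_comp, Mor.tm_tensor]
    rfl
  · rfl

theorem actionInv_typed (k a : ℕ) :
    ((actionInv k a).den thinEnv).dom = 2 ∧ ((actionInv k a).den thinEnv).cod = 1 := by
  unfold actionInv
  split_ifs <;> exact ⟨rfl, rfl⟩

theorem action_actionInv (k a : ℕ) :
    Holds (i 1 ⊠ D ⨾ action k a ⊠ i 1 ⨾ actionInv k a) (i 1 ⊠ e) := by
  unfold action actionInv
  split_ifs
  exacts [mul_divInv, counit_counit]

theorem actionInv_action (k a : ℕ) :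
    Holds (i 1 ⊠ D ⨾ actionInv k a ⊠ i 1 ⨾ action k a) (i 1 ⊠ e) := by
  unfold action actionInv
  split_ifs
  exacts [divInv_mul, counit_counit]

/-- The family `Θ̌` for the label `k`. -/
def checkΦ (k : ℕ) : List ℕ → Mor
  | [] => .tm eps
  | a :: l => ((Mor.id 1).tensor ((Mor.id l.length).tensor (.tm Delta))).comp
      (((Mor.id 1).tensor ((checkΦ k l).tensor (.id 1))).comp
        (((Mor.id 1).tensor ((slide k).G l)).comp
          (((actionInv k a).den thinEnv).tensor (.id l.length))))

variable (k : ℕ)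

theorem checkΦ_typed : ∀ l : List ℕ, (checkΦ k l).dom = l.length + 1 ∧
    (checkΦ k l).cod = l.length
  | [] => ⟨rfl, rfl⟩
  | a :: l => by
    have h : _ = 1 + (l.length + 1) ∧ _ = 1 + l.length :=
      den_typed (σ := [([0, 0], [0]), ([1, 0], [0, 1]), ([1, 0], [1])])
        (.of [l.length] [(actionInv k a).den thinEnv, (slide k).G l, checkΦ k l]
          (.cons (actionInv_typed k a) (.cons ((slide k).G_typed l) (.cons (checkΦ_typed l) .nil))))
        (i 1 ⊠ E.id [1] ⊠ D ⨾ i 1 ⊠ v 2 ⊠ i 1 ⨾ i 1 ⊠ v 1 ⨾ v 0 ⊠ E.id [1]) (by decide)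
    exact ⟨h.1.trans (add_comm _ _), h.2.trans (add_comm _ _)⟩

theorem tm_I_succ (n : ℕ) : Mor.tm (I (n + 1)) = (Mor.id 1).tensor (.id n) := by
  rw [Mor.id_tensor_id, add_comm]
  rfl

/-- In `Mor` the transports along equalities of objects are identities, so the formal recursion and
`Slide.G` coincide. Only the arithmetic of lengths is left. -/
theorem tm_gammaHat : ∀ l : List ℕ, Mor.tm (gammaHat k l) = (slide k).G l
  | [] => rfl
  | a :: l => by
    simp only [gammaHat, Mor.tm_comp, Mor.tm_tensor, Mor.tm_ofEq, Mor.tm_id, tm_gammaHat l,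
      tm_gammaHatOne]
    rw [Mor.comp_id, Mor.id_comp, Mor.id_comp]
    · rfl
    · change _ = ((slide k).g a).dom + l.length
      rw [((slide k).g_typed a).1]
      omega
    · rw [Mor.comp_dom]
      change l.length + 1 + 1 = 1 + ((slide k).G l).dom
      rw [((slide k).G_typed l).1]
      omega
    · change ((slide k).g a).cod + l.length = _
      rw [((slide k).g_typed a).2]

theorem tm_thetaHat : ∀ l : List ℕ, Mor.tm (thetaHat k l) = (slide k).Φ l
  | [] => rfl
  | a :: l => by
    simp only [thetaHat, Mor.tm_comp, Mor.tm_tensor, Mor.tm_ofEq, Mor.tm_id, tm_gammaHat,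
      tm_thetaHat l, tm_thetaHatOne]
    rw [Mor.comp_id, Mor.id_comp, Mor.id_comp, tm_I_succ, Mor.tensor_assoc]
    · rfl
    · change _ = ((slide k).θ a).dom + ((slide k).Φ l).dom
      rw [((slide k).θ_typed a).1, ((slide k).Φ_typed l).1]
      omega
    · rw [Mor.comp_dom]
      change l.length + 1 + 2 = 1 + (((slide k).G l).dom + 1)
      rw [((slide k).G_typed l).1]
      omega
    · change ((slide k).θ a).cod + ((slide k).Φ l).cod = _
      rw [((slide k).θ_typed a).2, ((slide k).Φ_typed l).2]

theorem tm_thetaCheck : ∀ l : List ℕ, Mor.tm (thetaCheck k l) = checkΦ k l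
  | [] => rfl
  | a :: l => by
    simp only [thetaCheck, Mor.tm_comp, Mor.tm_tensor, Mor.tm_ofEq, Mor.tm_id, tm_gammaHat,
      tm_thetaCheck l, tm_thetaCheckOne]
    rw [Mor.comp_id, Mor.id_comp, Mor.id_comp, tm_I_succ, Mor.tensor_assoc]
    · rfl
    · change _ = ((actionInv k a).den thinEnv).dom + l.length
      rw [(actionInv_typed k a).1]
      omega
    · rw [Mor.comp_dom]
      change l.length + 1 + 2 = 1 + ((checkΦ k l).dom + 1)
      rw [(checkΦ_typed k l).1]
      omega
    · change ((actionInv k a).den thinEnv).cod + l.length = _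
      rw [(actionInv_typed k a).2]

theorem tm_omega (l : List ℕ) : Mor.tm (omega k l) =
    ((Mor.id l.length).tensor (.tm eta)).comp ((slide k).Φ l) := by
  rw [omega, Mor.tm_comp, Mor.tm_tensor, tm_thetaHat]
  rfl

theorem tm_omegaInv (l : List ℕ) : Mor.tm (omegaInv k l) =
    ((Mor.id l.length).tensor (.tm eta)).comp (checkΦ k l) := by
  rw [omegaInv, Mor.tm_comp, Mor.tm_tensor, tm_thetaCheck]
  rfl

/-- Since `η` is grouplike, each unit splits into one for the first letter and one for the tail. The
tail cancels by induction. The other two units merge into one duplicated strand, which crosses the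
tail and acts on the first letter by an action and its inverse. -/
theorem omega_omegaInv (l : List ℕ) :
    (Mor.tm (omega k l)).comp (.tm (omegaInv k l)) = .id l.length := by
  rw [tm_omega, tm_omegaInv]
  induction l with
  | nil =>
    exact
      den_eq_of_check (σ := []) (f := (E.id [] ⊠ u ⨾ e) ⨾ E.id [] ⊠ u ⨾ e) (g := E.id [])
        (.of [] [] (.nil)) (.cons (one_counit.den _) <| .nil)
        [⟨0, false, 0, []⟩, ⟨0, false, 0, []⟩] [] (by decide +kernel)
  | cons a l ih =>
    rw [Slide.Φ, checkΦ, List.length_cons, add_comm, ← Mor.id_tensor_id]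
    exact
      den_eq_of_check (σ := [([0, 0], [0]), ([0, 0], [0]), ([1, 0], [0, 1]), ([1, 0], [1]), ([1, 0], [1])])
        (f := ((i 1 ⊠ E.id [1]) ⊠ u ⨾ i 1 ⊠ E.id [1] ⊠ D ⨾ i 1 ⊠ v 2 ⊠ i 1 ⨾ v 0 ⊠ v 3) ⨾ (i 1 ⊠
          E.id [1]) ⊠ u ⨾ i 1 ⊠ E.id [1] ⊠ D ⨾ i 1 ⊠ v 4 ⊠ i 1 ⨾ i 1 ⊠ v 2 ⨾ v 1 ⊠ E.id [1])
        (g := i 1 ⊠ E.id [1])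
        (.of [l.length] [(slide k).θ a, (actionInv k a).den thinEnv, (slide k).G l, (slide k).Φ l,
          checkΦ k l]
        (.cons ((slide k).θ_typed a) <| .cons (actionInv_typed k a) <| .cons ((slide k).G_typed l)
          <| .cons ((slide k).Φ_typed l) <| .cons (checkΦ_typed k l) .nil))
        (.cons (one_comul.den _) <|
        .cons (f := (E.id [1] ⊠ u ⨾ v 3) ⨾ E.id [1] ⊠ u ⨾ v 4) (g := E.id [1]) ih <|
        .cons (f := v 2 ⨾ D ⊠ E.id [1]) (g := E.id [1] ⊠ D ⨾ v 2 ⊠ i 1 ⨾ i 1 ⊠ v 2) ((slide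
          k).G_comul l) <|
        .cons (f := i 1 ⊠ D ⨾ v 0 ⊠ i 1 ⨾ v 1) (g := i 1 ⊠ e) (action_actionInv k a) <|
        .cons (f := v 2 ⨾ e ⊠ E.id [1]) (g := E.id [1] ⊠ e) ((slide k).G_counit l) <|
        .cons (one_counit.den _) <| .nil)
        [⟨0, false, 2, []⟩, ⟨0, false, 2, []⟩, ⟨1, false, 2, [2, 4]⟩, ⟨0, true, 2, []⟩, ⟨2, true,
          1, [0]⟩, ⟨3, false, 0, [0, 1]⟩, ⟨4, false, 1, [0]⟩, ⟨5, false, 2, []⟩] []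
        (by decide +kernel)

/-- The same cancellation in the other order: the first letter is cleared before the tail becomes
accessible to the induction hypothesis. -/
theorem omegaInv_omega (l : List ℕ) :
    (Mor.tm (omegaInv k l)).comp (.tm (omega k l)) = .id l.length := by
  rw [tm_omega, tm_omegaInv]
  induction l with
  | nil =>
    exact
      den_eq_of_check (σ := []) (f := (E.id [] ⊠ u ⨾ e) ⨾ E.id [] ⊠ u ⨾ e) (g := E.id [])
        (.of [] [] (.nil)) (.cons (one_counit.den _) <| .nil)
        [⟨0, false, 0, []⟩, ⟨0, false, 0, []⟩] [] (by decide +kernel)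
  | cons a l ih =>
    rw [Slide.Φ, checkΦ, List.length_cons, add_comm, ← Mor.id_tensor_id]
    exact
      den_eq_of_check (σ := [([0, 0], [0]), ([0, 0], [0]), ([1, 0], [0, 1]), ([1, 0], [1]), ([1, 0], [1])])
        (f := ((i 1 ⊠ E.id [1]) ⊠ u ⨾ i 1 ⊠ E.id [1] ⊠ D ⨾ i 1 ⊠ v 4 ⊠ i 1 ⨾ i 1 ⊠ v 2 ⨾ v 1 ⊠
          E.id [1]) ⨾ (i 1 ⊠ E.id [1]) ⊠ u ⨾ i 1 ⊠ E.id [1] ⊠ D ⨾ i 1 ⊠ v 2 ⊠ i 1 ⨾ v 0 ⊠ v 3)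
        (g := i 1 ⊠ E.id [1])
        (.of [l.length] [(slide k).θ a, (actionInv k a).den thinEnv, (slide k).G l, (slide k).Φ l,
          checkΦ k l]
        (.cons ((slide k).θ_typed a) <| .cons (actionInv_typed k a) <| .cons ((slide k).G_typed l)
          <| .cons ((slide k).Φ_typed l) <| .cons (checkΦ_typed k l) .nil))
        (.cons (one_comul.den _) <|
        .cons (f := v 2 ⨾ D ⊠ E.id [1]) (g := E.id [1] ⊠ D ⨾ v 2 ⊠ i 1 ⨾ i 1 ⊠ v 2) ((slide
          k).G_comul l) <|
        .cons (f := i 1 ⊠ D ⨾ v 1 ⊠ i 1 ⨾ v 0) (g := i 1 ⊠ e) (actionInv_action k a) <|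
        .cons (f := v 2 ⨾ e ⊠ E.id [1]) (g := E.id [1] ⊠ e) ((slide k).G_counit l) <|
        .cons (f := (E.id [1] ⊠ u ⨾ v 4) ⨾ E.id [1] ⊠ u ⨾ v 3) (g := E.id [1]) ih <|
        .cons (one_counit.den _) <| .nil)
        [⟨0, false, 2, []⟩, ⟨0, false, 2, []⟩, ⟨0, true, 2, [1, 2, 4]⟩, ⟨1, true, 1, [1, 2, 3]⟩,
          ⟨2, false, 0, [0, 1, 2, 3]⟩, ⟨3, false, 1, [0, 1, 2]⟩, ⟨4, false, 1, []⟩, ⟨5, false, 2,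
          []⟩] [] (by decide +kernel)

end BPHopf

namespace BPHopf

open StrictPres

local infixr:60 " ⨾ " => E.comp
local infixr:70 " ⊠ " => E.tensor

/-! ## Naturality for all morphisms of `MAlgF` -/

section

variable {k : ℕ} (hk : 1 ≤ k)

theorem of_eval_tensor {M : Type} [AddMonoid M] {G : M → M → Type} (φ : M →+ ℕ)
    (γ : ∀ a b : M, G a b → ((⟨φ a⟩ : FourAlg) ⟶ ⟨φ b⟩)) {a b c d : M} (f : Term G a b)
    (g : Term G c d) : Mor.of (Term.eval φ γ (.tensor f g)) =
      (Mor.of (Term.eval φ γ f)).tensor (.of (Term.eval φ γ g)) :=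
  Mor.of_eq_of_heq (congrArg Pres.mk (map_add φ a c)) (congrArg Pres.mk (map_add φ b d))
    (Term.eval_tensor_heq φ γ f g)

theorem of_forgetF_heq {A B A' B' : MAlgF} {f : A ⟶ B} {f' : A' ⟶ B'} (hA : A = A') (hB : B = B')
    (h : HEq f f') : Mor.of (forgetF.map f) = Mor.of (forgetF.map f') := by
  subst hA hB h
  rfl

theorem of_forgetF_tensor {A B C D : MAlgF} (f : A ⟶ B) (g : C ⟶ D) :
    Mor.of (forgetF.map (Pres.tensorMor f g)) =
      (Mor.of (forgetF.map f)).tensor (.of (forgetF.map g)) := by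
  obtain ⟨f, rfl⟩ := Pres.hom_surj f
  obtain ⟨g, rfl⟩ := Pres.hom_surj g
  exact of_eval_tensor lengthHom forgetGen f g

theorem of_forgetF_dite {P : Prop} [Decidable P] {A B : MAlgF} {f : P → (A ⟶ B)}
    {g : ¬P → (A ⟶ B)} {x y : E} (hf : ∀ h, Mor.of (forgetF.map (f h)) = x.den E.thinEnv)
    (hg : ∀ h, Mor.of (forgetF.map (g h)) = y.den E.thinEnv) :
    Mor.of (forgetF.map (if h : P then f h else g h)) = (if P then x else y).den E.thinEnv := by
  split_ifs with h
  exacts [hf h, hg h]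

theorem tm_ev : Mor.tm ev =
    (((E.i 1).tensor E.S).comp (E.m.comp E.l)).den E.thinEnv := by
  rw [ev, Mor.tm_comp, Mor.tm_comp, Mor.tm_tensor]
  rfl

theorem tm_W : Mor.tm W =
    (((E.i 1).tensor (E.L.comp E.D)).comp (E.m.tensor E.t)).den E.thinEnv := by
  rw [W, coev, Mor.tm_comp, Mor.tm_tensor, Mor.tm_tensor, Mor.tm_comp]
  rfl

theorem tm_WBar : Mor.tm WBar = ((E.T.tensor E.S).comp E.m).den E.thinEnv := by
  rw [WBar, Mor.tm_comp, Mor.tm_tensor]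
  rfl

theorem natural_gen {a b : FreeAddMonoid ℕ} (x : LGen a b) :
    (slide k).Natural (.of (forgetGen a b x)) (.of (forgetF.map (swapGen k hk a b x)))
      a.toList b.toList := by
  cases x with
  | ev i hi =>
    change (slide k).Natural (.tm ev) (.tm ev) [i, i] []
    rw [tm_ev]
    exact E.natural_ev hk i
  | comul i hi => exact E.natural_comul hk i
  | counit i hi => exact E.natural_counit hk i
  | integralElement i hi => exact E.natural_element hk i
  | ribbon i hi => exact E.natural_tau hk i
  | X i j hi hij =>
    have h : Mor.of (forgetF.map (swapGen k hk _ _ (.X i j hi hij))) =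
        (if i = k ∧ j = k + 1 then E.Xh else E.X).den E.thinEnv :=
      of_forgetF_dite (fun _ => rfl) (fun _ => rfl)
    rw [h]
    exact E.natural_X hk hij
  | YHat i j hi hij =>
    have h : Mor.of (forgetF.map (swapGen k hk _ _ (.YHat i j hi hij))) =
        (if i = k ∧ j = k + 1 then E.Y else E.Yh).den E.thinEnv :=
      of_forgetF_dite (fun _ => rfl) (fun _ => rfl)
    rw [h]
    exact E.natural_YHat hk hij
  | XHat i j hj hij =>
    have h : Mor.of (forgetF.map (swapGen k hk _ _ (.XHat i j hj hij))) =
        (if j = k ∧ i = k + 1 then E.X else E.Xh).den E.thinEnv :=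
      of_forgetF_dite (fun _ => rfl) (fun _ => rfl)
    rw [h]
    exact E.natural_XHat hk hij
  | Y i j hj hij =>
    have h : Mor.of (forgetF.map (swapGen k hk _ _ (.Y i j hj hij))) =
        (if j = k ∧ i = k + 1 then E.Yh else E.Y).den E.thinEnv :=
      of_forgetF_dite (fun _ => rfl) (fun _ => rfl)
    rw [h]
    exact E.natural_Y hk hij
  | W i hi =>
    -- The transport records that `0` is not affected by the exchange, since `k ≥ 1`; it disappears
    -- in `Mor`.
    unfold swapGen
    rw [of_forgetF_heq (congrArg Pres.mk (swapHom_zero hk)) rfl (eqToHom_comp_heq _ _)]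
    change (slide k).Natural (.tm W) (.tm W) [0] [i, i]
    rw [tm_W]
    exact E.natural_W hk i
  | WBar i hi =>
    unfold swapGen
    rw [of_forgetF_heq rfl (congrArg Pres.mk (swapHom_zero hk)) (comp_eqToHom_heq _ _)]
    change (slide k).Natural (.tm WBar) (.tm WBar) [i, i] [0]
    rw [tm_WBar]
    exact E.natural_WBar hk i
  | U _ hl hpos =>
    have h : (swapHom k a).toList.length = a.toList.length := List.length_map _
    change (slide k).Natural (.tm (U a.toList.length)) (.tm (U (swapHom k a).toList.length)) _ _
    rw [h]
    exact Slide.Natural.U (slide k) a.toList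

/-- Formal morphisms are built from generators by composition and tensor product, under which
natural pairs are closed. -/
theorem natural_term {a b : FreeAddMonoid ℕ} (t : Term LGen a b) :
    (slide k).Natural (.of (forgetF.map (Pres.hom t)))
      (.of ((swapLabels k hk ⋙ forgetF).map (Pres.hom t))) a.toList b.toList := by
  induction t with
  | id a =>
    have h : (Mor.of ((swapLabels k hk ⋙ forgetF).map (Pres.hom (.id a)))) =
        .id a.toList.length := congrArg Mor.id (List.length_map (as := a.toList) (swap k))
    rw [h]
    exact Slide.Natural.id a.toList
  | comp f g hf hg =>
    rw [Pres.hom_comp, Functor.map_comp, Functor.map_comp, Mor.of_comp, Mor.of_comp]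
    exact hf.comp hg
  | @tensor a b c d f g hf hg =>
    have h : Mor.of (forgetF.map (Pres.hom (.tensor f g))) = _ :=
      of_forgetF_tensor (Pres.hom f) (Pres.hom g)
    have h' : Mor.of ((swapLabels k hk ⋙ forgetF).map (Pres.hom (.tensor f g))) = _ :=
      (of_forgetF_heq (congrArg Pres.mk (map_add (swapHom k) a c))
        (congrArg Pres.mk (map_add (swapHom k) b d))
        (Term.eval_tensor_heq (swapHom k) (swapGen k hk) f g)).trans
      (of_forgetF_tensor ((swapLabels k hk).map (Pres.hom f)) ((swapLabels k hk).map (Pres.hom g)))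
    rw [h, h']
    exact hf.tensor hg
  | gen x => exact natural_gen hk x

theorem natural_map {A B : MAlgF} (f : A ⟶ B) :
    (slide k).Natural (.of (forgetF.map f)) (.of ((swapLabels k hk ⋙ forgetF).map f))
      A.as.toList B.as.toList := by
  obtain ⟨t, rfl⟩ := Pres.hom_surj f
  exact natural_term hk t

/-! ### Descent to `MAlg` and the two natural transformations. -/

namespace Slide.Natural

open E

theorem omega {F F' : Mor} {l p : List ℕ} (h : (slide k).Natural F F' l p) :
    F.comp (.tm (omega k p)) = (Mor.tm (BPHopf.omega k l)).comp F' := by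
  rw [tm_omega, tm_omega]
  exact
    den_eq_of_check (σ := [([1], [2]), ([1], [2]), ([1, 0], [1]), ([2, 0], [2])])
      (f := v 0 ⨾ E.id [2] ⊠ u ⨾ v 3) (g := (E.id [1] ⊠ u ⨾ v 2) ⨾ v 1)
      (.of [l.length, p.length] [F, F', (slide k).Φ l, (slide k).Φ p]
      (.cons (h.typed) <| .cons (h.typed') <| .cons ((slide k).Φ_typed l) <| .cons ((slide
        k).Φ_typed p) .nil)) (.cons (f := v 0 ⊠ i 1 ⨾ v 3) (g := v 2 ⨾ v 1) h.Φ <| .nil)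
      [⟨0, false, 0, [1]⟩] [] (by decide +kernel)

/-- The relabeled morphism is the conjugate of `F` by `Ω` and so depends on `F` alone. This is why
the exchange of labels respects the kernel congruence. -/
theorem eq_omegaInv {F F' : Mor} {l p : List ℕ} (h : (slide k).Natural F F' l p) :
    F' = (Mor.tm (BPHopf.omegaInv k l)).comp (F.comp (.tm (BPHopf.omega k p))) := by
  rw [h.omega, ← Mor.comp_assoc, omegaInv_omega, Mor.id_comp h.typed'.1.symm]
  · rfl
  · exact h.typed'.1.symm

end Slide.Natural

variable (k) in
/-- The functor induced by the exchange of labels. -/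
def exchanged : MAlg ⥤ FourAlg :=
  CategoryTheory.Quotient.lift forgetF.homRel (swapLabels k hk ⋙ forgetF) fun A B f g h => by
    apply Mor.of_injective
    rw [(natural_map hk f).eq_omegaInv, (natural_map hk g).eq_omegaInv, show forgetF.map f = forgetF.map g from h]

theorem toMAlg_exchanged : toMAlg ⋙ exchanged k hk = swapLabels k hk ⋙ forgetF :=
  CategoryTheory.Quotient.lift_spec _ _ _

theorem natural_exchanged {A B : MAlg} (f : A ⟶ B) :
    (slide k).Natural (.of (forget.map f)) (.of ((exchanged k hk).map f))
      A.as.as.toList B.as.as.toList := by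
  obtain ⟨f, rfl⟩ := (CategoryTheory.Quotient.functor forgetF.homRel).map_surjective f
  exact natural_map hk f

theorem obj_eq_exchanged (A : MAlg) :
    (⟨A.as.as.toList.length⟩ : FourAlg) = (exchanged k hk).obj A :=
  obj_eq (toMAlg_exchanged hk) A.as.as.toList

theorem of_comp_eqToHom {A B C : FourAlg} (f : A ⟶ B) (h : B = C) :
    Mor.of (f ≫ eqToHom h) = .of f := by
  subst h
  rw [eqToHom_refl, Category.comp_id]

theorem of_eqToHom_comp {A B C : FourAlg} (h : A = B) (f : B ⟶ C) :
    Mor.of (eqToHom h ≫ f) = .of f := by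
  subst h
  rw [eqToHom_refl, Category.id_comp]

/-- The components of `Θ̂`. -/
def thetaApp (A : MAlg) : (forget ⋙ tensorRight H).obj A ⟶ (exchanged k hk).obj A :=
  Pres.hom (thetaHat k A.as.as.toList) ≫ eqToHom (obj_eq_exchanged hk A)

/-- The components of `Ω`. -/
def omegaApp (A : MAlg) : forget.obj A ⟶ (exchanged k hk).obj A :=
  Pres.hom (omega k A.as.as.toList) ≫ eqToHom (obj_eq_exchanged hk A)

/-- The components of `Ω⁻¹`. -/
def omegaInvApp (A : MAlg) : (exchanged k hk).obj A ⟶ forget.obj A :=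
  eqToHom (obj_eq_exchanged hk A).symm ≫ Pres.hom (omegaInv k A.as.as.toList)

theorem of_thetaApp (A : MAlg) :
    Mor.of (thetaApp hk A) = (slide k).Φ A.as.as.toList :=
  (of_comp_eqToHom _ _).trans (tm_thetaHat k A.as.as.toList)

theorem of_omegaApp (A : MAlg) : Mor.of (omegaApp hk A) = .tm (omega k A.as.as.toList) :=
  of_comp_eqToHom _ _

theorem of_omegaInvApp (A : MAlg) :
    Mor.of (omegaInvApp hk A) = .tm (omegaInv k A.as.as.toList) :=
  of_eqToHom_comp _ _

/-- The natural transformation `Θ̂`. -/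
def thetaNat : forget ⋙ tensorRight H ⟶ exchanged k hk where
  app := thetaApp hk
  naturality A B f := by
    apply Mor.of_injective
    rw [Mor.of_comp, Mor.of_comp, of_thetaApp, of_thetaApp]
    exact (natural_exchanged hk f).Φ

theorem omegaApp_naturality {A B : MAlg} (f : A ⟶ B) :
    forget.map f ≫ omegaApp hk B = omegaApp hk A ≫ (exchanged k hk).map f := by
  apply Mor.of_injective
  rw [Mor.of_comp, Mor.of_comp, of_omegaApp, of_omegaApp]
  exact (natural_exchanged hk f).omega

/-- The natural isomorphism `Ω`. -/
def omegaIso : forget ≅ exchanged k hk :=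
  NatIso.ofComponents
    (fun A =>
      { hom := omegaApp hk A
        inv := omegaInvApp hk A
        hom_inv_id := by
          apply Mor.of_injective
          rw [Mor.of_comp, of_omegaApp, of_omegaInvApp]
          exact omega_omegaInv k _
        inv_hom_id := by
          apply Mor.of_injective
          rw [Mor.of_comp, of_omegaApp, of_omegaInvApp]
          exact (omegaInv_omega k _).trans (congrArg (fun B : FourAlg => Mor.id B.as)
            (obj_eq_exchanged hk A)) })
    (fun f => omegaApp_naturality hk f)

end

end BPHopf

theorem mainTheorem10 (k : ℕ) (hk : 1 ≤ k) :
    ∃ (Fhat : BPHopf.MAlg ⥤ BPHopf.FourAlg)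
      (hF : BPHopf.toMAlg ⋙ Fhat = BPHopf.swapLabels k hk ⋙ BPHopf.forgetF),
      (∀ G : BPHopf.MAlg ⥤ BPHopf.FourAlg,
        BPHopf.toMAlg ⋙ G = BPHopf.swapLabels k hk ⋙ BPHopf.forgetF → G = Fhat) ∧
      (∃ θ : BPHopf.forget ⋙ tensorRight BPHopf.H ⟶ Fhat,
        ∀ l : List ℕ, θ.app (BPHopf.ob l) =
          StrictPres.Pres.hom (BPHopf.thetaHat k l) ≫ eqToHom (BPHopf.obj_eq hF l)) ∧
      (∃ ω : BPHopf.forget ≅ Fhat,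
        ∀ l : List ℕ,
          ω.hom.app (BPHopf.ob l) =
            StrictPres.Pres.hom (BPHopf.omega k l) ≫ eqToHom (BPHopf.obj_eq hF l) ∧
          ω.inv.app (BPHopf.ob l) =
            eqToHom (BPHopf.obj_eq hF l).symm ≫ StrictPres.Pres.hom (BPHopf.omegaInv k l)) := by
  -- The word underlying `ob l` is `l` itself, so the prescribed components hold by `rfl`.
  -- Uniqueness is the universal property of the quotient category.
  refine ⟨BPHopf.exchanged k hk, BPHopf.toMAlg_exchanged hk, fun G hG => ?_,
    ⟨BPHopf.thetaNat hk, fun l => rfl⟩, BPHopf.omegaIso hk, fun l => ⟨rfl, rfl⟩⟩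
  exact CategoryTheory.Quotient.lift_unique' _ _ _ (hG.trans (BPHopf.toMAlg_exchanged hk).symm)
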